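/- All graphs are finite and simple, with at least two vertices. A triangulation of a surface is a connected graph with at least three vertices that has a 2-cell embedding in the surface all of whose facial walks have length three. Proposition. Let $G$ be a graph with at least two vertices that is embeddable in the projective plane (not necessarily with all faces discs; in particular $G$ may be planar or disconnected). Then at least one of the following holds: (a) $G$ is a spanning subgraph of a triangulation of the plane or of the projective plane, i.e. there is a graph $H$ with $V(H)=V(G)$ and $E(G)\subseteq E(H)$ that triangulates the plane (sphere) or the projective plane. (b) $G$ contains two distinct vertices $u,v$, each of degree at most $3$ in $G$, such that the graph $G-u-v$ is planar. (c) $G$ contains two adjacent vertices $u,v$, each of degree at most $4$ in $G$, such that the graph $G-u-v$ is planar. Embeddings are described combinatorially, by embedding schemes (a rotation at every vertex and a signature $\pm 1$ on every edge). The faces of a scheme are the facial walks up to direction, and one face for each isolated vertex. If $G$ has $n$ vertices, $m$ edges and $c$ connected components, and the scheme has $f$ faces, its Euler genus is $2c-(n-m+f)$. A graph is planar if it has a scheme of Euler genus $0$, and embeddable in the projective plane if it has a scheme of Euler genus $0$ or $1$; a triangulation of the plane (of the projective plane) is one given by a scheme of Euler genus $0$ (of Euler genus $1$). -/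

import Mathlib

namespace SimpleGraph

/-- An embedding scheme (rotation system with signature) of a simple graph `G`: at every vertex a
cyclic permutation of the darts (oriented edges) leaving it, the local rotation, and for every
edge a signature, which is `1` when the local orientations at its two ends agree along the edge
and `-1` when they do not. Embedding schemes are the combinatorial description of 2-cell
embeddings of graphs in closed surfaces, orientable or not. -/
structure EmbeddingScheme {V : Type*} (G : SimpleGraph V) where
  /-- The local rotations, all together. -/
  rot : Equiv.Perm G.Dart
  /-- The rotation maps every dart to a dart leaving the same vertex. -/
  rot_fst : ∀ d : G.Dart, (rot d).fst = d.fst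
  /-- All darts leaving one vertex form a single cycle of the rotation. -/
  rot_cyclic : ∀ d d' : G.Dart, d.fst = d'.fst → rot.SameCycle d d'
  /-- The signature of the edges. -/
  sign : G.edgeSet → ℤˣ

namespace EmbeddingScheme

variable {V : Type*} {G : SimpleGraph V}

/-- The signature of the edge that carries a dart. -/
def dartSign (S : EmbeddingScheme G) (d : G.Dart) : ℤˣ :=
  S.sign ⟨d.edge, d.edge_mem⟩

theorem dartSign_symm (S : EmbeddingScheme G) (d : G.Dart) :
    S.dartSign d.symm = S.dartSign d := by
  unfold dartSign
  congr 1
  exact Subtype.ext d.edge_symm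

/-- A flag `(d, ε)` is a dart `d` about to be traversed on one of its two sides, the side
being given by the orientation `ε` that is used at the start of `d`
(`1`: the one of the local rotation, `-1`: the opposite one). -/
abbrev Flag (_S : EmbeddingScheme G) : Type _ := G.Dart × ℤˣ

/-- Walk along the dart: the result is the dart back, with the orientation transported to the
far end of the edge. -/
def cross (S : EmbeddingScheme G) : Equiv.Perm S.Flag where
  toFun x := (x.1.symm, x.2 * S.dartSign x.1)
  invFun x := (x.1.symm, x.2 * S.dartSign x.1)
  left_inv x := by
    ext1
    · simp
    · simp only [dartSign_symm, mul_assoc, Int.units_mul_self, mul_one]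
  right_inv x := by
    ext1
    · simp
    · simp only [dartSign_symm, mul_assoc, Int.units_mul_self, mul_one]

/-- Turn at a vertex to the next dart in the sense of the current orientation. -/
def turn (S : EmbeddingScheme G) : Equiv.Perm S.Flag where
  toFun x := ((S.rot ^ (x.2 : ℤ)) x.1, x.2)
  invFun x := ((S.rot ^ (-(x.2 : ℤ))) x.1, x.2)
  left_inv x := by simp
  right_inv x := by simp

/-- One step of the face traversal procedure: walk along the dart, then turn. The cycles of this
permutation are the facial walks, each face being walked around once in each direction. -/
def faceStep (S : EmbeddingScheme G) : Equiv.Perm S.Flag :=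
  S.cross.trans S.turn

/-- The flag that traverses the same side of the same edge in the opposite direction. -/
def reverse (S : EmbeddingScheme G) : Equiv.Perm S.Flag :=
  S.cross.trans ((Equiv.refl G.Dart).prodCongr (Equiv.neg ℤˣ))

/-- The faces. A face of a component with edges is a facial walk up to its direction, that is, an
orbit of the flags under face traversal and reversal; a component that consists of one isolated
vertex (embedded in a sphere) has exactly one face. -/
def Face (S : EmbeddingScheme G) : Type _ :=
  MulAction.orbitRel.Quotient (Subgroup.closure {S.faceStep, S.reverse}) S.Flag ⊕
    {v : V // ∀ w, ¬ G.Adj v w}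

/-- The Euler genus of an embedding scheme of a finite graph. If the graph is connected, this is
`2 - χ`, where `χ = |V| - |E| + |F|` is the Euler characteristic of the closed surface on which
the scheme embeds the graph. In general the scheme embeds every component on a surface of its own,
and this is the sum of `2 - χ` over the components, that is, `2 - χ` for the connected sum of these
surfaces, on which the whole graph is embedded. -/
noncomputable def eulerGenus [Finite V] (S : EmbeddingScheme G) : ℤ :=
  2 * (Nat.card G.ConnectedComponent : ℤ)
    - ((Nat.card V : ℤ) - (Nat.card G.edgeSet : ℤ) + (Nat.card S.Face : ℤ))

/-- The scheme triangulates its surface: the graph is connected, has at least three vertices, and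
every facial walk has length three (and so is a triangle of `G`, as `G` is simple). -/
def IsTriangular [Finite V] (S : EmbeddingScheme G) : Prop :=
  G.Connected ∧ 3 ≤ Nat.card V ∧ ∀ x : S.Flag, Function.minimalPeriod S.faceStep x = 3

end EmbeddingScheme

variable {V : Type*} [Finite V]

/-- `G` is embeddable in the plane (equivalently, the sphere: the surface of Euler genus `0`). -/
def IsPlanar (G : SimpleGraph V) : Prop :=
  ∃ S : EmbeddingScheme G, S.eulerGenus = 0

/-- `G` is embeddable, not necessarily with all faces discs, in the projective plane (the surface
of Euler genus `1`): it is 2-cell embeddable there or it is planar, where for disconnected graphs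
the Euler genera of the components add up. -/
def IsProjectivePlanar (G : SimpleGraph V) : Prop :=
  ∃ S : EmbeddingScheme G, S.eulerGenus = 0 ∨ S.eulerGenus = 1

/-- `G` is (the graph of) a triangulation of the plane. -/
def IsPlaneTriangulation (G : SimpleGraph V) : Prop :=
  ∃ S : EmbeddingScheme G, S.IsTriangular ∧ S.eulerGenus = 0

/-- `G` is (the graph of) a triangulation of the projective plane. -/
def IsProjectiveTriangulation (G : SimpleGraph V) : Prop :=
  ∃ S : EmbeddingScheme G, S.IsTriangular ∧ S.eulerGenus = 1

end SimpleGraph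

set_option linter.unusedSectionVars false
-- Rotation systems on the vertex set, their faces, and labels of flags modulo two
namespace SimpleGraph

/-! On at most five vertices (b) or (c) holds trivially: all degrees are at most four, and deleting
two vertices leaves at most three, hence a planar graph. From six vertices on, (a) always holds: `G`
is enlarged to a graph `H` on the same vertices that is projective planar with an inclusion-maximal
edge set, and `H` is shown to be triangulated, by a planar embedding if it has one and by any
projective one otherwise.

The topology is done by homology over the field with two elements. A set of faces is a label of the
flags that is constant on faces; its boundary is an element of the cycle space, and the Euler genus
is the dimension of the cycle space modulo boundaries (`eulerGenus_toScheme`). Genus zero means that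
all cycles bound; genus at most one means that for any two cycles one of them or their sum bounds
(`eulerGenus_le_one_iff`). A chord drawn in a face is a label that jumps at the two corners where
the chord ends (`IsLink`), and inserting an edge along a chord preserves both conditions
(`exists_addEdge_of_isLink`).

Maximality yields the properties in `IsSaturated`. `H` is connected, vertices on a common face are
adjacent, facial walks do not turn back, and the two sides of an edge are different faces. Moreover,
an edge whose ends both lie on a third face could be moved there, so the vertices of the two faces
that it separated must already be pairwise equal or adjacent.

On a face that is not a triangle, three consecutive vertices span a triangle that does not bound,
since otherwise it would separate the ends of a chord of the face. In the plane every triangle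
bounds, so all faces are triangles. In the projective plane the sum of two such triangles bounds,
which leaves only cycles of length three, four and five as faces (`face_cases`). A pentagon forces
five triangular faces on its vertices; a quadrangle forces a second one on the same four vertices,
together with four triangles with a common apex. Either way six faces have total boundary zero, so
they are all the faces and `H` has only five vertices (`FacePent.false_of_card`,
`FaceQuadPair.false_of_card`). -/

theorem perm_apply_inv {α : Type*} (σ : Equiv.Perm α) (x : α) : σ (σ⁻¹ x) = x := by simp

theorem perm_inv_apply {α : Type*} (σ : Equiv.Perm α) (x : α) : σ⁻¹ (σ x) = x := by simp

/-- A rotation system with signature, given by permutations of the vertex set: the permutation at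
`u` rotates the neighbours of `u` and fixes the other vertices. -/
structure RotationSystem {V : Type*} (G : SimpleGraph V) where
  /-- The rotation at a vertex. -/
  rot : V → Equiv.Perm V
  /-- The signature. -/
  sgn : V → V → ℤˣ
  sgn_comm : ∀ u w, sgn u w = sgn w u
  isCycleOn_rot : ∀ u, (rot u).IsCycleOn (G.neighborSet u)
  rot_of_not_adj : ∀ u w, ¬ G.Adj u w → rot u w = w

namespace RotationSystem

variable {V : Type*} {G : SimpleGraph V} (E : RotationSystem G)

theorem adj_rot_iff {u w : V} : G.Adj u (E.rot u w) ↔ G.Adj u w :=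
  (E.isCycleOn_rot u).apply_mem_iff

theorem adj_rot_inv_iff {u w : V} : G.Adj u ((E.rot u)⁻¹ w) ↔ G.Adj u w := by
  rw [← E.adj_rot_iff, perm_apply_inv]

theorem adj_rot_zpow_iff {u w : V} (ε : ℤˣ) : G.Adj u ((E.rot u ^ (ε : ℤ)) w) ↔ G.Adj u w := by
  rcases Int.units_eq_one_or ε with rfl | rfl
  · simpa using E.adj_rot_iff
  · simpa using E.adj_rot_inv_iff

/-- The flag on the same side of the same edge in the opposite direction. -/
def rev (f : V × V × ℤˣ) : V × V × ℤˣ := (f.2.1, f.1, -(f.2.2 * E.sgn f.1 f.2.1))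

theorem rev_mk (u w : V) (ε : ℤˣ) : E.rev (u, w, ε) = (w, u, -(ε * E.sgn u w)) := rfl

@[simp] theorem rev_rev (f : V × V × ℤˣ) : E.rev (E.rev f) = f := by
  obtain ⟨u, w, ε⟩ := f
  simp [rev, E.sgn_comm w u, mul_assoc, Int.units_mul_self]

theorem rev_injective : Function.Injective E.rev := fun x y h => by
  rw [← E.rev_rev x, h, E.rev_rev]

/-- Face traversal without its inverse. -/
def stepFun (f : V × V × ℤˣ) : V × V × ℤˣ :=
  (f.2.1, (E.rot f.2.1 ^ ((f.2.2 * E.sgn f.1 f.2.1 : ℤˣ) : ℤ)) f.1, f.2.2 * E.sgn f.1 f.2.1)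

/-- Reversal conjugates face traversal to its inverse. This supplies the inverse of `step` without
any computation with inverse rotations. -/
theorem rev_stepFun_rev_stepFun (f : V × V × ℤˣ) :
    E.rev (E.stepFun (E.rev (E.stepFun f))) = f := by
  obtain ⟨u, w, ε⟩ := f
  have key : ∀ δ : ℤˣ, ∀ x : V,
      (E.rot w ^ ((-δ : ℤˣ) : ℤ)) ((E.rot w ^ (δ : ℤ)) x) = x := by
    intro δ x
    simp
  have h : ∀ (t : V) (δ : ℤˣ), -(δ * E.sgn w t) * E.sgn t w = -δ := by
    intro t δ
    rw [E.sgn_comm t w, neg_mul, mul_assoc, Int.units_mul_self, mul_one]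
  simp only [rev, stepFun, h, key]
  rw [E.sgn_comm w u, neg_mul, neg_neg, mul_assoc, Int.units_mul_self, mul_one]

/-- Face traversal: walk along the edge, then turn. -/
def step : Equiv.Perm (V × V × ℤˣ) where
  toFun := E.stepFun
  invFun f := E.rev (E.stepFun (E.rev f))
  left_inv f := E.rev_stepFun_rev_stepFun f
  right_inv f := by
    have h := E.rev_stepFun_rev_stepFun (E.rev f)
    exact E.rev_injective h

theorem step_mk (u w : V) (ε : ℤˣ) : E.step (u, w, ε) =
    (w, (E.rot w ^ ((ε * E.sgn u w : ℤˣ) : ℤ)) u, ε * E.sgn u w) := rfl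

theorem step_fst (f : V × V × ℤˣ) : (E.step f).1 = f.2.1 := rfl

theorem step_inv (f : V × V × ℤˣ) : E.step⁻¹ f = E.rev (E.step (E.rev f)) := rfl

/-- Every corner carries two flags, `(u, x, -1)` and `(u, E.rot u x, 1)`, and `step` after `rev`
exchanges them. For this reason constancy on faces needs testing only across edge sides and at
corners, as in `IsFaceLabel`. -/
theorem step_rev_neg_one (u x : V) : E.step (E.rev (u, x, -1)) = (u, E.rot u x, 1) := by
  simp [rev_mk, step_mk, E.sgn_comm x u, Int.units_mul_self]

theorem step_rev_one (u x : V) : E.step (E.rev (u, x, 1)) = (u, (E.rot u)⁻¹ x, -1) := by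
  simp [rev_mk, step_mk, E.sgn_comm x u, Int.units_mul_self]

theorem rev_step (f : V × V × ℤˣ) : E.rev (E.step f) = E.step⁻¹ (E.rev f) := by
  rw [step_inv, rev_rev]

theorem rev_step_pow (f : V × V × ℤˣ) (n : ℕ) :
    E.rev ((E.step ^ n) f) = (E.step ^ n)⁻¹ (E.rev f) := by
  induction n generalizing f with
  | zero => simp
  | succ n ih =>
    rw [pow_succ, Equiv.Perm.mul_apply, ih, rev_step, mul_inv_rev, Equiv.Perm.mul_apply]
    rw [← Equiv.Perm.mul_apply, ← Equiv.Perm.mul_apply]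
    congr 1
    group

theorem adj_step {f : V × V × ℤˣ} (h : G.Adj f.1 f.2.1) :
    G.Adj (E.step f).1 (E.step f).2.1 := by
  obtain ⟨u, w, ε⟩ := f
  exact (E.adj_rot_zpow_iff _).2 h.symm

theorem adj_rev {f : V × V × ℤˣ} (h : G.Adj f.1 f.2.1) :
    G.Adj (E.rev f).1 (E.rev f).2.1 := h.symm

theorem adj_step_inv {f : V × V × ℤˣ} (h : G.Adj f.1 f.2.1) :
    G.Adj (E.step⁻¹ f).1 (E.step⁻¹ f).2.1 :=
  E.adj_rev (E.adj_step (E.adj_rev h))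

theorem adj_step_pow {f : V × V × ℤˣ} (h : G.Adj f.1 f.2.1) (n : ℕ) :
    G.Adj ((E.step ^ n) f).1 ((E.step ^ n) f).2.1 := by
  induction n with
  | zero => exact h
  | succ n ih => rw [pow_succ', Equiv.Perm.mul_apply]; exact E.adj_step ih

/-- No flag is fixed by reversal, nor reversed by a power of the face traversal. -/
theorem rev_ne_step_pow (n : ℕ) (f : V × V × ℤˣ) (h : G.Adj f.1 f.2.1) :
    E.rev f ≠ (E.step ^ n) f := by
  induction n using Nat.strong_induction_on generalizing f with
  | _ n ih =>
  intro heq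
  match n, ih, heq with
  | 0, _, heq =>
    obtain ⟨u, w, ε⟩ := f
    simp only [rev_mk, pow_zero, Equiv.Perm.coe_one, id_eq, Prod.mk.injEq] at heq
    exact h.ne heq.2.1
  | 1, _, heq =>
    obtain ⟨u, w, ε⟩ := f
    simp only [rev_mk, pow_one, step_mk, Prod.mk.injEq] at heq
    have := heq.2.2
    rcases Int.units_eq_one_or (ε * E.sgn u w) with h1 | h1 <;> rw [h1] at this <;>
      exact absurd this (by decide)
  | n + 2, ih, heq =>
    refine ih n (by omega) (E.step f) (E.adj_step h) ?_
    rw [rev_step, heq, pow_succ', Equiv.Perm.mul_apply, perm_inv_apply, pow_succ,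
      Equiv.Perm.mul_apply]

/-- Two flags lie on the same face. -/
def SameFace (f g : V × V × ℤˣ) : Prop := E.step.SameCycle f g ∨ E.step.SameCycle f (E.rev g)

theorem sameCycle_rev_rev {f g : V × V × ℤˣ} (h : E.step.SameCycle f g) :
    E.step.SameCycle (E.rev f) (E.rev g) := by
  obtain ⟨i, hi⟩ := h
  refine ⟨-i, ?_⟩
  rw [← hi]
  obtain ⟨n, rfl | rfl⟩ := i.eq_nat_or_neg
  · rw [zpow_natCast, rev_step_pow]; simp
  · rw [neg_neg, zpow_neg, zpow_natCast]
    have := E.rev_step_pow ((E.step ^ n)⁻¹ f) n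
    rw [perm_apply_inv, Equiv.Perm.eq_inv_iff_eq] at this
    exact this

theorem SameFace.refl (f : V × V × ℤˣ) : E.SameFace f f := Or.inl (Equiv.Perm.SameCycle.refl _ _)

theorem SameFace.symm {f g : V × V × ℤˣ} (h : E.SameFace f g) : E.SameFace g f := by
  rcases h with h | h
  · exact Or.inl h.symm
  · right
    have := E.sameCycle_rev_rev h
    rw [rev_rev] at this
    exact this.symm

theorem SameFace.trans {f g k : V × V × ℤˣ} (h : E.SameFace f g) (h' : E.SameFace g k) :
    E.SameFace f k := by
  rcases h with h | h <;> rcases h' with h' | h'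
  · exact Or.inl (h.trans h')
  · exact Or.inr (h.trans h')
  · exact Or.inr (h.trans (E.sameCycle_rev_rev h'))
  · have := E.sameCycle_rev_rev h'
    rw [rev_rev] at this
    exact Or.inl (h.trans this)

theorem sameFace_rev (f : V × V × ℤˣ) : E.SameFace f (E.rev f) :=
  Or.inr (by rw [rev_rev])

theorem sameFace_step (f : V × V × ℤˣ) : E.SameFace f (E.step f) :=
  Or.inl ⟨1, by simp⟩

theorem sameFace_step_pow (f : V × V × ℤˣ) (n : ℕ) : E.SameFace f ((E.step ^ n) f) :=
  Or.inl ⟨n, by simp⟩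

/-- The value of a flag label is the same on the two flags of every side of every edge. -/
def EdgeCompat (L : V × V × ℤˣ → ZMod 2) : Prop :=
  ∀ f : V × V × ℤˣ, G.Adj f.1 f.2.1 → L (E.rev f) = L f

/-- The jump of a flag label at the corner that follows the dart from `u` to `x`. -/
def jump (L : V × V × ℤˣ → ZMod 2) (u x : V) : ZMod 2 := L (u, x, -1) + L (u, E.rot u x, 1)

/-- A flag label that is constant on faces. -/
def IsFaceLabel (L : V × V × ℤˣ → ZMod 2) : Prop :=
  E.EdgeCompat L ∧ ∀ u x, G.Adj u x → E.jump L u x = 0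

/-- A label that jumps at two given corners only. -/
def IsLink [DecidableEq V] (L : V × V × ℤˣ → ZMod 2) (c c' : V × V) : Prop :=
  E.EdgeCompat L ∧ ∀ u x, G.Adj u x →
    E.jump L u x = (if (u, x) = c then 1 else 0) + (if (u, x) = c' then 1 else 0)

/-- The corner of a flag. -/
def corner (f : V × V × ℤˣ) : V × V := (f.1, if f.2.2 = 1 then (E.rot f.1)⁻¹ f.2.1 else f.2.1)

variable {E}

theorem zmod_two_eq (x : ZMod 2) : x = 0 ∨ x = 1 := by
  revert x; decide

theorem zmod_two_add_eq_zero {x y : ZMod 2} : x + y = 0 ↔ x = y := by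
  revert x y; decide

theorem IsFaceLabel.rev {L : V × V × ℤˣ → ZMod 2} (hL : E.IsFaceLabel L) {f : V × V × ℤˣ}
    (hf : G.Adj f.1 f.2.1) : L (E.rev f) = L f := hL.1 f hf

theorem IsFaceLabel.rot_one {L : V × V × ℤˣ → ZMod 2} (hL : E.IsFaceLabel L) {u x : V}
    (h : G.Adj u x) : L (u, E.rot u x, 1) = L (u, x, -1) :=
  (zmod_two_add_eq_zero.1 (hL.2 u x h)).symm

/-- A step is a reversal followed by the exchange of the two flags of a corner; the two halves of
`IsFaceLabel` deal with one move each. -/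
theorem IsFaceLabel.step {L : V × V × ℤˣ → ZMod 2} (hL : E.IsFaceLabel L) {f : V × V × ℤˣ}
    (hf : G.Adj f.1 f.2.1) : L (E.step f) = L f := by
  have h1 : f = E.rev (E.rev f) := by simp
  rw [← hL.rev hf]
  have h2 := E.adj_rev hf
  generalize E.rev f = g at h1 h2
  subst h1
  obtain ⟨u, x, ε⟩ := g
  rcases Int.units_eq_one_or ε with rfl | rfl
  · rw [step_rev_one]
    have := hL.rot_one (u := u) (x := (E.rot u)⁻¹ x) (E.adj_rot_inv_iff.2 h2)
    rw [perm_apply_inv] at this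
    exact this.symm
  · rw [step_rev_neg_one]
    exact hL.rot_one h2

theorem IsFaceLabel.step_pow {L : V × V × ℤˣ → ZMod 2} (hL : E.IsFaceLabel L) {f : V × V × ℤˣ}
    (hf : G.Adj f.1 f.2.1) (n : ℕ) : L ((E.step ^ n) f) = L f := by
  induction n with
  | zero => rfl
  | succ n ih =>
    rw [pow_succ', Equiv.Perm.mul_apply, hL.step (E.adj_step_pow hf n), ih]

theorem IsFaceLabel.sameCycle [Finite V] {L : V × V × ℤˣ → ZMod 2} (hL : E.IsFaceLabel L)
    {f g : V × V × ℤˣ} (hf : G.Adj f.1 f.2.1) (h : E.step.SameCycle f g) : L g = L f := by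
  obtain ⟨n, -, rfl⟩ := h.exists_pow_eq'
  exact hL.step_pow hf n

theorem IsFaceLabel.sameFace [Finite V] {L : V × V × ℤˣ → ZMod 2} (hL : E.IsFaceLabel L)
    {f g : V × V × ℤˣ} (hf : G.Adj f.1 f.2.1) (hg : G.Adj g.1 g.2.1)
    (h : E.SameFace f g) : L g = L f := by
  rcases h with h | h
  · exact hL.sameCycle hf h
  · rw [← hL.rev hg]
    exact hL.sameCycle hf h

theorem IsFaceLabel.add {L L' : V × V × ℤˣ → ZMod 2} (hL : E.IsFaceLabel L)
    (hL' : E.IsFaceLabel L') : E.IsFaceLabel (L + L') := by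
  refine ⟨fun f hf => ?_, fun u x h => ?_⟩
  · simp [hL.1 f hf, hL'.1 f hf]
  · have h1 := hL.2 u x h
    have h2 := hL'.2 u x h
    simp only [jump, Pi.add_apply] at *
    linear_combination h1 + h2

theorem isFaceLabel_const (k : ZMod 2) : E.IsFaceLabel (fun _ => k) :=
  ⟨fun _ _ => rfl, fun _ _ _ => zmod_two_add_eq_zero.2 rfl⟩

theorem EdgeCompat.add {L L' : V × V × ℤˣ → ZMod 2} (hL : E.EdgeCompat L)
    (hL' : E.EdgeCompat L') : E.EdgeCompat (L + L') := by
  intro f hf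
  simp [hL f hf, hL' f hf]

theorem jump_add (L L' : V × V × ℤˣ → ZMod 2) (u x : V) :
    E.jump (L + L') u x = E.jump L u x + E.jump L' u x := by
  simp only [jump, Pi.add_apply]; ring

variable (E)

open Classical in
/-- The indicator function of a face. -/
noncomputable def faceIndicator (f : V × V × ℤˣ) (g : V × V × ℤˣ) : ZMod 2 :=
  if E.SameFace f g then 1 else 0

theorem isFaceLabel_faceIndicator (f : V × V × ℤˣ) : E.IsFaceLabel (E.faceIndicator f) := by
  refine ⟨fun g _ => ?_, fun u x _ => ?_⟩
  · have : E.SameFace f (E.rev g) ↔ E.SameFace f g :=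
      ⟨fun h => h.trans E (by simpa using E.sameFace_rev (E.rev g)),
        fun h => h.trans E (E.sameFace_rev g)⟩
    unfold faceIndicator
    classical exact if_congr this rfl rfl
  · have h0 : E.SameFace (u, x, -1) (u, E.rot u x, 1) := by
      rw [← E.step_rev_neg_one]
      exact (E.sameFace_rev _).trans E (E.sameFace_step _)
    have : E.SameFace f (u, E.rot u x, 1) ↔ E.SameFace f (u, x, -1) :=
      ⟨fun h => h.trans E (h0.symm E), fun h => h.trans E h0⟩
    unfold jump faceIndicator
    classical exact zmod_two_add_eq_zero.2 (if_congr this.symm rfl rfl)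

theorem faceIndicator_eq_one {f g : V × V × ℤˣ} : E.faceIndicator f g = 1 ↔ E.SameFace f g := by
  unfold faceIndicator; split_ifs with h <;> simp [h]

theorem faceIndicator_eq_zero {f g : V × V × ℤˣ} : E.faceIndicator f g = 0 ↔ ¬ E.SameFace f g := by
  unfold faceIndicator; split_ifs with h <;> simp [h]

/-- Labels separate faces, by the indicator function of a face. Faces of a modified embedding can
therefore be compared without following their walks. -/
theorem sameFace_of_forall_isFaceLabel {f g : V × V × ℤˣ}
    (h : ∀ L, E.IsFaceLabel L → L f = L g) : E.SameFace f g := by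
  rw [← faceIndicator_eq_one, ← h _ (E.isFaceLabel_faceIndicator f), faceIndicator_eq_one]
  exact SameFace.refl E f

theorem corner_neg_one (u x : V) : E.corner (u, x, -1) = (u, x) := by simp [corner]

theorem corner_one (u x : V) : E.corner (u, x, 1) = (u, (E.rot u)⁻¹ x) := by simp [corner]

theorem corner_step_rev (f : V × V × ℤˣ) : E.corner (E.step (E.rev f)) = E.corner f := by
  obtain ⟨u, x, ε⟩ := f
  rcases Int.units_eq_one_or ε with rfl | rfl
  · rw [step_rev_one, corner_neg_one, corner_one]
  · rw [step_rev_neg_one, corner_neg_one, corner_one, perm_inv_apply]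

theorem corner_indicator [DecidableEq V] (f : V × V × ℤˣ) (u x : V) :
    (if (u, x, (-1 : ℤˣ)) = f then (1 : ZMod 2) else 0) + (if (u, E.rot u x, (1 : ℤˣ)) = f then 1 else 0)
      = if (u, x) = E.corner f then 1 else 0 := by
  obtain ⟨v, y, ε⟩ := f
  have h10 : (-1 : ℤˣ) ≠ 1 := by decide
  rcases Int.units_eq_one_or ε with rfl | rfl
  · have : ((u, E.rot u x, (1 : ℤˣ)) = (v, y, 1)) ↔ ((u, x) = (v, (E.rot v)⁻¹ y)) := by
      simp only [Prod.mk.injEq, and_true]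
      constructor
      · rintro ⟨rfl, rfl⟩; simp
      · rintro ⟨rfl, rfl⟩; simp
    rw [corner_one]
    simp only [this, Prod.mk.injEq, h10, and_false, if_false, zero_add]
  · rw [corner_neg_one]
    simp only [Prod.mk.injEq, h10.symm, and_false, and_true, if_false, add_zero]

/-- The label that counts passages of a facial walk. -/
def walkLabel [DecidableEq V] (f : V × V × ℤˣ) (n : ℕ) (g : V × V × ℤˣ) : ZMod 2 :=
  ∑ i ∈ Finset.range n, ((if g = (E.step ^ i) f then 1 else 0)
    + (if E.rev g = (E.step ^ i) f then 1 else 0))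

theorem walkLabel_edgeCompat [DecidableEq V] (f : V × V × ℤˣ) (n : ℕ) :
    E.EdgeCompat (E.walkLabel f n) := by
  intro g _
  unfold walkLabel
  refine Finset.sum_congr rfl fun i _ => ?_
  rw [rev_rev, add_comm]

/-- A telescoping sum: the passage through the flag number `i` contributes at the corners where it
begins and ends, and consecutive passages share a corner, so modulo two only the first and the last
corner survive. -/
theorem walkLabel_add_step_rev [DecidableEq V] (f : V × V × ℤˣ) (n : ℕ) (g : V × V × ℤˣ) :
    E.walkLabel f n g + E.walkLabel f n (E.step (E.rev g))
      = ((if g = f then 1 else 0) + (if E.step (E.rev g) = f then 1 else 0))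
        + ((if g = (E.step ^ n) f then 1 else 0)
          + (if E.step (E.rev g) = (E.step ^ n) f then 1 else 0)) := by
  induction n with
  | zero => 
    simp only [walkLabel, Finset.range_zero, Finset.sum_empty, pow_zero, Equiv.Perm.coe_one, id_eq]
    exact (CharTwo.add_self_eq_zero _).symm
  | succ n ih =>
    have e : ∀ k, E.walkLabel f (n + 1) k = E.walkLabel f n k
        + ((if k = (E.step ^ n) f then 1 else 0) + (if E.rev k = (E.step ^ n) f then 1 else 0)) := by
      intro k; simp only [walkLabel, Finset.sum_range_succ]
    rw [e, e, add_add_add_comm, ih]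
    have h1 : E.rev g = (E.step ^ n) f ↔ E.step (E.rev g) = (E.step ^ (n + 1)) f := by
      rw [pow_succ', Equiv.Perm.mul_apply, EmbeddingLike.apply_eq_iff_eq]
    have h2 : E.rev (E.step (E.rev g)) = (E.step ^ n) f ↔ g = (E.step ^ (n + 1)) f := by
      rw [rev_step, rev_rev, pow_succ', Equiv.Perm.mul_apply, Equiv.Perm.inv_eq_iff_eq]
    simp only [h1, h2]
    have h2 : (2 : ZMod 2) = 0 := rfl
    linear_combination ((if g = (E.step ^ n) f then (1 : ZMod 2) else 0)
          + (if E.step (E.rev g) = (E.step ^ n) f then 1 else 0)) * h2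

theorem isLink_walkLabel [DecidableEq V] (f : V × V × ℤˣ) (n : ℕ) :
    E.IsLink (E.walkLabel f n) (E.corner f) (E.corner ((E.step ^ n) f)) := by
  refine ⟨E.walkLabel_edgeCompat f n, fun u x _ => ?_⟩
  have := E.walkLabel_add_step_rev f n (u, x, -1)
  rw [step_rev_neg_one, corner_indicator, corner_indicator] at this
  exact this

theorem walkLabel_eq_zero [DecidableEq V] {f g : V × V × ℤˣ} (h : ¬ E.SameFace f g) (n : ℕ) :
    E.walkLabel f n g = 0 := by
  refine Finset.sum_eq_zero fun i _ => ?_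
  rw [if_neg, if_neg, add_zero]
  · intro hg
    exact h (((E.sameFace_step_pow f i).trans E (hg ▸ SameFace.refl E _)).trans E
      ((E.sameFace_rev g).symm E))
  · rintro rfl
    exact h (E.sameFace_step_pow f i)

theorem exists_isLink [Finite V] [DecidableEq V] {f g : V × V × ℤˣ} (h : E.SameFace f g) :
    ∃ L, E.IsLink L (E.corner f) (E.corner g) ∧ ∀ k, ¬ E.SameFace f k → L k = 0 := by
  rcases h with h | h
  · obtain ⟨n, -, rfl⟩ := h.exists_pow_eq'
    exact ⟨_, E.isLink_walkLabel f n, fun k hk => E.walkLabel_eq_zero hk n⟩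
  · obtain ⟨n, -, hn⟩ := h.exists_pow_eq'
    -- The walk meets `g` in reverse; one further step leads to the other flag of the corner of `g`.
    refine ⟨_, ?_, fun k hk => E.walkLabel_eq_zero hk (n + 1)⟩
    have := E.isLink_walkLabel f (n + 1)
    rwa [pow_succ', Equiv.Perm.mul_apply, hn, corner_step_rev] at this

/-- A discrete Stokes formula: in the sum of `ψ` times the jump of `L` over all corners each flag
occurs once, and the flags cancel in pairs under `rev`. What remains are the values of `ψ` at the
two corners of the link. So linked corners are on one face, a converse of `exists_isLink`. -/
theorem IsFaceLabel.eq_of_isLink [Fintype V] [DecidableEq V] {L ψ : V × V × ℤˣ → ZMod 2}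
    {c c' : V × V}
    (hL : E.IsLink L c c') (hψ : E.IsFaceLabel ψ) (hc : G.Adj c.1 c.2) (hc' : G.Adj c'.1 c'.2) :
    ψ (c.1, c.2, -1) = ψ (c'.1, c'.2, -1) := by
  classical
  -- Extension by zero to pairs that are not edges, so that the rotations, which permute all of `V`,
  -- can reindex the sum.
  set a : V × V × ℤˣ → ZMod 2 := fun f => if G.Adj f.1 f.2.1 then ψ f * L f else 0 with ha
  have key : ∑ p : V × V, (a (p.1, p.2, -1) + a (p.1, E.rot p.1 p.2, 1))
      = ψ (c.1, c.2, -1) + ψ (c'.1, c'.2, -1) := by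
    have : ∀ p : V × V, a (p.1, p.2, -1) + a (p.1, E.rot p.1 p.2, 1)
        = (if p = c then ψ (c.1, c.2, -1) else 0) + (if p = c' then ψ (c'.1, c'.2, -1) else 0) := by
      rintro ⟨u, x⟩
      by_cases h : G.Adj u x
      · have h1 := hL.2 u x h
        have h2 := hψ.rot_one h
        simp only [ha, E.adj_rot_iff, h, if_true, h2, ← mul_add]
        rw [jump] at h1
        rw [h1, mul_add]
        congr 1
        · split_ifs with h3
          · subst h3; simp
          · simp
        · split_ifs with h3
          · subst h3; simp
          · simp
      · have h1 : (u, x) ≠ c := by rintro rfl; exact h hc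
        have h2 : (u, x) ≠ c' := by rintro rfl; exact h hc'
        simp [ha, E.adj_rot_iff, h, h1, h2]
    rw [Finset.sum_congr rfl fun p _ => this p, Finset.sum_add_distrib]
    simp
  rw [← zmod_two_add_eq_zero, ← key, Finset.sum_add_distrib]
  have h1 : ∑ p : V × V, a (p.1, E.rot p.1 p.2, 1) = ∑ p : V × V, a (p.1, p.2, 1) := by
    rw [Fintype.sum_prod_type, Fintype.sum_prod_type]
    refine Finset.sum_congr rfl fun u _ => ?_
    exact Equiv.sum_comp (E.rot u) fun x => a (u, x, 1)
  rw [h1]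
  have h2 : ∑ f : V × V × ℤˣ, a f = 0 := by
    refine Finset.sum_ninvolution E.rev (fun f => ?_) (fun f hf => ?_) (fun f => Finset.mem_univ _)
      (fun f => E.rev_rev f)
    · by_cases h : G.Adj f.1 f.2.1
      · have h3 := hL.1 f h
        have h4 := hψ.1 f h
        have h5 : G.Adj (E.rev f).1 (E.rev f).2.1 := E.adj_rev h
        simp only [ha, h, h5, if_true, h3, h4]
        exact CharTwo.add_self_eq_zero _
      · have h5 : ¬ G.Adj (E.rev f).1 (E.rev f).2.1 := fun h' => h h'.symm
        simp [ha, h, h5]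
    · have h : G.Adj f.1 f.2.1 := by
        by_contra h; simp [ha, h] at hf
      simpa using E.rev_ne_step_pow 0 f h
  rw [← h2, Fintype.sum_prod_type, Fintype.sum_prod_type, Fintype.sum_prod_type,
    ← Finset.sum_add_distrib]
  refine Finset.sum_congr rfl fun u _ => ?_
  rw [← Finset.sum_add_distrib, Fintype.sum_prod_type]
  refine Finset.sum_congr rfl fun w _ => ?_
  rw [add_comm]
  exact (Fintype.sum_eq_add (f := fun ε => a (u, w, ε)) (1 : ℤˣ) (-1) (by decide) (by
    rintro x ⟨h1, h2⟩
    rcases Int.units_eq_one_or x with h | h <;> contradiction)).symm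

end RotationSystem
end SimpleGraph

/-! ### Cyclic permutations, the cycle space modulo two, and boundaries of sets of faces -/

namespace SimpleGraph

section Perm

variable {α : Type*} [DecidableEq α]

/-- The product inserts `x` into the cycle directly after `p`. For empty `s` there is no such `p`;
the choice `p = x` makes the transposition trivial. -/
theorem isCycleOn_mul_swap [Finite α] {σ : Equiv.Perm α} {s : Set α} (hσ : σ.IsCycleOn s) {p x : α}
    (hp : p ∈ s ∨ s = ∅ ∧ p = x) (hx : x ∉ s) (hσx : σ x = x) :
    (σ * Equiv.swap p x).IsCycleOn (insert x s) := by
  rcases hp with hp | ⟨rfl, rfl⟩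
  swap
  · simpa using hσx
  have hpx : p ≠ x := by rintro rfl; exact hx hp
  set τ := σ * Equiv.swap p x with hτ
  have t1 : τ x = σ p := by simp [hτ]
  have t2 : τ p = x := by simp [hτ, hσx]
  have t3 : ∀ y, y ≠ p → y ≠ x → τ y = σ y := fun y h1 h2 => by
    simp [hτ, Equiv.swap_apply_of_ne_of_ne h1 h2]
  have hne : ∀ y, y ∈ s → y ≠ x := by rintro y hy rfl; exact hx hy
  have s1 : ∀ y ∈ s, τ.SameCycle y (σ y) := by
    intro y hy
    by_cases h : y = p
    · subst h
      exact ⟨2, by rw [zpow_two, Equiv.Perm.mul_apply, t2, t1]⟩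
    · exact ⟨1, by rw [zpow_one, t3 y h (hne y hy)]⟩
  have s2 : ∀ y ∈ s, τ.SameCycle p y := by
    intro y hy
    obtain ⟨n, -, rfl⟩ := (hσ.2 hp hy).exists_pow_eq'
    clear hy
    suffices h : (σ ^ n) p ∈ s ∧ τ.SameCycle p ((σ ^ n) p) from h.2
    induction n with
    | zero => exact ⟨hp, Equiv.Perm.SameCycle.refl _ _⟩
    | succ n ih =>
      rw [pow_succ', Equiv.Perm.mul_apply]
      exact ⟨hσ.apply_mem_iff.2 ih.1, ih.2.trans (s1 _ ih.1)⟩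
  have s3 : ∀ y ∈ insert x s, τ.SameCycle p y := by
    rintro y (rfl | hy)
    · exact ⟨1, by rw [zpow_one, t2]⟩
    · exact s2 y hy
  refine ⟨τ.bijOn fun y => ?_, fun y hy z hz => (s3 y hy).symm.trans (s3 z hz)⟩
  by_cases h1 : y = x
  · subst h1
    rw [t1]
    simp [hσ.apply_mem_iff, hp]
  · by_cases h2 : y = p
    · subst h2
      rw [t2]; simp [hp]
    · rw [t3 y h2 h1]
      have : σ y ≠ x := fun h => h1 (σ.injective (h.trans hσx.symm))
      simp [this, h1, hσ.apply_mem_iff]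

theorem isCycleOn_swap_mul [Finite α] {σ : Equiv.Perm α} {s : Set α} (hσ : σ.IsCycleOn s) {x : α}
    (hx : x ∈ s) : (Equiv.swap x (σ x) * σ).IsCycleOn (s \ {x}) := by
  set τ := Equiv.swap x (σ x) * σ with hτ
  have t1 : τ x = x := by simp [hτ]
  have t2 : ∀ y, σ y = x → τ y = σ x := fun y h => by simp [hτ, h]
  have t3 : ∀ y, y ≠ x → σ y ≠ x → τ y = σ y := fun y h1 h2 => by
    simp [hτ, Equiv.swap_apply_of_ne_of_ne h2 (σ.injective.ne h1)]
  refine ⟨τ.bijOn fun y => ?_, fun y hy z hz => ?_⟩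
  · by_cases h1 : y = x
    · subst h1; simp [t1]
    · have h0 : τ y ≠ x := fun h => h1 (τ.injective (h.trans t1.symm))
      by_cases h2 : σ y = x
      · have : y ∈ s := by rw [← hσ.apply_mem_iff, h2]; exact hx
        simp [h1, t2 y h2, hσ.apply_mem_iff, this, hx]
        rw [← t2 y h2]; exact h0
      · simp [h1, t3 y h1 h2, hσ.apply_mem_iff, h2]
  · obtain ⟨n, -, rfl⟩ := (hσ.2 hy.1 hz.1).exists_pow_eq'
    have hz2 : (σ ^ n) y ≠ x := hz.2
    clear hz
    -- The orbit of `σ` is followed with `x` replaced by its successor, so that the induction may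
    -- pass through the removed point.
    suffices h : τ.SameCycle y (if (σ ^ n) y = x then σ x else (σ ^ n) y) by
      rwa [if_neg hz2] at h
    clear hz2
    induction n with
    | zero => rw [if_neg (show (σ ^ 0) y ≠ x from hy.2)]; exact Equiv.Perm.SameCycle.refl _ _
    | succ n ih =>
      rw [pow_succ', Equiv.Perm.mul_apply]
      generalize (σ ^ n) y = z at ih
      by_cases hz : z = x
      · subst hz
        rw [if_pos rfl] at ih
        split_ifs <;> exact ih
      · rw [if_neg hz] at ih
        split_ifs with h
        · exact ih.trans ⟨1, by rw [zpow_one, t2 z h]⟩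
        · exact ih.trans ⟨1, by rw [zpow_one, t3 z hz h]⟩

end Perm

variable {V : Type*}

/-- The cycle space of a graph over the field with two elements. -/
def cycleSpace [Fintype V] (G : SimpleGraph V) : Submodule (ZMod 2) (V → V → ZMod 2) where
  carrier := {z | (∀ u w, z u w = z w u) ∧ (∀ u w, ¬ G.Adj u w → z u w = 0) ∧ ∀ u, ∑ w, z u w = 0}
  zero_mem' := by simp
  add_mem' := by
    rintro a b ⟨h1, h2, h3⟩ ⟨k1, k2, k3⟩
    refine ⟨fun u w => ?_, fun u w h => ?_, fun u => ?_⟩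
    · simp [h1 u w, k1 u w]
    · simp [h2 u w h, k2 u w h]
    · simp [Finset.sum_add_distrib, h3, k3]
  smul_mem' := by
    rintro c a ⟨h1, h2, h3⟩
    refine ⟨fun u w => ?_, fun u w h => ?_, fun u => ?_⟩
    · simp [h1 u w]
    · simp [h2 u w h]
    · simp [← Finset.mul_sum, h3]

open Classical in
/-- The boundary of a flag label. -/
noncomputable def bdy (G : SimpleGraph V) :
    (V × V × ℤˣ → ZMod 2) →ₗ[ZMod 2] (V → V → ZMod 2) where
  toFun L u w := if G.Adj u w then L (u, w, 1) + L (u, w, -1) else 0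
  map_add' L L' := by
    ext u w
    simp only [Pi.add_apply]
    split_ifs <;> ring
  map_smul' c L := by
    ext u w
    simp only [Pi.smul_apply, smul_eq_mul, RingHom.id_apply]
    split_ifs <;> ring

theorem bdy_apply_of_adj {G : SimpleGraph V} {u w : V} (h : G.Adj u w) (L : V × V × ℤˣ → ZMod 2) :
    bdy G L u w = L (u, w, 1) + L (u, w, -1) := if_pos h

theorem bdy_apply_of_not_adj {G : SimpleGraph V} {u w : V} (h : ¬ G.Adj u w)
    (L : V × V × ℤˣ → ZMod 2) : bdy G L u w = 0 := if_neg h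

theorem eq_of_bdy_eq_zero {G : SimpleGraph V} {u w : V} (h : G.Adj u w) {L : V × V × ℤˣ → ZMod 2}
    (hL : bdy G L u w = 0) (ε ε' : ℤˣ) : L (u, w, ε) = L (u, w, ε') := by
  rw [bdy_apply_of_adj h, RotationSystem.zmod_two_add_eq_zero] at hL
  rcases Int.units_eq_one_or ε with rfl | rfl <;> rcases Int.units_eq_one_or ε' with rfl | rfl <;>
    simp [hL]

theorem sum_symm_eq_zero [Fintype V] (z : V → V → ZMod 2) (h : ∀ u w, z u w = z w u)
    (h0 : ∀ u, z u u = 0) : ∑ u, ∑ w, z u w = 0 := by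
  rw [← Fintype.sum_prod_type']
  refine Finset.sum_ninvolution Prod.swap (fun p => ?_) (fun p hp => ?_)
    (fun _ => Finset.mem_univ _) (fun p => Prod.swap_swap p)
  · rw [Prod.fst_swap, Prod.snd_swap, h]; exact CharTwo.add_self_eq_zero _
  · obtain ⟨u, w⟩ := p
    intro he
    simp only [Prod.swap_prod_mk, Prod.mk.injEq] at he
    obtain rfl := he.1
    exact hp (h0 _)

namespace RotationSystem

variable {G : SimpleGraph V} (E : RotationSystem G)

/-- The space of face labels. -/
def faceLabels : Submodule (ZMod 2) (V × V × ℤˣ → ZMod 2) where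
  carrier := {L | E.IsFaceLabel L}
  zero_mem' := isFaceLabel_const 0
  add_mem' := IsFaceLabel.add
  smul_mem' c L hL := by
    rcases zmod_two_eq c with rfl | rfl
    · rw [zero_smul]; exact isFaceLabel_const 0
    · rwa [one_smul]

/-- The space of boundaries of sets of faces. -/
noncomputable def boundarySpace : Submodule (ZMod 2) (V → V → ZMod 2) := E.faceLabels.map (bdy G)

theorem mem_boundarySpace {z : V → V → ZMod 2} :
    z ∈ E.boundarySpace ↔ ∃ L, E.IsFaceLabel L ∧ bdy G L = z := Iff.rfl

variable {E}

theorem EdgeCompat.bdy_symm {L : V × V × ℤˣ → ZMod 2} (hL : E.EdgeCompat L) (u w : V) :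
    bdy G L u w = bdy G L w u := by
  by_cases h : G.Adj u w
  · rw [bdy_apply_of_adj h, bdy_apply_of_adj h.symm, ← hL (u, w, 1) h, ← hL (u, w, -1) h]
    simp only [rev_mk, neg_mul, neg_neg, one_mul]
    rcases Int.units_eq_one_or (E.sgn u w) with h1 | h1 <;> rw [h1]
    · rw [add_comm]
    · rw [neg_neg]
  · rw [bdy_apply_of_not_adj h, bdy_apply_of_not_adj fun h' => h h'.symm]

theorem IsFaceLabel.bdy_mem [Fintype V] {L : V × V × ℤˣ → ZMod 2} (hL : E.IsFaceLabel L) :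
    bdy G L ∈ cycleSpace G := by
  classical
  refine ⟨hL.1.bdy_symm, fun u w h => bdy_apply_of_not_adj h L, fun u => ?_⟩
  -- The corner condition replaces the side `-1` of an edge by the side `1` of the next edge around
  -- `u`; summed around `u`, everything then occurs twice.
  have h1 : ∀ w, bdy G L u w = (if G.Adj u w then L (u, w, 1) else 0)
      + (if G.Adj u (E.rot u w) then L (u, E.rot u w, 1) else 0) := by
    intro w
    by_cases h : G.Adj u w
    · rw [bdy_apply_of_adj h, if_pos h, if_pos (E.adj_rot_iff.2 h), hL.rot_one h]
    · rw [bdy_apply_of_not_adj h, if_neg h, if_neg fun h' => h (E.adj_rot_iff.1 h'), add_zero]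
  simp only [h1, Finset.sum_add_distrib]
  rw [Equiv.sum_comp (E.rot u) fun w => if G.Adj u w then L (u, w, 1) else 0]
  exact CharTwo.add_self_eq_zero _

theorem boundarySpace_le [Fintype V] (E : RotationSystem G) : E.boundarySpace ≤ cycleSpace G := by
  rintro _ ⟨L, hL, rfl⟩
  exact IsFaceLabel.bdy_mem hL

variable (E)

/-- The rotation system describes an embedding of Euler genus zero. -/
def IsSpherical [Fintype V] : Prop := cycleSpace G ≤ E.boundarySpace

/-- The rotation system describes an embedding of Euler genus at most one. -/
def IsProjective [Fintype V] : Prop := ∀ z ∈ cycleSpace G, ∀ z' ∈ cycleSpace G,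
  z ∈ E.boundarySpace ∨ z' ∈ E.boundarySpace ∨ z + z' ∈ E.boundarySpace

variable {E} in
theorem IsSpherical.isProjective [Fintype V] (h : E.IsSpherical) : E.IsProjective :=
  fun _ hz _ _ => Or.inl (h hz)

end RotationSystem

/-- `H` is obtained from `K` by adding an edge between the distinct non-adjacent vertices `u`
and `w`. -/
structure IsAddEdge (K H : SimpleGraph V) (u w : V) : Prop where
  ne : u ≠ w
  not_adj : ¬ K.Adj u w
  adj_iff : ∀ a b, H.Adj a b ↔ K.Adj a b ∨ (a = u ∧ b = w) ∨ (a = w ∧ b = u)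

namespace IsAddEdge

variable {K H : SimpleGraph V} {u w : V} (h : IsAddEdge K H u w)

include h

theorem symm : IsAddEdge K H w u :=
  ⟨h.ne.symm, fun h' => h.not_adj h'.symm, fun a b => by rw [h.adj_iff]; tauto⟩

theorem adj : H.Adj u w := (h.adj_iff u w).2 (Or.inr (Or.inl ⟨rfl, rfl⟩))

theorem le : K ≤ H := fun a b hab => (h.adj_iff a b).2 (Or.inl hab)

theorem neighborSet_left : H.neighborSet u = insert w (K.neighborSet u) := by
  ext b
  have := h.ne
  simp only [mem_neighborSet, h.adj_iff, Set.mem_insert_iff]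
  tauto

theorem neighborSet_of_ne {v : V} (hu : v ≠ u) (hw : v ≠ w) :
    H.neighborSet v = K.neighborSet v := by
  ext b
  simp only [mem_neighborSet, h.adj_iff]
  tauto

theorem adj_iff_left {b : V} : H.Adj u b ↔ K.Adj u b ∨ b = w := by
  have := h.ne
  rw [h.adj_iff]; tauto

theorem adj_iff_of_ne {v b : V} (hu : v ≠ u) (hw : v ≠ w) : H.Adj v b ↔ K.Adj v b := by
  rw [h.adj_iff]; tauto

theorem mem_cycleSpace_iff [Fintype V] {z : V → V → ZMod 2} :
    z ∈ cycleSpace K ↔ z ∈ cycleSpace H ∧ z u w = 0 := by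
  constructor
  · rintro ⟨h1, h2, h3⟩
    exact ⟨⟨h1, fun a b hab => h2 a b fun h' => hab (h.le h'), h3⟩, h2 u w h.not_adj⟩
  · rintro ⟨⟨h1, h2, h3⟩, h4⟩
    refine ⟨h1, fun a b hab => ?_, h3⟩
    by_cases hab' : H.Adj a b
    · rcases (h.adj_iff a b).1 hab' with h' | ⟨rfl, rfl⟩ | ⟨rfl, rfl⟩
      · exact absurd h' hab
      · exact h4
      · rw [h1]; exact h4
    · exact h2 a b hab'

end IsAddEdge

end SimpleGraph

/-! ### Adding and deleting an edge of a rotation system -/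

namespace SimpleGraph
namespace RotationSystem

variable {V : Type*} [Finite V] [DecidableEq V] {K H : SimpleGraph V} {u w : V}

/-- Insert a new edge into given corners. An isolated end vertex `u` has no corner, then `p = w`. -/
def addEdge (T : RotationSystem K) (h : IsAddEdge K H u w) (p q : V)
    (hp : K.Adj u p ∨ (∀ y, ¬ K.Adj u y) ∧ p = w) (hq : K.Adj w q ∨ (∀ y, ¬ K.Adj w y) ∧ q = u)
    (σ : ℤˣ) : RotationSystem H where
  rot v := if v = u then T.rot u * Equiv.swap p w else
    if v = w then T.rot w * Equiv.swap q u else T.rot v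
  sgn a b := if (a = u ∧ b = w) ∨ (a = w ∧ b = u) then σ else T.sgn a b
  sgn_comm a b := by
    have : ((a = u ∧ b = w) ∨ (a = w ∧ b = u)) ↔ ((b = u ∧ a = w) ∨ (b = w ∧ a = u)) := by tauto
    rw [T.sgn_comm a b, if_congr this rfl rfl]
  isCycleOn_rot v := by
    have aux : ∀ u w p : V, IsAddEdge K H u w → (K.Adj u p ∨ (∀ y, ¬ K.Adj u y) ∧ p = w) →
        (T.rot u * Equiv.swap p w).IsCycleOn (H.neighborSet u) := by
      intro u w p h hp
      rw [h.neighborSet_left]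
      refine isCycleOn_mul_swap (T.isCycleOn_rot u) ?_ h.not_adj (T.rot_of_not_adj _ _ h.not_adj)
      exact hp.imp id fun h' => ⟨Set.eq_empty_of_forall_notMem h'.1, h'.2⟩
    split_ifs with h1 h2
    · subst h1; exact aux _ _ _ h hp
    · subst h2; exact aux _ _ _ h.symm hq
    · rw [h.neighborSet_of_ne h1 h2]; exact T.isCycleOn_rot v
  rot_of_not_adj v b hb := by
    have aux : ∀ u w p : V, IsAddEdge K H u w → (K.Adj u p ∨ (∀ y, ¬ K.Adj u y) ∧ p = w) →
        ∀ b, ¬ H.Adj u b → (T.rot u * Equiv.swap p w) b = b := by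
      intro u w p h hp b hb
      rw [h.adj_iff_left, not_or] at hb
      have : b ≠ p := by
        rintro rfl
        exact hp.elim hb.1 fun h' => hb.2 h'.2
      rw [Equiv.Perm.mul_apply, Equiv.swap_apply_of_ne_of_ne this hb.2, T.rot_of_not_adj _ _ hb.1]
    split_ifs with h1 h2
    · subst h1; exact aux _ _ _ h hp b hb
    · subst h2; exact aux _ _ _ h.symm hq b hb
    · exact T.rot_of_not_adj _ _ fun h' => hb (h.le h')

section AddEdge

variable (T : RotationSystem K) (h : IsAddEdge K H u w) {p q : V}
    (hp : K.Adj u p ∨ (∀ y, ¬ K.Adj u y) ∧ p = w) (hq : K.Adj w q ∨ (∀ y, ¬ K.Adj w y) ∧ q = u)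
    (σ : ℤˣ)

/-- Extend a flag label by given values on the flags of the added edge. -/
def extendLabel (u w : V) (L N : V × V × ℤˣ → ZMod 2) (f : V × V × ℤˣ) : ZMod 2 :=
  if (f.1 = u ∧ f.2.1 = w) ∨ (f.1 = w ∧ f.2.1 = u) then N f else L f

theorem extendLabel_of_adj (h : IsAddEdge K H u w) {L N : V × V × ℤˣ → ZMod 2} {f : V × V × ℤˣ}
    (hf : K.Adj f.1 f.2.1) : extendLabel u w L N f = L f := by
  rw [extendLabel, if_neg]
  rintro (⟨h1, h2⟩ | ⟨h1, h2⟩)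
  · rw [h1, h2] at hf; exact h.not_adj hf
  · rw [h1, h2] at hf; exact h.not_adj hf.symm

theorem extendLabel_left {L N : V × V × ℤˣ → ZMod 2} (ε : ℤˣ) :
    extendLabel u w L N (u, w, ε) = N (u, w, ε) := if_pos (Or.inl ⟨rfl, rfl⟩)

theorem extendLabel_right {L N : V × V × ℤˣ → ZMod 2} (ε : ℤˣ) :
    extendLabel u w L N (w, u, ε) = N (w, u, ε) := if_pos (Or.inr ⟨rfl, rfl⟩)

theorem addEdge_edgeCompat {L N : V × V × ℤˣ → ZMod 2} (hL : T.EdgeCompat L)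
    (hN : ∀ ε, N (w, u, -(ε * σ)) = N (u, w, ε)) :
    (T.addEdge h p q hp hq σ).EdgeCompat (extendLabel u w L N) := by
  rintro ⟨a, b, ε⟩ hab
  rcases (h.adj_iff a b).1 hab with h' | ⟨rfl, rfl⟩ | ⟨rfl, rfl⟩
  · have : (T.addEdge h p q hp hq σ).rev (a, b, ε) = T.rev (a, b, ε) := by
      simp only [rev_mk, addEdge]
      rw [if_neg]
      rintro (⟨rfl, rfl⟩ | ⟨rfl, rfl⟩)
      · exact h.not_adj h'
      · exact h.not_adj h'.symm
    rw [this, extendLabel_of_adj h (show K.Adj (a, b, ε).1 (a, b, ε).2.1 from h'),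
      extendLabel_of_adj h (T.adj_rev (show K.Adj (a, b, ε).1 (a, b, ε).2.1 from h'))]
    exact hL _ h'
  · rw [rev_mk, extendLabel_left, extendLabel_right, ← hN]
    simp [addEdge]
  · rw [rev_mk, extendLabel_left, extendLabel_right, ← hN]
    simp [addEdge, Int.units_mul_self, mul_assoc]

/-- The jumps of an extended label. -/
theorem addEdge_jump_left {L N : V × V × ℤˣ → ZMod 2}
    (hN1 : K.Adj u p → N (u, w, 1) = L (u, p, -1) ∧ N (u, w, -1) = L (u, T.rot u p, 1))
    (hN2 : ¬ K.Adj u p → N (u, w, 1) = N (u, w, -1)) {b : V} (hb : H.Adj u b) :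
    (T.addEdge h p q hp hq σ).jump (extendLabel u w L N) u b
      = if b ≠ w ∧ b ≠ p then T.jump L u b else 0 := by
  have hr : (T.addEdge h p q hp hq σ).rot u = T.rot u * Equiv.swap p w := if_pos rfl
  rw [jump, hr, Equiv.Perm.mul_apply]
  by_cases hbw : b = w
  · subst hbw
    rw [if_neg (by simp), Equiv.swap_apply_right, extendLabel_left]
    by_cases hup : K.Adj u p
    · rw [extendLabel_of_adj h (by exact T.adj_rot_iff.2 hup), (hN1 hup).2]
      exact CharTwo.add_self_eq_zero _
    · have : p = b := (hp.resolve_left hup).2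
      subst this
      rw [T.rot_of_not_adj _ _ hup, extendLabel_left, hN2 hup]
      exact CharTwo.add_self_eq_zero _
  · have hub : K.Adj u b := (h.adj_iff_left.1 hb).resolve_right hbw
    rw [extendLabel_of_adj h (by exact hub)]
    by_cases hbp : b = p
    · subst hbp
      rw [if_neg (by simp), Equiv.swap_apply_left, T.rot_of_not_adj _ _ h.not_adj,
        extendLabel_left, (hN1 hub).1]
      exact CharTwo.add_self_eq_zero _
    · rw [if_pos ⟨hbw, hbp⟩, Equiv.swap_apply_of_ne_of_ne hbp hbw,
        extendLabel_of_adj h (by exact T.adj_rot_iff.2 hub)]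
      rfl

theorem extendLabel_symm (L N : V × V × ℤˣ → ZMod 2) :
    extendLabel u w L N = extendLabel w u L N := by
  ext f
  unfold extendLabel
  exact if_congr (by tauto) rfl rfl

theorem addEdge_symm :
    T.addEdge h p q hp hq σ = T.addEdge h.symm q p hq hp σ := by
  have hne := h.ne
  unfold addEdge
  congr 1
  · ext v
    by_cases h1 : v = u
    · simp [h1, h.ne]
    · by_cases h2 : v = w
      · simp [h2, h.ne.symm]
      · simp [h1, h2]
  · ext a b
    rw [if_congr (Or.comm) rfl rfl]

theorem addEdge_jump_right {L N : V × V × ℤˣ → ZMod 2}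
    (hN1 : K.Adj w q → N (w, u, 1) = L (w, q, -1) ∧ N (w, u, -1) = L (w, T.rot w q, 1))
    (hN2 : ¬ K.Adj w q → N (w, u, 1) = N (w, u, -1)) {b : V} (hb : H.Adj w b) :
    (T.addEdge h p q hp hq σ).jump (extendLabel u w L N) w b
      = if b ≠ u ∧ b ≠ q then T.jump L w b else 0 := by
  rw [addEdge_symm, extendLabel_symm]
  exact addEdge_jump_left T h.symm hq hp σ hN1 hN2 hb

theorem addEdge_jump_of_ne {L N : V × V × ℤˣ → ZMod 2} {a b : V} (hu : a ≠ u) (hw : a ≠ w)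
    (hab : H.Adj a b) :
    (T.addEdge h p q hp hq σ).jump (extendLabel u w L N) a b = T.jump L a b := by
  have hr : (T.addEdge h p q hp hq σ).rot a = T.rot a := (if_neg hu).trans (if_neg hw)
  have hab' : K.Adj a b := (h.adj_iff_of_ne hu hw).1 hab
  rw [jump, hr, extendLabel_of_adj h (by exact hab'),
    extendLabel_of_adj h (by exact T.adj_rot_iff.2 hab')]
  rfl

/-- A label without jumps at the corners of the added edge extends, with the same jumps. -/
theorem exists_extension {L : V × V × ℤˣ → ZMod 2} (hL : T.EdgeCompat L) (k : ZMod 2)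
    (h1 : K.Adj u p → L (u, p, -1) = k ∧ T.jump L u p = 0)
    (h2 : K.Adj w q → L (w, q, -1) = k ∧ T.jump L w q = 0) :
    ∃ L', (T.addEdge h p q hp hq σ).EdgeCompat L' ∧
      (∀ f : V × V × ℤˣ, K.Adj f.1 f.2.1 → L' f = L f) ∧
      (∀ ε, L' (u, w, ε) = k) ∧
      (∀ a b, K.Adj a b → (T.addEdge h p q hp hq σ).jump L' a b = T.jump L a b) ∧
      (T.addEdge h p q hp hq σ).jump L' u w = 0 ∧
      (T.addEdge h p q hp hq σ).jump L' w u = 0 := by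
  have key : ∀ {a b : V}, L (a, b, -1) = k ∧ T.jump L a b = 0 →
      k = L (a, b, -1) ∧ k = L (a, T.rot a b, 1) := by
    rintro a b ⟨rfl, h'⟩
    exact ⟨rfl, zmod_two_add_eq_zero.1 h'⟩
  refine ⟨extendLabel u w L (fun _ => k), addEdge_edgeCompat T h hp hq σ hL fun _ => rfl,
    fun f hf => extendLabel_of_adj h hf, fun ε => extendLabel_left ε, fun a b hab => ?_, ?_, ?_⟩
  · by_cases hu : a = u
    · subst hu
      rw [addEdge_jump_left T h hp hq σ (fun h' => key (h1 h')) (fun _ => rfl) (h.le hab)]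
      have : b ≠ w := by rintro rfl; exact h.not_adj hab
      split_ifs with h'
      · rfl
      · have : b = p := by tauto
        subst this
        exact (h1 hab).2.symm
    · by_cases hw : a = w
      · subst hw
        rw [addEdge_jump_right T h hp hq σ (fun h' => key (h2 h')) (fun _ => rfl) (h.le hab)]
        have : b ≠ u := by rintro rfl; exact h.not_adj hab.symm
        split_ifs with h'
        · rfl
        · have : b = q := by tauto
          subst this
          exact (h2 hab).2.symm
      · exact addEdge_jump_of_ne T h hp hq σ hu hw (h.le hab)
  · rw [addEdge_jump_left T h hp hq σ (fun h' => key (h1 h')) (fun _ => rfl) h.adj]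
    simp
  · rw [addEdge_jump_right T h hp hq σ (fun h' => key (h2 h')) (fun _ => rfl) h.adj.symm]
    simp

variable {T} in
theorem addEdge_isFaceLabel {S : RotationSystem H} {L : V × V × ℤˣ → ZMod 2}
    (h : IsAddEdge K H u w) (h1 : S.EdgeCompat L)
    (h2 : ∀ a b, K.Adj a b → S.jump L a b = 0) (h3 : S.jump L u w = 0) (h4 : S.jump L w u = 0) :
    S.IsFaceLabel L := by
  refine ⟨h1, fun a b hab => ?_⟩
  rcases (h.adj_iff a b).1 hab with h' | ⟨rfl, rfl⟩ | ⟨rfl, rfl⟩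
  · exact h2 a b h'
  · exact h3
  · exact h4

omit [Finite V] [DecidableEq V] in
theorem bdy_eq_of_extension (h : IsAddEdge K H u w) {L L' : V × V × ℤˣ → ZMod 2}
    (h1 : ∀ f : V × V × ℤˣ, K.Adj f.1 f.2.1 → L' f = L f)
    (h2 : bdy H L' u w = 0) (h3 : bdy H L' w u = 0) : bdy H L' = bdy K L := by
  ext a b
  by_cases hab : K.Adj a b
  · rw [bdy_apply_of_adj hab, bdy_apply_of_adj (h.le hab), h1 (a, b, 1) hab, h1 (a, b, -1) hab]
  · rw [bdy_apply_of_not_adj hab]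
    by_cases hab' : H.Adj a b
    · rcases (h.adj_iff a b).1 hab' with h' | ⟨rfl, rfl⟩ | ⟨rfl, rfl⟩
      · exact absurd h' hab
      · exact h2
      · exact h3
    · exact bdy_apply_of_not_adj hab' _

end AddEdge

/-- An edge can be added between two linked corners. -/
theorem exists_addEdge_of_isLink {V : Type*} [Fintype V] [DecidableEq V] {K H : SimpleGraph V}
    {u w p q : V} (T : RotationSystem K)
    (h : IsAddEdge K H u w) {L : V × V × ℤˣ → ZMod 2} (hL : T.IsLink L (u, p) (w, q))
    (hp : K.Adj u p) (hq : K.Adj w q) :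
    ∃ S : RotationSystem H, (T.IsSpherical → S.IsSpherical) ∧ (T.IsProjective → S.IsProjective) ∧
      ∀ c c' M, T.IsLink M c c' → c ≠ (u, p) → c ≠ (w, q) → c' ≠ (u, p) → c' ≠ (w, q) →
        K.Adj c.1 c.2 → K.Adj c'.1 c'.2 →
        M (u, p, -1) = M (w, q, -1) → ∃ M', S.IsLink M' c c' := by
  have hne := h.ne
  have hne' := h.ne.symm
  have hadjw := h.adj
  set i := L (u, p, -1) with hi
  set j := L (w, q, -1) with hj
  -- `L` takes the values `i` and `i + 1` on the two sides of the new edge at `u`, and `j` and `j +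
  -- 1` at `w`. This signature makes equal values meet along the edge.
  set σ : ℤˣ := if i = j then -1 else 1 with hσ
  set S := T.addEdge h p q (Or.inl hp) (Or.inl hq) σ with hS
  -- the label that separates the two sides of the new edge
  set N : V × V × ℤˣ → ZMod 2 := fun f =>
    (if f.1 = u then i else j) + (if f.2.2 = 1 then 0 else 1) with hN
  have hneg : (-1 : ℤˣ) ≠ 1 := by decide
  have hju : L (u, T.rot u p, 1) = i + 1 := by
    have := hL.2 u p hp
    rw [if_pos rfl, if_neg (by simp [hne]), jump, ← hi, add_zero] at this
    rw [← this, ← add_assoc, CharTwo.add_self_eq_zero, zero_add]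
  have hjw : L (w, T.rot w q, 1) = j + 1 := by
    have := hL.2 w q hq
    rw [if_neg (by simp [hne']), if_pos rfl, jump, ← hj, zero_add] at this
    rw [← this, ← add_assoc, CharTwo.add_self_eq_zero, zero_add]
  have hNc : ∀ ε, N (w, u, -(ε * σ)) = N (u, w, ε) := by
    intro ε
    have e1 : (-1 : ℤˣ) ≠ 1 := hneg
    simp only [hN, hne', if_false, if_true, hσ]
    rcases zmod_two_eq i with h1 | h1 <;> rcases zmod_two_eq j with h2 | h2 <;>
      rcases Int.units_eq_one_or ε with rfl | rfl <;> simp [h1, h2] <;> first | done | rfl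
  have hN1 : K.Adj u p → N (u, w, 1) = L (u, p, -1) ∧ N (u, w, -1) = L (u, T.rot u p, 1) := by
    intro _
    rw [hju]
    simp [hN, ← hi]
  have hN2 : K.Adj w q → N (w, u, 1) = L (w, q, -1) ∧ N (w, u, -1) = L (w, T.rot w q, 1) := by
    intro _
    rw [hjw]
    simp [hN, ← hj, hne']
  set φ := extendLabel u w L N with hφ
  have hφf : S.IsFaceLabel φ := by
    refine ⟨addEdge_edgeCompat T h _ _ σ hL.1 hNc, fun a b hab => ?_⟩
    by_cases hu : a = u
    · subst hu
      rw [hφ, hS, addEdge_jump_left T h _ _ σ hN1 (fun h' => absurd hp h') hab]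
      split_ifs with h'
      · have hb := (h.adj_iff_left.1 hab).resolve_right h'.1
        rw [hL.2 _ _ hb]
        simp [h'.2, hne]
      · rfl
    · by_cases hw : a = w
      · subst hw
        rw [hφ, hS, addEdge_jump_right T h _ _ σ hN2 (fun h' => absurd hq h') hab]
        split_ifs with h'
        · have hb := (h.symm.adj_iff_left.1 hab).resolve_right h'.1
          rw [hL.2 _ _ hb]
          simp [h'.2, hne']
        · rfl
      · rw [hφ, hS, addEdge_jump_of_ne T h _ _ σ hu hw hab,
          hL.2 _ _ ((h.adj_iff_of_ne hu hw).1 hab)]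
        simp [hu, hw]
  have hφb : bdy H φ u w = 1 := by
    rw [bdy_apply_of_adj h.adj, hφ, extendLabel_left, extendLabel_left]
    simp only [hN, if_true, hneg, if_false, add_zero]
    rw [← add_assoc, CharTwo.add_self_eq_zero, zero_add]
  have hφz := hφf.bdy_mem
  -- An old face label has equal values at the linked corners, so it extends over the new edge with
  -- the same value on both sides and the same boundary.
  have hbd : ∀ z, z ∈ T.boundarySpace → z ∈ S.boundarySpace := by
    rintro _ ⟨ψ, hψ, rfl⟩
    have hψ' : T.IsFaceLabel ψ := hψ
    have e1 : ψ (u, p, -1) = ψ (w, q, -1) := IsFaceLabel.eq_of_isLink T hL hψ' hp hq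
    obtain ⟨L', c1, c2, c3, c4, c5, c6⟩ := exists_extension T h (Or.inl hp) (Or.inl hq) σ hψ'.1
      (ψ (u, p, -1)) (fun _ => ⟨rfl, hψ'.2 _ _ hp⟩) (fun _ => ⟨e1.symm, hψ'.2 _ _ hq⟩)
    have c7 : bdy H L' u w = 0 := by
      rw [bdy_apply_of_adj h.adj, c3, c3]; exact CharTwo.add_self_eq_zero _
    refine ⟨L', addEdge_isFaceLabel h c1 (fun a b hab => (c4 a b hab).trans (hψ'.2 a b hab)) c5 c6,
      bdy_eq_of_extension h c2 c7 (by rw [c1.bdy_symm, c7])⟩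
  -- The new edge lies on the boundary of `φ`, so adding that boundary when necessary turns every
  -- cycle into one of the old graph.
  have hred : ∀ z ∈ cycleSpace H, z + z u w • bdy H φ ∈ cycleSpace K := by
    intro z hz
    rw [h.mem_cycleSpace_iff]
    refine ⟨add_mem hz (Submodule.smul_mem _ _ hφz), ?_⟩
    simp only [Pi.add_apply, Pi.smul_apply, hφb, smul_eq_mul, mul_one]
    exact CharTwo.add_self_eq_zero _
  have hφB : bdy H φ ∈ S.boundarySpace := ⟨φ, hφf, rfl⟩
  have hback : ∀ z (k : ZMod 2), z + k • bdy H φ ∈ T.boundarySpace → z ∈ S.boundarySpace := by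
    intro z k hz
    have := Submodule.sub_mem _ (hbd _ hz) (Submodule.smul_mem _ k hφB)
    simpa using this
  refine ⟨S, fun hT z hz => hback z _ (hT (hred z hz)), fun hT z hz z' hz' => ?_, ?_⟩
  · rcases hT _ (hred z hz) _ (hred z' hz') with h1 | h1 | h1
    · exact Or.inl (hback _ _ h1)
    · exact Or.inr (Or.inl (hback _ _ h1))
    · refine Or.inr (Or.inr (hback (z + z') (z u w + z' u w) ?_))
      convert h1 using 1
      rw [add_smul]; abel
  -- A second chord survives the insertion if the new edge does not cross it, that is, if the
  -- corners of the new edge are on the same side of that chord. The equality of the values of `M`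
  -- says this.
  · intro c c' M hM d1 d2 d3 d4 d5 d6 hMe
    obtain ⟨L', c1, c2, c3, c4, c5, c6⟩ := exists_extension T h (Or.inl hp) (Or.inl hq) σ hM.1
      (M (u, p, -1)) (fun _ => ⟨rfl, by rw [hM.2 _ _ hp, if_neg d1.symm, if_neg d3.symm, add_zero]⟩)
      (fun _ => ⟨hMe.symm, by rw [hM.2 _ _ hq, if_neg d2.symm, if_neg d4.symm, add_zero]⟩)
    refine ⟨L', c1, fun a b hab => ?_⟩
    rcases (h.adj_iff a b).1 hab with h' | ⟨rfl, rfl⟩ | ⟨rfl, rfl⟩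
    · rw [c4 a b h', hM.2 a b h']
    · rw [c5, if_neg, if_neg, add_zero]
      · rintro rfl; exact h.not_adj d6
      · rintro rfl; exact h.not_adj d5
    · rw [c6, if_neg, if_neg, add_zero]
      · rintro rfl; exact h.not_adj d6.symm
      · rintro rfl; exact h.not_adj d5.symm

/-- An edge can be added between two components. -/
theorem exists_addEdge_of_not_reachable {V : Type*} [Fintype V] {K H : SimpleGraph V}
    {u w : V} (T : RotationSystem K)
    (h : IsAddEdge K H u w) (hr : ¬ K.Reachable u w) (hT : T.IsProjective) :
    ∃ S : RotationSystem H, S.IsProjective := by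
  classical
  have hex : ∀ a b : V, ∃ p, K.Adj a p ∨ (∀ y, ¬ K.Adj a y) ∧ p = b := by
    intro a b
    by_cases ha : ∃ p, K.Adj a p
    · exact ⟨ha.choose, Or.inl ha.choose_spec⟩
    · exact ⟨b, Or.inr ⟨fun y hy => ha ⟨y, hy⟩, rfl⟩⟩
  obtain ⟨p, hp⟩ := hex u w
  obtain ⟨q, hq⟩ := hex w u
  set c : V → ZMod 2 := fun v => if K.Reachable u v then 1 else 0 with hc
  have hcadj : ∀ a b, K.Adj a b → c a = c b := by
    intro a b hab
    have : K.Reachable u a ↔ K.Reachable u b :=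
      ⟨fun h' => h'.trans hab.reachable, fun h' => h'.trans hab.symm.reachable⟩
    simp only [hc, this]
  have hcu : c u = 1 := if_pos (Reachable.refl _)
  have hcw : c w = 0 := if_neg hr
  have hcyc : ∀ z ∈ cycleSpace H, z ∈ cycleSpace K := by
    intro z hz
    rw [h.mem_cycleSpace_iff]
    refine ⟨hz, ?_⟩
    obtain ⟨h1, h2, h3⟩ := hz
    -- The new edge is a bridge. Adding the vertex conditions over the component of `u` counts every
    -- edge inside it twice, which leaves the coefficient of the bridge.
    have e1 : ∑ a, ∑ b, c a * z a b = 0 := by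
      simp [← Finset.mul_sum, h3]
    have e2 : ∑ a, ∑ b, c a * c b * z a b = 0 :=
      sum_symm_eq_zero _ (fun a b => by rw [h1 a b]; ring) fun a => by
        rw [h2 a a (SimpleGraph.irrefl _), mul_zero]
    have e3 : ∀ a b, c a * z a b = c a * c b * z a b + (if a = u ∧ b = w then z u w else 0) := by
      intro a b
      by_cases hab : H.Adj a b
      · rcases (h.adj_iff a b).1 hab with h' | ⟨rfl, rfl⟩ | ⟨rfl, rfl⟩
        · rw [if_neg (by rintro ⟨rfl, rfl⟩; exact h.not_adj h'), ← hcadj a b h', add_zero]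
          congr 1
          rcases zmod_two_eq (c a) with h4 | h4 <;> simp [h4]
        · simp [hcu, hcw]
        · simp [hcw, h.ne]
      · rw [h2 a b hab, if_neg (by rintro ⟨rfl, rfl⟩; exact hab h.adj)]
        simp
    simp only [e3, Finset.sum_add_distrib, e2, zero_add] at e1
    rw [← e1]
    rw [Finset.sum_eq_single u (fun a _ ha => Finset.sum_eq_zero fun b _ => if_neg (by tauto))
      (by simp), Finset.sum_eq_single w (fun b _ hb => if_neg (by tauto)) (by simp), if_pos ⟨rfl, rfl⟩]
  set S := T.addEdge h p q hp hq 1 with hS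
  have hbd : ∀ z, z ∈ T.boundarySpace → z ∈ S.boundarySpace := by
    rintro _ ⟨ψ, hψ, rfl⟩
    have hψ' : T.IsFaceLabel ψ := hψ
    -- The two faces to be joined may have different values of `ψ`; adding the constant `m` on the
    -- component of `u` makes them agree and does not alter the boundary.
    obtain ⟨m, k, e1, e2⟩ : ∃ m k : ZMod 2,
        (K.Adj u p → ψ (u, p, -1) + m = k) ∧ (K.Adj w q → ψ (w, q, -1) = k) := by
      by_cases hup : K.Adj u p
      · by_cases hwq : K.Adj w q
        · exact ⟨ψ (w, q, -1) - ψ (u, p, -1), ψ (w, q, -1), fun _ => by ring, fun _ => rfl⟩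
        · exact ⟨0, ψ (u, p, -1), fun _ => by ring, fun h' => absurd h' hwq⟩
      · exact ⟨0, ψ (w, q, -1), fun h' => absurd h' hup, fun _ => rfl⟩
    have hm : T.IsFaceLabel (fun f => m * c f.1) := by
      refine ⟨fun f hf => ?_, fun a b _ => ?_⟩
      · change m * c f.2.1 = m * c f.1
        rw [hcadj _ _ hf]
      · exact CharTwo.add_self_eq_zero _
    have hψm := hψ'.add hm
    obtain ⟨L', c1, c2, c3, c4, c5, c6⟩ := exists_extension T h hp hq 1 hψm.1 k
      (fun h' => ⟨by simp [hcu, e1 h'], hψm.2 _ _ h'⟩)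
      (fun h' => ⟨by simp [hcw, e2 h'], hψm.2 _ _ h'⟩)
    have c7 : bdy H L' u w = 0 := by
      rw [bdy_apply_of_adj h.adj, c3, c3]; exact CharTwo.add_self_eq_zero _
    refine ⟨L', addEdge_isFaceLabel h c1 (fun a b hab => (c4 a b hab).trans (hψm.2 a b hab)) c5 c6,
      (bdy_eq_of_extension h c2 c7 (by rw [c1.bdy_symm, c7])).trans ?_⟩
    rw [map_add]
    have : bdy K (fun f => m * c f.1) = 0 := by
      ext a b
      by_cases hab : K.Adj a b
      · rw [bdy_apply_of_adj hab]; exact CharTwo.add_self_eq_zero _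
      · exact bdy_apply_of_not_adj hab _
    rw [this, add_zero]
  exact ⟨S, fun z hz z' hz' => (hT z (hcyc z hz) z' (hcyc z' hz')).imp (hbd _)
    fun h' => h'.imp (hbd _) (hbd _)⟩

/-- Delete an edge. -/
def deleteEdge {V : Type*} [Finite V] [DecidableEq V] {K H : SimpleGraph V} {u w : V}
    (S : RotationSystem H) (h : IsAddEdge K H u w) : RotationSystem K where
  rot v := if v = u then Equiv.swap w (S.rot u w) * S.rot u else
    if v = w then Equiv.swap u (S.rot w u) * S.rot w else S.rot v
  sgn := S.sgn
  sgn_comm := S.sgn_comm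
  isCycleOn_rot v := by
    have aux : ∀ u w : V, IsAddEdge K H u w →
        (Equiv.swap w (S.rot u w) * S.rot u).IsCycleOn (K.neighborSet u) := by
      intro u w h
      have := isCycleOn_swap_mul (S.isCycleOn_rot u) (x := w) h.adj
      rwa [h.neighborSet_left, Set.insert_sdiff_of_mem _ (Set.mem_singleton w),
        Set.sdiff_singleton_eq_self (by exact h.not_adj)] at this
    split_ifs with h1 h2
    · subst h1; exact aux _ _ h
    · subst h2; exact aux _ _ h.symm
    · rw [← h.neighborSet_of_ne h1 h2]; exact S.isCycleOn_rot v
  rot_of_not_adj v b hb := by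
    have aux : ∀ u w : V, IsAddEdge K H u w → ∀ b, ¬ K.Adj u b →
        (Equiv.swap w (S.rot u w) * S.rot u) b = b := by
      intro u w h b hb
      rw [Equiv.Perm.mul_apply]
      by_cases hbw : b = w
      · subst hbw; exact Equiv.swap_apply_right _ _
      · have hub : ¬ H.Adj u b := by rw [h.adj_iff_left]; tauto
        rw [S.rot_of_not_adj _ _ hub, Equiv.swap_apply_of_ne_of_ne hbw]
        rintro rfl
        exact hub (S.adj_rot_iff.2 h.adj)
    split_ifs with h1 h2
    · subst h1; exact aux _ _ h b hb
    · subst h2; exact aux _ _ h.symm b hb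
    · exact S.rot_of_not_adj _ _ fun h' => hb ((h.adj_iff_of_ne h1 h2).1 h')

section DeleteEdge

variable (h : IsAddEdge K H u w)

theorem deleteEdge_edgeCompat (S : RotationSystem H) {L : V × V × ℤˣ → ZMod 2}
    (hL : S.EdgeCompat L) : (S.deleteEdge h).EdgeCompat L :=
  fun f hf => hL f (h.le hf)

theorem deleteEdge_symm (S : RotationSystem H) : S.deleteEdge h = S.deleteEdge h.symm := by
  unfold deleteEdge
  congr 1
  ext v
  by_cases h1 : v = u
  · simp [h1, h.ne]
  · by_cases h2 : v = w
    · simp [h2, h.ne.symm]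
    · simp [h1, h2]

/-- The two corners at `u` next to the deleted edge become one corner. Its jump is the sum of their
jumps and of the difference of the label across that edge. -/
theorem deleteEdge_jump_left (S : RotationSystem H) (L : V × V × ℤˣ → ZMod 2) {b : V}
    (hb : K.Adj u b) : (S.deleteEdge h).jump L u b
      = S.jump L u b + if S.rot u b = w then S.jump L u w + bdy H L u w else 0 := by
  have hr : (S.deleteEdge h).rot u = Equiv.swap w (S.rot u w) * S.rot u := if_pos rfl
  rw [jump, hr, Equiv.Perm.mul_apply]
  split_ifs with h'
  · rw [h', Equiv.swap_apply_left, bdy_apply_of_adj h.adj, jump, jump, h']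
    have h2 : (2 : ZMod 2) = 0 := rfl
    linear_combination (-L (u, w, 1) - L (u, w, -1)) * h2
  · rw [Equiv.swap_apply_of_ne_of_ne h', add_zero]
    · rfl
    · intro h1
      have := (S.rot u).injective h1
      subst this
      exact h.not_adj hb

theorem deleteEdge_jump_right (S : RotationSystem H) (L : V × V × ℤˣ → ZMod 2) {b : V}
    (hb : K.Adj w b) : (S.deleteEdge h).jump L w b
      = S.jump L w b + if S.rot w b = u then S.jump L w u + bdy H L w u else 0 := by
  rw [deleteEdge_symm]
  exact deleteEdge_jump_left h.symm S L hb

theorem deleteEdge_jump_of_ne (S : RotationSystem H) (L : V × V × ℤˣ → ZMod 2) {a b : V}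
    (hu : a ≠ u) (hw : a ≠ w) : (S.deleteEdge h).jump L a b = S.jump L a b := by
  have hr : (S.deleteEdge h).rot a = S.rot a := (if_neg hu).trans (if_neg hw)
  rw [jump, hr]; rfl

theorem deleteEdge_isFaceLabel {S : RotationSystem H} {L : V × V × ℤˣ → ZMod 2}
    (hL : S.IsFaceLabel L) (hb : bdy H L u w = 0) : (S.deleteEdge h).IsFaceLabel L := by
  refine ⟨deleteEdge_edgeCompat h S hL.1, fun a b hab => ?_⟩
  by_cases hu : a = u
  · subst hu
    rw [deleteEdge_jump_left h S L hab, hL.2 _ _ (h.le hab), hL.2 _ _ h.adj, hb]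
    simp
  · by_cases hw : a = w
    · subst hw
      rw [deleteEdge_jump_right h S L hab, hL.2 _ _ (h.le hab), hL.2 _ _ h.adj.symm,
        hL.1.bdy_symm, hb]
      simp
    · rw [deleteEdge_jump_of_ne h S L hu hw, hL.2 _ _ (h.le hab)]

omit [Finite V] [DecidableEq V] in
theorem bdy_eq_of_isAddEdge (h : IsAddEdge K H u w) {S : RotationSystem H}
    {L : V × V × ℤˣ → ZMod 2} (hL : S.EdgeCompat L) (hb : bdy H L u w = 0) :
    bdy H L = bdy K L :=
  bdy_eq_of_extension h (fun _ _ => rfl) hb (by rw [hL.bdy_symm, hb])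

theorem deleteEdge_mem_boundarySpace {S : RotationSystem H} {z : V → V → ZMod 2}
    (hz : z ∈ S.boundarySpace) (h0 : z u w = 0) : z ∈ (S.deleteEdge h).boundarySpace := by
  obtain ⟨L, hL, rfl⟩ := hz
  have hL' : S.IsFaceLabel L := hL
  exact ⟨L, deleteEdge_isFaceLabel h hL' h0, (bdy_eq_of_isAddEdge h hL'.1 h0).symm⟩

end DeleteEdge

theorem IsProjective.deleteEdge {V : Type*} [Fintype V] [DecidableEq V] {K H : SimpleGraph V}
    {u w : V} {S : RotationSystem H} (hS : S.IsProjective) (h : IsAddEdge K H u w) :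
    (S.deleteEdge h).IsProjective := by
  intro z hz z' hz'
  rw [h.mem_cycleSpace_iff] at hz hz'
  rcases hS z hz.1 z' hz'.1 with h1 | h1 | h1
  · exact Or.inl (deleteEdge_mem_boundarySpace h h1 hz.2)
  · exact Or.inr (Or.inl (deleteEdge_mem_boundarySpace h h1 hz'.2))
  · exact Or.inr (Or.inr (deleteEdge_mem_boundarySpace h h1 (by simp [hz.2, hz'.2])))

end RotationSystem
end SimpleGraph

/-! ### Triangles as cycles, separation by bounding cycles, and edge-maximal graphs -/

namespace SimpleGraph

section Graph

variable {V : Type*} {H : SimpleGraph V} {u w : V}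

theorem isAddEdge_sup_edge (hne : u ≠ w) (h : ¬ H.Adj u w) : IsAddEdge H (H ⊔ edge u w) u w :=
  ⟨hne, h, fun a b => by
    rw [sup_adj, edge_adj]
    constructor
    · rintro (h' | ⟨h', -⟩)
      · exact Or.inl h'
      · exact Or.inr h'
    · rintro (h' | h')
      · exact Or.inl h'
      · refine Or.inr ⟨h', ?_⟩
        rcases h' with ⟨rfl, rfl⟩ | ⟨rfl, rfl⟩
        · exact hne
        · exact hne.symm⟩

theorem isAddEdge_deleteEdges (h : H.Adj u w) : IsAddEdge (H.deleteEdges {s(u, w)}) H u w :=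
  ⟨h.ne, fun h' => by simp [deleteEdges_adj] at h', fun a b => by
    rw [deleteEdges_adj, Set.mem_singleton_iff, Sym2.eq_iff]
    constructor
    · intro h'; tauto
    · rintro (h' | ⟨rfl, rfl⟩ | ⟨rfl, rfl⟩)
      · exact h'.1
      · exact h
      · exact h.symm⟩

theorem mem_of_reachable {s : Set V} (hs : ∀ a ∈ s, ∀ b, H.Adj a b → b ∈ s) {a b : V}
    (hab : H.Reachable a b) (ha : a ∈ s) : b ∈ s := by
  obtain ⟨p⟩ := hab
  induction p with
  | nil => exact ha
  | cons h' _ ih => exact ih (hs _ ha _ h')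

theorem add_self_eq_zero_of_zmod_two (z : V → V → ZMod 2) : z + z = 0 := by
  ext u v
  exact CharTwo.add_self_eq_zero _

/-- The indicator function of an edge. -/
def edgeInd [DecidableEq V] (a b u v : V) : ZMod 2 :=
  if (u = a ∧ v = b) ∨ (u = b ∧ v = a) then 1 else 0

theorem edgeInd_comm [DecidableEq V] (a b : V) : edgeInd a b = edgeInd b a := by
  ext u v
  unfold edgeInd
  exact if_congr or_comm rfl rfl

theorem edgeInd_symm [DecidableEq V] (a b u v : V) : edgeInd a b u v = edgeInd a b v u := by
  unfold edgeInd
  exact if_congr (by tauto) rfl rfl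

theorem edgeInd_of_ne [DecidableEq V] {a b u : V} (ha : u ≠ a) (hb : u ≠ b) (v : V) :
    edgeInd a b u v = 0 := by
  simp [edgeInd, ha, hb]

theorem edgeInd_left [DecidableEq V] {a b : V} (h : a ≠ b) (v : V) :
    edgeInd a b a v = if v = b then 1 else 0 := by
  simp [edgeInd, h]

theorem edgeInd_right [DecidableEq V] {a b : V} (h : a ≠ b) (v : V) :
    edgeInd a b b v = if v = a then 1 else 0 := by
  simp [edgeInd, h.symm]

theorem sum_edgeInd [Fintype V] [DecidableEq V] {a b : V} (h : a ≠ b) (u : V) :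
    ∑ v, edgeInd a b u v = (if u = a then 1 else 0) + (if u = b then 1 else 0) := by
  by_cases ha : u = a
  · subst ha
    simp [edgeInd_left h, h]
  · by_cases hb : u = b
    · subst hb
      simp [edgeInd_right h, h.symm]
    · simp [edgeInd_of_ne ha hb, ha, hb]

/-- The edge set of a triangle. -/
def tri [DecidableEq V] (a b c : V) : V → V → ZMod 2 := edgeInd a b + edgeInd b c + edgeInd c a

theorem tri_mem_cycleSpace [Fintype V] [DecidableEq V] {a b c : V} (hab : H.Adj a b)
    (hbc : H.Adj b c) (hca : H.Adj c a) : tri a b c ∈ cycleSpace H := by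
  have key : ∀ {a b u v : V}, H.Adj a b → ¬ H.Adj u v → edgeInd a b u v = 0 := by
    intro a b u v h h'
    refine if_neg ?_
    rintro (⟨rfl, rfl⟩ | ⟨rfl, rfl⟩)
    · exact h' h
    · exact h' h.symm
  refine ⟨fun u v => ?_, fun u v h => ?_, fun u => ?_⟩
  · simp only [tri, Pi.add_apply, edgeInd_symm _ _ u v]
  · simp only [tri, Pi.add_apply, key hab h, key hbc h, key hca h, add_zero]
  · simp only [tri, Pi.add_apply, Finset.sum_add_distrib, sum_edgeInd hab.ne, sum_edgeInd hbc.ne,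
      sum_edgeInd hca.ne]
    have h2 : (2 : ZMod 2) = 0 := rfl
    linear_combination ((if u = a then (1 : ZMod 2) else 0) + (if u = b then 1 else 0)
      + (if u = c then 1 else 0)) * h2

theorem tri_apply [DecidableEq V] {a b c : V} (hac : a ≠ c) (hbc : b ≠ c) : tri a b c a b = 1 := by
  simp [tri, edgeInd, hac, hbc]

end Graph

namespace RotationSystem

variable {V : Type*} {H : SimpleGraph V} {u w : V}

theorem adj_corner (E : RotationSystem H) {f : V × V × ℤˣ} (hf : H.Adj f.1 f.2.1) :
    H.Adj (E.corner f).1 (E.corner f).2 := by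
  unfold corner
  split_ifs
  · exact E.adj_rot_inv_iff.2 hf
  · exact hf

theorem sameFace_corner (E : RotationSystem H) (f : V × V × ℤˣ) :
    E.SameFace f ((E.corner f).1, (E.corner f).2, -1) := by
  obtain ⟨a, b, ε⟩ := f
  rcases Int.units_eq_one_or ε with rfl | rfl
  · rw [corner_one]
    have h := E.step_rev_neg_one a ((E.rot a)⁻¹ b)
    rw [perm_apply_inv] at h
    rw [← h]
    exact ((E.sameFace_rev _).trans E (E.sameFace_step _)).symm E
  · rw [corner_neg_one]
    exact SameFace.refl E _

theorem eq_of_rot_eq_self (E : RotationSystem H) {x y : V} (hx : H.Adj u x) (hy : H.Adj u y)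
    (h : E.rot u x = x) : y = x := by
  obtain ⟨i, hi⟩ := (E.isCycleOn_rot u).2 (show x ∈ H.neighborSet u from hx) hy
  rw [← hi]
  exact Function.IsFixedPt.perm_zpow h i

theorem rot_eq_self_of_zpow (E : RotationSystem H) {x : V} (ε : ℤˣ)
    (h : (E.rot u ^ (ε : ℤ)) x = x) : E.rot u x = x := by
  rcases Int.units_eq_one_or ε with rfl | rfl
  · simpa using h
  · have h' : (E.rot u)⁻¹ x = x := by simpa using h
    rw [Equiv.Perm.inv_eq_iff_eq] at h'
    exact h'.symm

section Labels

variable [Finite V] [DecidableEq V] {E : RotationSystem H} {α : V × V × ℤˣ → ZMod 2}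

/-- Turning around `u`, the label changes neither across an edge, as the boundary avoids `u`, nor at
a corner. -/
theorem IsFaceLabel.eq_at_vertex (hα : E.IsFaceLabel α) (h0 : ∀ x, bdy H α u x = 0) {x y : V}
    (hx : H.Adj u x) (hy : H.Adj u y) (ε ε' : ℤˣ) : α (u, x, ε) = α (u, y, ε') := by
  obtain ⟨n, -, rfl⟩ :=
    ((E.isCycleOn_rot u).2 (show x ∈ H.neighborSet u from hx) hy).exists_pow_eq'
  clear hy
  rw [eq_of_bdy_eq_zero hx (h0 x) ε 1]
  suffices h : H.Adj u ((E.rot u ^ n) x) ∧ α (u, x, 1) = α (u, (E.rot u ^ n) x, 1) by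
    rw [h.2, eq_of_bdy_eq_zero h.1 (h0 _) ε' 1]
  induction n with
  | zero => exact ⟨hx, rfl⟩
  | succ n ih =>
    rw [pow_succ', Equiv.Perm.mul_apply]
    refine ⟨E.adj_rot_iff.2 ih.1, ?_⟩
    rw [hα.rot_one ih.1, ih.2]
    exact eq_of_bdy_eq_zero ih.1 (h0 _) _ _

theorem IsFaceLabel.eq_of_reachable (hα : E.IsFaceLabel α) (h0 : bdy H α = 0) {a b x y : V}
    (hab : H.Reachable a b) (hx : H.Adj a x) (hy : H.Adj b y) (ε ε' : ℤˣ) :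
    α (a, x, ε) = α (b, y, ε') := by
  have h1 : ∀ u x, bdy H α u x = 0 := fun u x => by rw [h0]; rfl
  obtain ⟨p⟩ := hab
  induction p generalizing x with
  | nil => exact hα.eq_at_vertex (h1 _) hx hy _ _
  | @cons u v t h' _ ih =>
    rw [hα.eq_at_vertex (h1 _) hx h' ε 1, ← hα.rev (f := (u, v, 1)) h', rev_mk,
      eq_of_bdy_eq_zero h'.symm (h1 _ _) _ ε]
    exact ih h'.symm hy

/-- The side of `v` towards the corner has label `0`, so crossing `v` leads to label `1`. Turning on
around `y`, the label stays `1` until `x`, the only other boundary edge at `y`, is reached; behind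
`x` there is only the corner. -/
theorem IsFaceLabel.eq_one_of_corner (hα : E.IsFaceLabel α) {y x v : V} (hv : H.Adj y v)
    (hx : E.rot y x = v) (h0 : α (y, v, 1) = 0)
    (hb : ∀ t, bdy H α y t = if t = x ∨ t = v then 1 else 0) {t : V} (ht : H.Adj y t)
    (htx : t ≠ x) (htv : t ≠ v) (ε : ℤˣ) : α (y, t, ε) = 1 := by
  have key : ∀ {s}, H.Adj y s → bdy H α y s = α (y, s, 1) + α (y, s, -1) :=
    fun h => bdy_apply_of_adj h α
  have main : α (y, t, -1) = 1 := by
    obtain ⟨n, -, rfl⟩ :=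
      ((E.isCycleOn_rot y).2 (show v ∈ H.neighborSet y from hv) ht).exists_pow_eq'
    clear htv ht
    suffices h : H.Adj y ((E.rot y ^ n) v) ∧
        ((E.rot y ^ n) v = x ∨ α (y, (E.rot y ^ n) v, -1) = 1) from h.2.resolve_left htx
    clear htx
    have hv1 : α (y, v, -1) = 1 := by
      have := key hv
      rw [hb v, if_pos (Or.inr rfl), h0, zero_add] at this
      exact this.symm
    induction n with
    | zero => exact ⟨hv, Or.inr hv1⟩
    | succ n ih =>
      rw [pow_succ', Equiv.Perm.mul_apply]
      obtain ⟨ih1, ih2⟩ := ih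
      generalize (E.rot y ^ n) v = s at ih1 ih2
      refine ⟨E.adj_rot_iff.2 ih1, ?_⟩
      rcases ih2 with rfl | ih2
      · rw [hx]; exact Or.inr hv1
      · by_cases h1 : E.rot y s = x
        · exact Or.inl h1
        · right
          by_cases h2 : E.rot y s = v
          · rw [h2]; exact hv1
          · have h3 := hb (E.rot y s)
            rw [if_neg (by tauto)] at h3
            rw [eq_of_bdy_eq_zero (E.adj_rot_iff.2 ih1) h3 (-1) 1, hα.rot_one ih1, ih2]
  rw [← main]
  have h3 := hb t
  rw [if_neg (by tauto)] at h3
  exact eq_of_bdy_eq_zero ht h3 _ _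

/-- If the boundary of a set of faces passes a vertex `y` along a corner of a face outside of the
set, and not otherwise, then all the other edges at `y` have the set on both sides. -/
theorem IsFaceLabel.eq_one_of_step (hα : E.IsFaceLabel α) {f : V × V × ℤˣ} (hf : H.Adj f.1 f.2.1)
    (h0 : α f = 0)
    (hb : ∀ t, bdy H α f.2.1 t = if t = f.1 ∨ t = (E.step f).2.1 then 1 else 0) {t : V}
    (ht : H.Adj f.2.1 t) (htx : t ≠ f.1) (htv : t ≠ (E.step f).2.1) (ε : ℤˣ) :
    α (f.2.1, t, ε) = 1 := by
  have hs := hα.step hf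
  have hr := hα.rev hf
  rw [h0] at hs hr
  have hadj := E.adj_step hf
  obtain ⟨v, hv⟩ : ∃ v, (E.step f).2.1 = v := ⟨_, rfl⟩
  rw [hv] at htv hadj
  simp only [hv] at hb
  obtain ⟨x, y, δ⟩ := f
  rw [rev_mk] at hr
  rw [step_mk] at hs hv
  -- The walk turns with or against the rotation at `y`. The second case is the first one with the
  -- two edges of the corner exchanged.
  rcases Int.units_eq_one_or (δ * E.sgn x y) with h1 | h1
  · rw [h1] at hs hv
    simp only [Units.val_one, zpow_one] at hs hv
    rw [hv] at hs
    exact hα.eq_one_of_corner hadj hv hs hb ht htx htv ε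
  · rw [h1] at hv hr
    rw [neg_neg] at hr
    have h2 : ((-1 : ℤˣ) : ℤ) = -1 := rfl
    simp only [h2, zpow_neg_one] at hv
    exact hα.eq_one_of_corner hf.symm (by rw [← hv]; exact perm_apply_inv _ _) hr
      (fun t => (hb t).trans (if_congr or_comm rfl rfl)) ht htv htx ε

/-- Complementing a set of faces does not change its boundary, so a prescribed face can be assumed
to lie outside. -/
theorem exists_isFaceLabel_eq_zero {z : V → V → ZMod 2} (hz : z ∈ E.boundarySpace)
    (f : V × V × ℤˣ) : ∃ α, E.IsFaceLabel α ∧ bdy H α = z ∧ α f = 0 := by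
  obtain ⟨α, hα, rfl⟩ := hz
  have hα' : E.IsFaceLabel α := hα
  refine ⟨α + fun _ => α f, hα'.add (isFaceLabel_const _), ?_, ?_⟩
  · rw [map_add]
    have : bdy H (fun _ : V × V × ℤˣ => α f) = 0 := by
      ext a b
      by_cases hab : H.Adj a b
      · rw [bdy_apply_of_adj hab]; exact CharTwo.add_self_eq_zero _
      · exact bdy_apply_of_not_adj hab _
    rw [this, add_zero]
  · exact CharTwo.add_self_eq_zero _

/-- An edge cannot leave a bounding cycle at a corner of a face and end elsewhere on that face. -/
theorem false_of_corner {z : V → V → ZMod 2} (hz : z ∈ E.boundarySpace) {f g : V × V × ℤˣ}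
    (hf : H.Adj f.1 f.2.1) (hg : H.Adj g.1 g.2.1) (hfg : E.SameFace f g)
    (hb : ∀ t, z f.2.1 t = if t = f.1 ∨ t = (E.step f).2.1 then 1 else 0)
    (hb' : ∀ t, z g.1 t = 0) (hgf : H.Adj f.2.1 g.1) (h1 : g.1 ≠ f.1)
    (h2 : g.1 ≠ (E.step f).2.1) : False := by
  obtain ⟨α, hα, rfl, h0⟩ := exists_isFaceLabel_eq_zero hz f
  have h3 := hα.eq_one_of_step hf h0 hb hgf h1 h2 1
  have h4 : α g = 0 := (hα.sameFace hf hg hfg).trans h0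
  rw [← hα.rev (f := (f.2.1, g.1, 1)) hgf, rev_mk,
    hα.eq_at_vertex hb' hgf.symm hg _ g.2.2] at h3
  exact zero_ne_one (h4.symm.trans h3)

end Labels

variable [Fintype V] [DecidableEq V]

/-- No edge can be added to the graph, except that the Euler genus gets larger than one. -/
def IsEdgeMaximal (H : SimpleGraph V) : Prop :=
  ∀ u w H', IsAddEdge H H' u w → ∀ S : RotationSystem H', ¬ S.IsProjective

variable {E : RotationSystem H}

theorem IsEdgeMaximal.preconnected (hmax : IsEdgeMaximal H) (hE : E.IsProjective) :
    H.Preconnected := by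
  intro u w
  by_contra hr
  have hne : u ≠ w := by rintro rfl; exact hr (Reachable.refl _)
  have h := isAddEdge_sup_edge hne fun h' => hr h'.reachable
  obtain ⟨S, hS⟩ := exists_addEdge_of_not_reachable E h hr hE
  exact hmax _ _ _ h S hS

theorem IsEdgeMaximal.adj_of_sameFace (hmax : IsEdgeMaximal H) (hE : E.IsProjective)
    {f g : V × V × ℤˣ} (hf : H.Adj f.1 f.2.1) (hg : H.Adj g.1 g.2.1) (hfg : E.SameFace f g)
    (hne : f.1 ≠ g.1) : H.Adj f.1 g.1 := by
  by_contra hadj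
  have h := isAddEdge_sup_edge hne hadj
  obtain ⟨L, hL, -⟩ := E.exists_isLink hfg
  obtain ⟨S, -, hS, -⟩ := exists_addEdge_of_isLink E h (p := (E.corner f).2)
    (q := (E.corner g).2) hL (E.adj_corner hf) (E.adj_corner hg)
  exact hmax _ _ _ h S (hS hE)

/-- A walk that turns back does so at a leaf. The leaf shares its face with the vertex reached two
steps after it, hence is adjacent to that vertex unless it is equal to it. The first is impossible
for a leaf; the second makes its neighbour a leaf too, so that the graph has just two vertices. -/
theorem IsEdgeMaximal.turn_ne (hmax : IsEdgeMaximal H) (hE : E.IsProjective)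
    (hn : 3 ≤ Fintype.card V) {f : V × V × ℤˣ} (hf : H.Adj f.1 f.2.1) :
    (E.step f).2.1 ≠ f.1 := by
  intro heq
  have h1 := E.adj_step hf
  have h2 := E.adj_step h1
  have e1 : (E.step (E.step f)).1 = f.1 := heq
  have hfix : E.rot f.2.1 f.1 = f.1 := E.rot_eq_self_of_zpow _ heq
  have hw : ∀ y, H.Adj f.2.1 y → y = f.1 := fun y hy => E.eq_of_rot_eq_self hf.symm hy hfix
  by_cases h3 : (E.step (E.step f)).2.1 = f.2.1
  · have hfix' : E.rot f.1 f.2.1 = f.2.1 := by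
      have : (E.rot (E.step f).2.1 ^ (((E.step f).2.2 * E.sgn (E.step f).1 (E.step f).2.1 : ℤˣ) : ℤ))
        (E.step f).1 = f.2.1 := h3
      rw [heq, step_fst] at this
      exact E.rot_eq_self_of_zpow _ this
    have hu : ∀ y, H.Adj f.1 y → y = f.2.1 := fun y hy => E.eq_of_rot_eq_self hf hy hfix'
    have hall : ∀ v, v ∈ ({f.1, f.2.1} : Set V) := fun v =>
      mem_of_reachable (a := f.1) (by
        rintro a (rfl | rfl) b hb
        · exact Or.inr (hu b hb)
        · exact Or.inl (hw b hb)) (hmax.preconnected hE f.1 v) (Or.inl rfl)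
    have : Fintype.card V ≤ 2 := by
      rw [← Finset.card_univ]
      refine (Finset.card_le_card (t := {f.1, f.2.1}) fun v _ => ?_).trans Finset.card_le_two
      simpa using hall v
    omega
  · have h4 := E.adj_step h2
    have h5 := hmax.adj_of_sameFace hE (f := E.step f) (g := E.step (E.step (E.step f))) h1 h4
      ((E.sameFace_step _).trans E (E.sameFace_step _)) fun h' => h3 h'.symm
    have h6 := hw _ h5
    rw [e1] at h2
    change (E.step (E.step f)).2.1 = f.1 at h6
    rw [h6] at h2
    exact h2.ne rfl

theorem IsEdgeMaximal.adj_turn (hmax : IsEdgeMaximal H) (hE : E.IsProjective)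
    (hn : 3 ≤ Fintype.card V) {f : V × V × ℤˣ} (hf : H.Adj f.1 f.2.1) :
    H.Adj (E.step f).2.1 f.1 :=
  (hmax.adj_of_sameFace hE hf (E.adj_step (E.adj_step hf))
    ((E.sameFace_step _).trans E (E.sameFace_step _)) (hmax.turn_ne hE hn hf).symm).symm

/-- The two sides of every edge are different faces. -/
theorem IsEdgeMaximal.exists_bdy_eq_one (hmax : IsEdgeMaximal H) (hE : E.IsProjective)
    (hn : 3 ≤ Fintype.card V)
    (hsph : E.IsSpherical ∨ ∀ S : RotationSystem H, ¬ S.IsSpherical) (huw : H.Adj u w) :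
    ∃ α, E.IsFaceLabel α ∧ bdy H α u w = 1 := by
  obtain ⟨t, hwt, htu⟩ : ∃ t, H.Adj w t ∧ H.Adj t u :=
    ⟨_, E.adj_step (f := (u, w, 1)) huw, hmax.adj_turn hE hn (f := (u, w, 1)) huw⟩
  have hz0 := tri_mem_cycleSpace huw hwt htu
  have hz1 : tri u w t u w = 1 := tri_apply htu.ne.symm hwt.ne
  by_contra! hno
  have hno' : ∀ α, E.IsFaceLabel α → bdy H α u w = 0 := fun α hα =>
    (zmod_two_eq _).resolve_right (hno α hα)
  have hbno : ∀ z ∈ E.boundarySpace, z u w = 0 := by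
    rintro _ ⟨α, hα, rfl⟩
    exact hno' α hα
  -- If no boundary contains `uw`, the triangle through `uw` does not bound, nor does its sum with a
  -- cycle avoiding `uw`; by projectivity the latter cycle bounds.
  have hbd : ∀ z ∈ cycleSpace H, z u w = 0 → z ∈ E.boundarySpace := by
    intro z hz h0
    rcases hE z hz _ hz0 with h1 | h1 | h1
    · exact h1
    · exact absurd ((hbno _ h1).symm.trans hz1) zero_ne_one
    · have := hbno _ h1
      rw [Pi.add_apply, Pi.add_apply, h0, hz1, zero_add] at this
      exact absurd this one_ne_zero
  rcases hsph with hs | hs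
  · exact absurd ((hbno _ (hs hz0)).symm.trans hz1) zero_ne_one
  -- Without `uw` the embedding is spherical. The edge can be put back inside one face of it, which
  -- gives `H` a spherical embedding against the assumption.
  · have h := isAddEdge_deleteEdges huw
    set K := H.deleteEdges {s(u, w)} with hK
    set T := E.deleteEdge h with hT
    have hT0 : T.IsSpherical := by
      intro z hz
      rw [h.mem_cycleSpace_iff] at hz
      exact deleteEdge_mem_boundarySpace h (hbd z hz.1 hz.2) hz.2
    have hne : ∀ {a b c : V}, H.Adj a b → H.Adj a c → b ≠ c → (E.rot a)⁻¹ b ≠ b := by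
      intro a b c hab hac hbc he
      rw [Equiv.Perm.inv_eq_iff_eq] at he
      exact hbc (E.eq_of_rot_eq_self hab hac he.symm).symm
    have hp : K.Adj u ((E.rot u)⁻¹ w) :=
      (h.adj_iff_left.1 (E.adj_rot_inv_iff.2 huw)).resolve_right (hne huw htu.symm hwt.ne)
    have hq : K.Adj w ((E.rot w)⁻¹ u) :=
      (h.symm.adj_iff_left.1 (E.adj_rot_inv_iff.2 huw.symm)).resolve_right
        (hne huw.symm hwt htu.ne.symm)
    have hKr : K.Reachable u w := by
      have h1 : K.Adj u t := (h.adj_iff_left.1 htu.symm).resolve_right hwt.ne.symm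
      have h2 : K.Adj w t := (h.symm.adj_iff_left.1 hwt).resolve_right htu.ne
      exact h1.reachable.trans h2.symm.reachable
    -- The boundary of a label `ψ` of the smaller graph also bounds some `α` in the old embedding.
    -- The two labels differ by a constant, and `α` has the same value at the ends of `uw` because
    -- it cannot distinguish the sides of `uw`.
    have hsame : T.SameFace (u, (E.rot u)⁻¹ w, -1) (w, (E.rot w)⁻¹ u, -1) := by
      refine T.sameFace_of_forall_isFaceLabel fun ψ hψ => ?_
      have hψz := h.mem_cycleSpace_iff.1 hψ.bdy_mem
      obtain ⟨α, hα, hαψ⟩ := hbd _ hψz.1 hψz.2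
      have hα' : E.IsFaceLabel α := hα
      have hα0 := hno' α hα'
      have hαT := deleteEdge_isFaceLabel h hα' hα0
      have hb0 : bdy K (α + ψ) = 0 := by
        rw [map_add, ← bdy_eq_of_isAddEdge h hα'.1 hα0, hαψ]
        exact add_self_eq_zero_of_zmod_two _
      have e1 := (hαT.add hψ).eq_of_reachable hb0 hKr hp hq (-1) (-1)
      have e2 : α (u, (E.rot u)⁻¹ w, -1) = α (w, (E.rot w)⁻¹ u, -1) := by
        have a1 := hα'.rot_one (E.adj_rot_inv_iff.2 huw)
        have a2 := hα'.rot_one (E.adj_rot_inv_iff.2 huw.symm)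
        rw [perm_apply_inv] at a1 a2
        rw [← a1, ← a2, ← hα'.rev (f := (u, w, 1)) huw, rev_mk]
        refine eq_of_bdy_eq_zero huw.symm ?_ _ _
        rw [hα'.1.bdy_symm, hα0]
      simp only [Pi.add_apply, e2] at e1
      exact add_left_cancel e1
    obtain ⟨L, hL, -⟩ := T.exists_isLink hsame
    rw [corner_neg_one, corner_neg_one] at hL
    obtain ⟨S, hS, -⟩ := exists_addEdge_of_isLink T h hL hp hq
    exact hs S (hS hT0)

/-- If an edge can be rerouted through a face that is not on its sides, then the vertices of the
two faces on its sides are adjacent to each other. -/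
theorem IsEdgeMaximal.adj_of_reroute (hmax : IsEdgeMaximal H) (hE : E.IsProjective)
    (huw : H.Adj u w) (hsep : ∃ α, E.IsFaceLabel α ∧ bdy H α u w = 1)
    {f g : V × V × ℤˣ} (hf : H.Adj f.1 f.2.1) (hg : H.Adj g.1 g.2.1) (hfg : E.SameFace f g)
    (hfu : f.1 = u) (hgw : g.1 = w) (hf1 : ∀ ε, ¬ E.SameFace f (u, w, ε))
    {k l : V × V × ℤˣ} (hk : H.Adj k.1 k.2.1) (hl : H.Adj l.1 l.2.1)
    (huk : E.SameFace (u, w, 1) k) (hul : E.SameFace (u, w, -1) l) (hkl : k.1 ≠ l.1) :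
    H.Adj k.1 l.1 := by
  by_contra hadj
  have hne := huw.ne
  have hwu : ∀ ε, E.SameFace (u, w, ε) (w, u, -(ε * E.sgn u w)) := fun ε => E.sameFace_rev _
  -- An end of `uw` lies on both side faces, so it would share a face with the other vertex of the
  -- pair, and the two would be adjacent.
  have hku : k.1 ≠ u := by
    intro h
    exact hadj (h ▸ hmax.adj_of_sameFace hE (f := (u, w, -1)) huw hl hul (h ▸ hkl))
  have hkw : k.1 ≠ w := by
    intro h
    exact hadj (h ▸ hmax.adj_of_sameFace hE (f := (w, u, _)) huw.symm hl
      (((hwu (-1)).symm E).trans E hul) (h ▸ hkl))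
  have hlu : l.1 ≠ u := by
    intro h
    exact hadj (h ▸ hmax.adj_of_sameFace hE (g := (u, w, 1)) hk huw (huk.symm E) (h ▸ hkl))
  have hlw : l.1 ≠ w := by
    intro h
    exact hadj (h ▸ hmax.adj_of_sameFace hE (g := (w, u, _)) hk huw.symm
      ((huk.symm E).trans E (hwu 1)) (h ▸ hkl))
  have h := isAddEdge_deleteEdges huw
  set K := H.deleteEdges {s(u, w)} with hK
  set T := E.deleteEdge h with hT
  set c := E.corner k with hc
  set d := E.corner l with hd
  have hc1 : c.1 = k.1 := rfl
  have hd1 : d.1 = l.1 := rfl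
  have hcu : ∀ b, (u, b) ≠ c := fun b h' => hku (by rw [← hc1, ← h'])
  have hcw : ∀ b, (w, b) ≠ c := fun b h' => hkw (by rw [← hc1, ← h'])
  have hdu : ∀ b, (u, b) ≠ d := fun b h' => hlu (by rw [← hd1, ← h'])
  have hdw : ∀ b, (w, b) ≠ d := fun b h' => hlw (by rw [← hd1, ← h'])
  -- a link in the face that results from the deletion
  obtain ⟨L, hL0, hLj, hLb⟩ : ∃ L, E.EdgeCompat L ∧ (∀ a b, H.Adj a b → E.jump L a b =
      ((if (a, b) = c then 1 else 0) + (if (a, b) = (u, (E.rot u)⁻¹ w) then 1 else 0)) +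
      ((if (a, b) = d then 1 else 0) + (if (a, b) = (u, w) then 1 else 0))) ∧
      bdy H L u w = 0 := by
    obtain ⟨L1, hL1, -⟩ := E.exists_isLink (huk.symm E)
    obtain ⟨L2, hL2, -⟩ := E.exists_isLink (hul.symm E)
    rw [corner_one] at hL1
    rw [corner_neg_one] at hL2
    obtain ⟨α, hα, hα1⟩ := hsep
    have hj : ∀ a b, H.Adj a b → E.jump (L1 + L2) a b =
      ((if (a, b) = c then 1 else 0) + (if (a, b) = (u, (E.rot u)⁻¹ w) then 1 else 0)) +
      ((if (a, b) = d then 1 else 0) + (if (a, b) = (u, w) then 1 else 0)) := by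
      intro a b hab
      rw [jump_add, hL1.2 a b hab, hL2.2 a b hab]
    -- A link after deletion must agree across the deleted edge. The chords from `k` and `l` to `u`,
    -- one in each side face, give such a label, if necessary after correction by the label that
    -- distinguishes the sides.
    rcases zmod_two_eq (bdy H (L1 + L2) u w) with h0 | h0
    · exact ⟨L1 + L2, hL1.1.add hL2.1, hj, h0⟩
    · refine ⟨L1 + L2 + α, (hL1.1.add hL2.1).add hα.1, fun a b hab => ?_, ?_⟩
      · rw [jump_add, hα.2 a b hab, add_zero, hj a b hab]
      · rw [map_add, Pi.add_apply, Pi.add_apply, h0, hα1]; rfl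
  have hLT : T.IsLink L c d := by
    refine ⟨deleteEdge_edgeCompat h E hL0, fun a b hab => ?_⟩
    by_cases hau : a = u
    · subst hau
      rw [if_neg (hcu b), if_neg (hdu b), hT, deleteEdge_jump_left h E L hab, hLj _ _ (h.le hab),
        hLj _ _ huw, hLb, if_neg (hcu b), if_neg (hdu b), if_neg (hcu w), if_neg (hdu w)]
      have hbw : b ≠ w := by rintro rfl; exact h.not_adj hab
      by_cases hb : E.rot a b = w
      · subst hb
        simp [hbw, hbw.symm]
        rfl
      · have : b ≠ (E.rot a)⁻¹ w := by
          rintro rfl; exact hb (perm_apply_inv _ _)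
        have hb' : (a, b) ≠ (a, (E.rot a)⁻¹ w) := fun h' => this (Prod.mk.inj h').2
        have hbw' : (a, b) ≠ (a, w) := fun h' => hbw (Prod.mk.inj h').2
        simp only [hb, hb', hbw', if_false, add_zero]
    · have hau' : ∀ x y : V, (a, x) ≠ (u, y) := fun x y h' => hau (Prod.mk.inj h').1
      by_cases haw : a = w
      · subst haw
        rw [if_neg (hcw b), if_neg (hdw b), hT, deleteEdge_jump_right h E L hab,
          hLj _ _ (h.le hab), hLj _ _ huw.symm, hL0.bdy_symm, hLb, if_neg (hcw b),
          if_neg (hdw b), if_neg (hcw u), if_neg (hdw u), if_neg (hau' _ _), if_neg (hau' _ _),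
          if_neg (hau' _ _), if_neg (hau' _ _)]
        simp
      · rw [hT, deleteEdge_jump_of_ne h E L hau haw, hLj _ _ (h.le hab), if_neg (hau' _ _),
          if_neg (hau' _ _), add_zero, add_zero]
  have hcK : K.Adj c.1 c.2 := (h.adj_iff_of_ne (by exact hku) (by exact hkw)).1 (E.adj_corner hk)
  have hdK : K.Adj d.1 d.2 := (h.adj_iff_of_ne (by exact hlu) (by exact hlw)).1 (E.adj_corner hl)
  have h' := isAddEdge_sup_edge hkl fun h1 => hadj (h.le h1)
  obtain ⟨T', -, hT', hext⟩ :=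
    exists_addEdge_of_isLink T h' (p := c.2) (q := d.2) hLT hcK hdK
  -- the face in which the deleted edge is put back
  obtain ⟨M, hM, hM0⟩ := E.exists_isLink hfg
  set c' := E.corner f with hc'
  set d' := E.corner g with hd'
  have hc'1 : c'.1 = u := hfu
  have hd'1 : d'.1 = w := hgw
  have hc'w : c' ≠ (u, w) := by
    intro h1
    have := E.sameFace_corner f
    rw [← hc', h1] at this
    exact hf1 _ this
  have hd'u : d' ≠ (w, u) := by
    intro h1
    have h2 := E.sameFace_corner g
    rw [← hd', h1] at h2
    have h3 := (hfg.trans E h2).trans E (E.sameFace_rev _)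
    exact hf1 _ h3
  have hMb : bdy H M u w = 0 := by
    rw [bdy_apply_of_adj huw, hM0 _ (hf1 1), hM0 _ (hf1 (-1)), add_zero]
  have hc'K : K.Adj u c'.2 := by
    have := E.adj_corner hf
    rw [← hc', hc'1] at this
    exact (h.adj_iff_left.1 this).resolve_right fun h1 => hc'w (by rw [← hc'1, ← h1])
  have hd'K : K.Adj w d'.2 := by
    have := E.adj_corner hg
    rw [← hd', hd'1] at this
    exact (h.symm.adj_iff_left.1 this).resolve_right fun h1 => hd'u (by rw [← hd'1, ← h1])
  have hMT : T.IsLink M c' d' := by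
    refine ⟨deleteEdge_edgeCompat h E hM.1, fun a b hab => ?_⟩
    by_cases hau : a = u
    · subst hau
      have : E.jump M a w = 0 := by
        rw [hM.2 _ _ huw, if_neg hc'w.symm, if_neg, add_zero]
        intro h1; rw [← h1] at hd'1; exact hne hd'1
      rw [hT, deleteEdge_jump_left h E M hab, this, hMb, hM.2 _ _ (h.le hab)]
      simp
    · by_cases haw : a = w
      · subst haw
        have : E.jump M a u = 0 := by
          rw [hM.2 _ _ huw.symm, if_neg, if_neg hd'u.symm, add_zero]
          intro h1; rw [← h1] at hc'1; exact hne.symm hc'1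
        rw [hT, deleteEdge_jump_right h E M hab, this, hM.1.bdy_symm, hMb, hM.2 _ _ (h.le hab)]
        simp
      · rw [hT, deleteEdge_jump_of_ne h E M hau haw, hM.2 _ _ (h.le hab)]
  -- The chord for the rerouted edge lives in the face of `f`, and `M` vanishes on the side faces
  -- that contain `k` and `l`. So the new edge between them does not cross it.
  have hMc : M (k.1, c.2, -1) = 0 := hM0 _ fun h1 =>
    hf1 1 (h1.trans E (((E.sameFace_corner k).symm E).trans E (huk.symm E)))
  have hMd : M (l.1, d.2, -1) = 0 := hM0 _ fun h1 =>
    hf1 (-1) (h1.trans E (((E.sameFace_corner l).symm E).trans E (hul.symm E)))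
  obtain ⟨M', hM'⟩ := hext c' d' M hMT
    (fun h1 => hku (by rw [← hc'1, h1])) (fun h1 => hlu (by rw [← hc'1, h1]))
    (fun h1 => hkw (by rw [← hd'1, h1])) (fun h1 => hlw (by rw [← hd'1, h1]))
    (by rw [hc'1]; exact hc'K) (by rw [hd'1]; exact hd'K) (hMc.trans hMd.symm)
  have h'' : IsAddEdge (K ⊔ edge k.1 l.1) (H ⊔ edge k.1 l.1) u w := by
    refine ⟨hne, ?_, fun a b => ?_⟩
    · rw [h'.adj_iff_of_ne hku.symm hlu.symm]
      exact h.not_adj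
    · rw [sup_adj, sup_adj, h.adj_iff]; tauto
  have hM'' : T'.IsLink M' (u, c'.2) (w, d'.2) := by
    rw [← hc'1, ← hd'1]; exact hM'
  obtain ⟨S, -, hS, -⟩ := exists_addEdge_of_isLink T' h'' hM'' (h'.le hc'K) (h'.le hd'K)
  exact hmax _ _ _ (isAddEdge_sup_edge hkl hadj) S (hS (hT' (hE.deleteEdge h)))

end RotationSystem
end SimpleGraph

/-! ### Saturated embeddings: facial walks that are not triangles have length four or five -/

namespace SimpleGraph
namespace RotationSystem

variable {V : Type*} [Fintype V] [DecidableEq V] {H : SimpleGraph V}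

/-- The properties of an embedding that no edge can be added to, not even after rerouting
another edge. -/
structure IsSaturated (E : RotationSystem H) : Prop where
  preconnected : H.Preconnected
  isProjective : E.IsProjective
  adj_of_sameFace : ∀ {f g : V × V × ℤˣ}, H.Adj f.1 f.2.1 → H.Adj g.1 g.2.1 → E.SameFace f g →
    f.1 ≠ g.1 → H.Adj f.1 g.1
  turn_ne : ∀ {f : V × V × ℤˣ}, H.Adj f.1 f.2.1 → (E.step f).2.1 ≠ f.1
  exists_bdy_eq_one : ∀ {u w : V}, H.Adj u w → ∃ α, E.IsFaceLabel α ∧ bdy H α u w = 1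
  adj_of_reroute : ∀ {u w : V}, H.Adj u w → ∀ {f g : V × V × ℤˣ}, H.Adj f.1 f.2.1 →
    H.Adj g.1 g.2.1 → E.SameFace f g → f.1 = u → g.1 = w → (∀ ε, ¬ E.SameFace f (u, w, ε)) →
    ∀ {k l : V × V × ℤˣ}, H.Adj k.1 k.2.1 → H.Adj l.1 l.2.1 → E.SameFace (u, w, 1) k →
    E.SameFace (u, w, -1) l → k.1 ≠ l.1 → H.Adj k.1 l.1

theorem IsEdgeMaximal.isSaturated {E : RotationSystem H} (hmax : IsEdgeMaximal H)
    (hE : E.IsProjective) (hn : 3 ≤ Fintype.card V)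
    (hsph : E.IsSpherical ∨ ∀ S : RotationSystem H, ¬ S.IsSpherical) : E.IsSaturated where
  preconnected := hmax.preconnected hE
  isProjective := hE
  adj_of_sameFace := hmax.adj_of_sameFace hE
  turn_ne := hmax.turn_ne hE hn
  exists_bdy_eq_one := hmax.exists_bdy_eq_one hE hn hsph
  adj_of_reroute huw _ _ hf hg hfg hfu hgw hf1 _ _ hk hl huk hul hkl :=
    hmax.adj_of_reroute hE huw (hmax.exists_bdy_eq_one hE hn hsph huw) hf hg hfg hfu hgw hf1 hk hl
      huk hul hkl

/-- The vertices of a facial walk. -/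
def vtx (E : RotationSystem H) (f : V × V × ℤˣ) (i : ℕ) : V := ((E.step ^ i) f).1

section Walk

variable (E : RotationSystem H) (f : V × V × ℤˣ)

theorem vtx_zero : E.vtx f 0 = f.1 := rfl

theorem vtx_succ (i : ℕ) : E.vtx f (i + 1) = ((E.step ^ i) f).2.1 := by
  rw [vtx, pow_succ', Equiv.Perm.mul_apply, step_fst]

theorem vtx_one : E.vtx f 1 = f.2.1 := rfl

theorem vtx_add (i k : ℕ) : E.vtx ((E.step ^ k) f) i = E.vtx f (i + k) := by
  rw [vtx, vtx, pow_add, Equiv.Perm.mul_apply]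

theorem vtx_step (i : ℕ) : E.vtx (E.step f) i = E.vtx f (i + 1) := E.vtx_add f i 1

theorem step_pow_step {f : V × V × ℤˣ} {n k : ℕ} :
    (E.step ^ n) ((E.step ^ k) f) = (E.step ^ k) f ↔ (E.step ^ n) f = f := by
  rw [← Equiv.Perm.mul_apply, ← pow_add, add_comm, pow_add, Equiv.Perm.mul_apply,
    EmbeddingLike.apply_eq_iff_eq]

theorem exists_step_eq : ∃ g, E.step g = f ∧ (H.Adj f.1 f.2.1 → H.Adj g.1 g.2.1) :=
  ⟨E.step⁻¹ f, perm_apply_inv _ _, fun h => E.adj_step_inv h⟩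

end Walk

namespace IsSaturated

variable {E : RotationSystem H} (hs : E.IsSaturated) {f : V × V × ℤˣ}

include hs

theorem not_sameFace_neg {u w : V} (h : H.Adj u w) (ε : ℤˣ) :
    ¬ E.SameFace (u, w, ε) (u, w, -ε) := by
  obtain ⟨α, hα, h1⟩ := hs.exists_bdy_eq_one h
  intro h2
  have := hα.sameFace (f := (u, w, ε)) (g := (u, w, -ε)) h h h2
  rw [bdy_apply_of_adj h] at h1
  rcases Int.units_eq_one_or ε with rfl | rfl
  · rw [this] at h1
    exact zero_ne_one ((CharTwo.add_self_eq_zero _).symm.trans h1)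
  · rw [neg_neg] at this
    rw [this] at h1
    exact zero_ne_one ((CharTwo.add_self_eq_zero _).symm.trans h1)

theorem eq_of_sameFace {u w : V} (h : H.Adj u w) {ε ε' : ℤˣ}
    (h' : E.SameFace (u, w, ε) (u, w, ε')) : ε = ε' := by
  by_contra hne
  have : ε' = -ε := by
    rcases Int.units_eq_one_or ε with rfl | rfl <;> rcases Int.units_eq_one_or ε' with rfl | rfl <;>
      first | rfl | exact absurd rfl hne
  exact hs.not_sameFace_neg h ε (this ▸ h')

theorem adj_vtx (hf : H.Adj f.1 f.2.1) {i j : ℕ} (h : E.vtx f i ≠ E.vtx f j) :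
    H.Adj (E.vtx f i) (E.vtx f j) :=
  hs.adj_of_sameFace (E.adj_step_pow hf i) (E.adj_step_pow hf j)
    (((E.sameFace_step_pow f i).symm E).trans E (E.sameFace_step_pow f j)) h

omit hs in
theorem _root_.SimpleGraph.RotationSystem.adj_vtx_succ (hf : H.Adj f.1 f.2.1) (i : ℕ) :
    H.Adj (E.vtx f i) (E.vtx f (i + 1)) := by
  rw [vtx_succ]
  exact E.adj_step_pow hf i

theorem vtx_ne_succ_succ (hf : H.Adj f.1 f.2.1) (i : ℕ) : E.vtx f i ≠ E.vtx f (i + 2) := by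
  have := hs.turn_ne (E.adj_step_pow hf i)
  rw [← Equiv.Perm.mul_apply, ← pow_succ', ← vtx_succ] at this
  exact this.symm

/-- As the two sides of an edge belong to different faces, a flag on a given face is determined by
its two vertices; periods of facial walks can thus be read off the vertices. -/
theorem step_pow_eq (hf : H.Adj f.1 f.2.1) {i j : ℕ} (h : E.vtx f i = E.vtx f j)
    (h' : E.vtx f (i + 1) = E.vtx f (j + 1)) : (E.step ^ i) f = (E.step ^ j) f := by
  have hi := E.adj_step_pow hf i
  have hij := ((E.sameFace_step_pow f i).symm E).trans E (E.sameFace_step_pow f j)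
  rw [vtx_succ, vtx_succ] at h'
  rw [vtx, vtx] at h
  generalize (E.step ^ i) f = a at *
  generalize (E.step ^ j) f = b at *
  obtain ⟨u, w, ε⟩ := a
  obtain ⟨u', w', ε'⟩ := b
  obtain rfl : u = u' := h
  obtain rfl : w = w' := h'
  rw [hs.eq_of_sameFace hi hij]

/-- Within one face, the same edge in the opposite direction has to be the reversed flag, and
`rev_ne_step_pow` keeps that out of the walk. -/
theorem vtx_not_reversed (hf : H.Adj f.1 f.2.1) {i j : ℕ} (h : E.vtx f i = E.vtx f (j + 1))
    (h' : E.vtx f (i + 1) = E.vtx f j) : False := by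
  wlog hij : i ≤ j generalizing i j
  · exact this h'.symm h.symm (by omega)
  obtain ⟨k, rfl⟩ := Nat.exists_eq_add_of_le hij
  have hi := E.adj_step_pow hf i
  have e : (E.step ^ (i + k)) f = (E.step ^ k) ((E.step ^ i) f) := by
    rw [← Equiv.Perm.mul_apply, ← pow_add, add_comm]
  rw [vtx_succ] at h h'
  rw [vtx] at h h'
  rw [e] at h h'
  generalize (E.step ^ i) f = a at *
  refine E.rev_ne_step_pow k a hi ?_
  have h1 := (E.sameFace_rev a).symm E
  have h2 := h1.trans E (E.sameFace_step_pow a k)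
  generalize (E.step ^ k) a = b at *
  obtain ⟨u, w, ε⟩ := a
  obtain ⟨u', w', ε'⟩ := b
  obtain rfl : u = w' := h
  obtain rfl : w = u' := h'
  rw [rev_mk] at h2 ⊢
  rw [hs.eq_of_sameFace hi.symm h2]

theorem add_mem {z z' : V → V → ZMod 2} (hz : z ∈ cycleSpace H) (hz' : z' ∈ cycleSpace H)
    (h : z ∉ E.boundarySpace) (h' : z' ∉ E.boundarySpace) : z + z' ∈ E.boundarySpace :=
  ((hs.isProjective z hz z' hz').resolve_left h).resolve_left h'

theorem false_of_vtx {z : V → V → ZMod 2} (hz : z ∈ E.boundarySpace) (hf : H.Adj f.1 f.2.1)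
    {i j : ℕ} (hb : ∀ t, z (E.vtx f (i + 1)) t
      = if t = E.vtx f i ∨ t = E.vtx f (i + 2) then 1 else 0)
    (hb' : ∀ t, z (E.vtx f j) t = 0) (h0 : E.vtx f j ≠ E.vtx f i)
    (h1 : E.vtx f j ≠ E.vtx f (i + 1)) (h2 : E.vtx f j ≠ E.vtx f (i + 2)) : False := by
  have e2 : (E.step ((E.step ^ i) f)).2.1 = E.vtx f (i + 2) := by
    rw [← Equiv.Perm.mul_apply, ← pow_succ', ← vtx_succ]
  have h3 := hs.adj_vtx hf h1.symm
  rw [vtx_succ] at h3 hb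
  refine false_of_corner hz (E.adj_step_pow hf i) (E.adj_step_pow hf j)
    (((E.sameFace_step_pow f i).symm E).trans E (E.sameFace_step_pow f j)) (fun t => ?_) hb' h3 h0
    (by rw [e2]; exact h2)
  rw [hb]
  exact if_congr (by rw [e2]; rfl) rfl rfl

theorem tri_mem_cycleSpace_of_vtx (hf : H.Adj f.1 f.2.1) (i : ℕ) :
    tri (E.vtx f i) (E.vtx f (i + 1)) (E.vtx f (i + 2)) ∈ cycleSpace H :=
  tri_mem_cycleSpace (E.adj_vtx_succ hf i) (E.adj_vtx_succ hf (i + 1))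
    (hs.adj_vtx hf (hs.vtx_ne_succ_succ hf i).symm)

/-- If the triangle bounded, the face would be on one side of it and the edge from `E.vtx f 1` to
`E.vtx f 3` would leave into the other side. But `E.vtx f 3` is a vertex of that face off the
triangle. -/
theorem tri_left_notMem (hf : H.Adj f.1 f.2.1) (h : E.vtx f 0 ≠ E.vtx f 3) :
    tri (E.vtx f 0) (E.vtx f 1) (E.vtx f 2) ∉ E.boundarySpace := by
  intro hz
  have h01 := (E.adj_vtx_succ hf 0).ne
  have h12 := (E.adj_vtx_succ hf 1).ne
  have h23 := (E.adj_vtx_succ hf 2).ne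
  have h02 := hs.vtx_ne_succ_succ hf 0
  have h13 := hs.vtx_ne_succ_succ hf 1
  refine hs.false_of_vtx hz hf (i := 0) (j := 3) (fun t => ?_) (fun t => ?_) h.symm h13.symm h23.symm
  · simp only [zero_add, tri, Pi.add_apply, edgeInd] at *
    grind
  · simp only [zero_add, tri, Pi.add_apply, edgeInd] at *
    grind

theorem tri_right_notMem (hf : H.Adj f.1 f.2.1) (h : E.vtx f 0 ≠ E.vtx f 3) :
    tri (E.vtx f 1) (E.vtx f 2) (E.vtx f 3) ∉ E.boundarySpace := by
  intro hz
  have h01 := (E.adj_vtx_succ hf 0).ne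
  have h12 := (E.adj_vtx_succ hf 1).ne
  have h23 := (E.adj_vtx_succ hf 2).ne
  have h02 := hs.vtx_ne_succ_succ hf 0
  have h13 := hs.vtx_ne_succ_succ hf 1
  refine hs.false_of_vtx hz hf (i := 1) (j := 0) (fun t => ?_) (fun t => ?_) h01 h02 h
  · simp only [zero_add, tri, Pi.add_apply, edgeInd] at *
    grind
  · simp only [zero_add, tri, Pi.add_apply, edgeInd] at *
    grind

theorem vtx_ne_of_not_triangle (hf : H.Adj f.1 f.2.1) (hnt : (E.step ^ 3) f ≠ f)
    (h : E.vtx f 0 = E.vtx f 3) : E.vtx f 1 ≠ E.vtx f 4 := by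
  intro h'
  exact hnt (hs.step_pow_eq hf (i := 0) (j := 3) h h').symm

theorem step_pow_three_of_isSpherical (hE : E.IsSpherical) (hf : H.Adj f.1 f.2.1) :
    (E.step ^ 3) f = f := by
  by_contra hnt
  by_cases h : E.vtx f 0 = E.vtx f 3
  · have h' := hs.vtx_ne_of_not_triangle hf hnt h
    have hf' := E.adj_step hf
    exact hs.tri_left_notMem hf' (by rw [vtx_step, vtx_step]; exact h')
      (hE (hs.tri_mem_cycleSpace_of_vtx hf' 0))
  · exact hs.tri_left_notMem hf h (hE (hs.tri_mem_cycleSpace_of_vtx hf 0))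

/-- With `v₁ = v₄`, the first two triangles of consecutive vertices do not bound, so their sum, the
cycle `v₀v₁v₃v₂`, does. The walk turns along this cycle at `v₃`, between `v₂` and `v₄ = v₁`, while
`v₅` is off the cycle: the same contradiction as for a bounding triangle. -/
theorem vtx_one_ne_four (hf : H.Adj f.1 f.2.1) (hnt : (E.step ^ 3) f ≠ f) :
    E.vtx f 1 ≠ E.vtx f 4 := by
  intro h14
  have h03 : E.vtx f 0 ≠ E.vtx f 3 := fun h => hs.vtx_ne_of_not_triangle hf hnt h h14
  have h01 := (E.adj_vtx_succ hf 0).ne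
  have h12 := (E.adj_vtx_succ hf 1).ne
  have h23 := (E.adj_vtx_succ hf 2).ne
  have h45 := (E.adj_vtx_succ hf 4).ne
  have h02 := hs.vtx_ne_succ_succ hf 0
  have h13 := hs.vtx_ne_succ_succ hf 1
  have h35 := hs.vtx_ne_succ_succ hf 3
  have h25 : E.vtx f 2 ≠ E.vtx f 5 := by
    intro h
    have := hs.step_pow_eq hf (i := 1) (j := 4) h14 h
    rw [show 4 = 3 + 1 from rfl, pow_add, Equiv.Perm.mul_apply, eq_comm, step_pow_step] at this
    exact hnt this
  have h05 : E.vtx f 0 ≠ E.vtx f 5 := fun h => hs.vtx_not_reversed hf (i := 0) (j := 4) h h14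
  have hz := hs.add_mem (hs.tri_mem_cycleSpace_of_vtx hf 0) (hs.tri_mem_cycleSpace_of_vtx hf 1)
    (hs.tri_left_notMem hf h03) (hs.tri_right_notMem hf h03)
  refine hs.false_of_vtx hz hf (i := 2) (j := 5) (fun t => ?_) (fun t => ?_) h25.symm h35.symm
    (by rw [← h14]; rw [← h14] at h45; exact h45.symm)
  · simp only [← h14, zero_add, tri, Pi.add_apply, edgeInd, Nat.reduceAdd] at *
    grind
  · simp only [← h14, zero_add, tri, Pi.add_apply, edgeInd, Nat.reduceAdd] at *
    grind

omit hs in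
theorem _root_.SimpleGraph.RotationSystem.not_triangle_step_pow (hnt : (E.step ^ 3) f ≠ f)
    (k : ℕ) : (E.step ^ 3) ((E.step ^ k) f) ≠ (E.step ^ k) f := fun h => hnt (E.step_pow_step.1 h)

theorem vtx_ne_add_three (hf : H.Adj f.1 f.2.1) (hnt : (E.step ^ 3) f ≠ f) (i : ℕ) :
    E.vtx f i ≠ E.vtx f (i + 3) := by
  -- `vtx_one_ne_four` starts at index one, so the walk is begun one step earlier.
  obtain ⟨g, rfl, hg⟩ := E.exists_step_eq f
  have hg := hg hf
  have hnt' : (E.step ^ 3) g ≠ g := fun h => hnt ((E.step_pow_step (k := 1)).2 h)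
  have := hs.vtx_one_ne_four (E.adj_step_pow hg i) (E.not_triangle_step_pow hnt' i)
  rw [vtx_add, vtx_add] at this
  rw [vtx_step, vtx_step]
  convert this using 2 <;> ring

theorem tri_notMem (hf : H.Adj f.1 f.2.1) (hnt : (E.step ^ 3) f ≠ f) (i : ℕ) :
    tri (E.vtx f i) (E.vtx f (i + 1)) (E.vtx f (i + 2)) ∉ E.boundarySpace := by
  have := hs.tri_left_notMem (E.adj_step_pow hf i) (by
    rw [vtx_add, vtx_add, zero_add, add_comm 3]; exact hs.vtx_ne_add_three hf hnt i)
  simpa only [vtx_add, zero_add, add_zero, add_comm _ i] using this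

theorem tri_add_tri_mem (hf : H.Adj f.1 f.2.1) (hnt : (E.step ^ 3) f ≠ f) (i j : ℕ) :
    tri (E.vtx f i) (E.vtx f (i + 1)) (E.vtx f (i + 2)) +
      tri (E.vtx f j) (E.vtx f (j + 1)) (E.vtx f (j + 2)) ∈ E.boundarySpace :=
  hs.add_mem (hs.tri_mem_cycleSpace_of_vtx hf i) (hs.tri_mem_cycleSpace_of_vtx hf j)
    (hs.tri_notMem hf hnt i) (hs.tri_notMem hf hnt j)

/-- For `v₁ = v₅` the triangles at `v₁v₂v₃` and `v₃v₄v₅` add up to the cycle `v₁v₂v₃v₄`, which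
bounds and follows the walk at `v₂`. Without period four `v₀` would be off this cycle. -/
theorem step_pow_four_of_vtx_one_eq (hf : H.Adj f.1 f.2.1) (hnt : (E.step ^ 3) f ≠ f)
    (h : E.vtx f 1 = E.vtx f 5) : (E.step ^ 4) f = f := by
  by_contra hne
  have h04 : E.vtx f 0 ≠ E.vtx f 4 := fun h' => hne (hs.step_pow_eq hf (i := 0) (j := 4) h' h).symm
  have h01 := (E.adj_vtx_succ hf 0).ne
  have h12 := (E.adj_vtx_succ hf 1).ne
  have h23 := (E.adj_vtx_succ hf 2).ne
  have h34 := (E.adj_vtx_succ hf 3).ne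
  have h02 := hs.vtx_ne_succ_succ hf 0
  have h13 := hs.vtx_ne_succ_succ hf 1
  have h24 := hs.vtx_ne_succ_succ hf 2
  have h03 := hs.vtx_ne_add_three hf hnt 0
  have h14 := hs.vtx_ne_add_three hf hnt 1
  have hz := hs.tri_add_tri_mem hf hnt 1 3
  refine hs.false_of_vtx hz hf (i := 1) (j := 0) (fun t => ?_) (fun t => ?_) h01 h02 h03
  · simp only [← h, zero_add, tri, Pi.add_apply, edgeInd, Nat.reduceAdd] at *
    grind
  · simp only [← h, zero_add, tri, Pi.add_apply, edgeInd, Nat.reduceAdd] at *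
    grind

theorem step_pow_four (hf : H.Adj f.1 f.2.1) (hnt : (E.step ^ 3) f ≠ f) (i : ℕ)
    (h : E.vtx f i = E.vtx f (i + 4)) : (E.step ^ 4) f = f := by
  obtain ⟨g, rfl, hg⟩ := E.exists_step_eq f
  have hg := hg hf
  have hnt' : (E.step ^ 3) g ≠ g := fun h => hnt ((E.step_pow_step (k := 1)).2 h)
  have := hs.step_pow_four_of_vtx_one_eq (E.adj_step_pow hg i) (E.not_triangle_step_pow hnt' i) (by
    rw [vtx_add, vtx_add]
    rw [vtx_step, vtx_step] at h
    convert h using 2 <;> ring)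
  rw [step_pow_step] at this
  exact (E.step_pow_step (k := 1)).2 this

/-- The sum of the triangles `v₀v₁v₂` and `v₂v₃v₄` bounds and follows the walk at `v₁`. A vertex of
the face other than these five would be separated from `v₁`, so there are only five, and the
distinctness already known fixes `v₅` and `v₆`. -/
theorem step_pow_five (hf : H.Adj f.1 f.2.1) (hnt : (E.step ^ 3) f ≠ f)
    (h : (E.step ^ 4) f ≠ f) : (E.step ^ 5) f = f := by
  have h04 : ∀ i, E.vtx f i ≠ E.vtx f (i + 4) := fun i h' => h (hs.step_pow_four hf hnt i h')
  have h01 := fun i => (E.adj_vtx_succ hf i).ne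
  have h02 := hs.vtx_ne_succ_succ hf
  have h03 := hs.vtx_ne_add_three hf hnt
  have hz := hs.tri_add_tri_mem hf hnt 0 2
  have h0 := h01 0
  have h1 := h01 1
  have h2 := h01 2
  have h3 := h01 3
  have k0 := h02 0
  have k1 := h02 1
  have k2 := h02 2
  have l0 := h03 0
  have l1 := h03 1
  have m0 := h04 0
  have hall : ∀ j, E.vtx f j = E.vtx f 0 ∨ E.vtx f j = E.vtx f 1 ∨ E.vtx f j = E.vtx f 2 ∨
      E.vtx f j = E.vtx f 3 ∨ E.vtx f j = E.vtx f 4 := by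
    intro j
    by_contra! hj
    obtain ⟨j0, j1, j2, j3, j4⟩ := hj
    refine hs.false_of_vtx hz hf (i := 0) (j := j) (fun t => ?_) (fun t => ?_) j0 j1 j2
    · simp only [zero_add, tri, Pi.add_apply, edgeInd, Nat.reduceAdd] at *
      grind
    · simp only [zero_add, tri, Pi.add_apply, edgeInd, Nat.reduceAdd] at *
      grind
  have h5 : E.vtx f 0 = E.vtx f 5 := by
    rcases hall 5 with h' | h' | h' | h' | h'
    · exact h'.symm
    · exact absurd h'.symm (h04 1)
    · exact absurd h'.symm (h03 2)
    · exact absurd h'.symm (h02 3)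
    · exact absurd h'.symm (h01 4)
  have h6 : E.vtx f 1 = E.vtx f 6 := by
    rcases hall 6 with h' | h' | h' | h' | h'
    · exact absurd (h5.symm.trans h'.symm) (h01 5)
    · exact h'.symm
    · exact absurd h'.symm (h04 2)
    · exact absurd h'.symm (h03 3)
    · exact absurd h'.symm (h02 4)
  exact (hs.step_pow_eq hf (i := 0) (j := 5) h5 h6).symm

/-- The boundary of a face whose facial walk has no repeated vertices. -/
theorem bdy_faceIndicator (hf : H.Adj f.1 f.2.1) {n : ℕ} (hn : 0 < n) (hp : (E.step ^ n) f = f)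
    (hinj : ∀ i < n, ∀ j < n, E.vtx f i = E.vtx f j → i = j) :
    bdy H (E.faceIndicator f) = ∑ i ∈ Finset.range n, edgeInd (E.vtx f i) (E.vtx f (i + 1)) := by
  ext u w
  rw [Finset.sum_apply, Finset.sum_apply]
  have hmod : ∀ m, (E.step ^ m) f = (E.step ^ (m % n)) f := by
    intro m
    conv_lhs => rw [← Nat.mod_add_div m n, pow_add, pow_mul, Equiv.Perm.mul_apply]
    congr 1
    have : ∀ k, ((E.step ^ n) ^ k) f = f := by
      intro k
      induction k with
      | zero => rfl
      | succ k ih => rw [pow_succ', Equiv.Perm.mul_apply, ih, hp]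
    exact this _
  by_cases h : ∃ i < n, (u = E.vtx f i ∧ w = E.vtx f (i + 1)) ∨ (u = E.vtx f (i + 1) ∧ w = E.vtx f i)
  · obtain ⟨i, hi, h⟩ := h
    have huw : H.Adj u w := by
      rcases h with ⟨rfl, rfl⟩ | ⟨rfl, rfl⟩
      · exact E.adj_vtx_succ hf i
      · exact (E.adj_vtx_succ hf i).symm
    rw [Finset.sum_eq_single i, edgeInd, if_pos h]
    · have hex : ∃ ε, E.SameFace f (u, w, ε) := by
        have h1 := E.sameFace_step_pow f i
        have h2 := h1.trans E (E.sameFace_rev _)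
        rw [vtx_succ, vtx] at h
        generalize (E.step ^ i) f = g at h h1 h2
        obtain ⟨a, b, ε⟩ := g
        rcases h with ⟨rfl, rfl⟩ | ⟨rfl, rfl⟩
        · exact ⟨_, h1⟩
        · exact ⟨_, h2⟩
      obtain ⟨ε, hε⟩ := hex
      have hε' : ¬ E.SameFace f (u, w, -ε) := fun h' =>
        hs.not_sameFace_neg huw ε ((hε.symm E).trans E h')
      rw [← faceIndicator_eq_one] at hε
      rw [← faceIndicator_eq_zero] at hε'
      rw [bdy_apply_of_adj huw]
      rcases Int.units_eq_one_or ε with rfl | rfl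
      · rw [hε, hε', add_zero]
      · rw [neg_neg] at hε'
        rw [hε, hε', zero_add]
    · intro j hj hji
      refine if_neg ?_
      rintro h'
      have key : E.vtx f i = E.vtx f j := by
        rcases h with ⟨rfl, rfl⟩ | ⟨rfl, rfl⟩ <;> rcases h' with ⟨h1, h2⟩ | ⟨h1, h2⟩
        · exact h1
        · exact (hs.vtx_not_reversed hf h1 h2).elim
        · exact (hs.vtx_not_reversed hf h2 h1).elim
        · exact h2
      exact hji (hinj i hi j (Finset.mem_range.1 hj) key).symm
    · intro h'
      exact absurd (Finset.mem_range.2 hi) h'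
  · rw [Finset.sum_eq_zero]
    · by_cases huw : H.Adj u w
      · have h0 : ∀ ε, ¬ E.SameFace f (u, w, ε) := by
          intro ε hε
          rcases hε with hε | hε
          · obtain ⟨m, -, hm⟩ := hε.exists_pow_eq'
            rw [hmod] at hm
            refine h ⟨m % n, Nat.mod_lt _ hn, Or.inl ?_⟩
            rw [vtx_succ, vtx, hm]
            exact ⟨rfl, rfl⟩
          · obtain ⟨m, -, hm⟩ := hε.exists_pow_eq'
            rw [hmod] at hm
            refine h ⟨m % n, Nat.mod_lt _ hn, Or.inr ?_⟩
            rw [vtx_succ, vtx, hm]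
            exact ⟨rfl, rfl⟩
        rw [bdy_apply_of_adj huw, E.faceIndicator_eq_zero.2 (h0 1),
          E.faceIndicator_eq_zero.2 (h0 (-1)), add_zero]
      · exact bdy_apply_of_not_adj huw _
    · intro i hi
      refine if_neg fun h' => h ⟨i, Finset.mem_range.1 hi, h'⟩

end IsSaturated
end RotationSystem
end SimpleGraph

/-! ### Triangular, quadrangular and pentagonal faces -/

namespace SimpleGraph
namespace RotationSystem

variable {V : Type*} [Fintype V] [DecidableEq V] {H : SimpleGraph V} {E : RotationSystem H}

variable (E) in
/-- The vertex `p` lies on the face of the flag `f`. -/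
def OnFace (f : V × V × ℤˣ) (p : V) : Prop := ∃ g, H.Adj g.1 g.2.1 ∧ E.SameFace f g ∧ g.1 = p

variable (E) in
/-- The face of the flag `f` has a corner at `b` between the edges to `a` and `c`: a set of faces
that does not contain this face and whose boundary takes this turn at `b` has all the other edges
at `b` in its interior. -/
def HasCorner (f : V × V × ℤˣ) (a b c : V) : Prop :=
  ∀ α, E.IsFaceLabel α → α f = 0 → (∀ t, bdy H α b t = if t = a ∨ t = c then 1 else 0) →
    ∀ t, H.Adj b t → t ≠ a → t ≠ c → ∀ ε, α (b, t, ε) = 1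

theorem HasCorner.symm {f : V × V × ℤˣ} {a b c : V} (h : E.HasCorner f a b c) :
    E.HasCorner f c b a := fun α hα h0 hb t ht hc ha =>
  h α hα h0 (fun s => (hb s).trans (if_congr or_comm rfl rfl)) t ht ha hc

/-- A face whose facial walk is a triangle. -/
structure FaceTri (E : RotationSystem H) (f : V × V × ℤˣ) (a b c : V) : Prop where
  adj : H.Adj f.1 f.2.1
  bdy_eq : bdy H (E.faceIndicator f) = tri a b c
  onFace_iff : ∀ p, E.OnFace f p ↔ p = a ∨ p = b ∨ p = c
  ne : a ≠ b ∧ b ≠ c ∧ c ≠ a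
  period : (E.step ^ 3) f = f

/-- A face whose facial walk is a cycle of length four. -/
structure FaceQuad (E : RotationSystem H) (f : V × V × ℤˣ) (a b c d : V) : Prop where
  adj : H.Adj f.1 f.2.1
  bdy_eq : bdy H (E.faceIndicator f) = edgeInd a b + edgeInd b c + edgeInd c d + edgeInd d a
  onFace_iff : ∀ p, E.OnFace f p ↔ p = a ∨ p = b ∨ p = c ∨ p = d
  ne : a ≠ b ∧ a ≠ c ∧ a ≠ d ∧ b ≠ c ∧ b ≠ d ∧ c ≠ d
  notMem₁ : tri a b c ∉ E.boundarySpace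
  notMem₂ : tri b c d ∉ E.boundarySpace
  notMem₃ : tri c d a ∉ E.boundarySpace
  notMem₄ : tri d a b ∉ E.boundarySpace
  corner₁ : E.HasCorner f a b c
  corner₂ : E.HasCorner f b c d
  corner₃ : E.HasCorner f c d a
  corner₄ : E.HasCorner f d a b

/-- A face whose facial walk is a cycle of length five. -/
structure FacePent (E : RotationSystem H) (f : V × V × ℤˣ) (a b c d e : V) : Prop where
  adj : H.Adj f.1 f.2.1
  bdy_eq : bdy H (E.faceIndicator f)
    = edgeInd a b + edgeInd b c + edgeInd c d + edgeInd d e + edgeInd e a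
  onFace_iff : ∀ p, E.OnFace f p ↔ p = a ∨ p = b ∨ p = c ∨ p = d ∨ p = e
  ne : a ≠ b ∧ a ≠ c ∧ a ≠ d ∧ a ≠ e ∧ b ≠ c ∧ b ≠ d ∧ b ≠ e ∧ c ≠ d ∧ c ≠ e ∧ d ≠ e
  notMem₁ : tri a b c ∉ E.boundarySpace
  notMem₂ : tri b c d ∉ E.boundarySpace
  notMem₃ : tri c d e ∉ E.boundarySpace
  notMem₄ : tri d e a ∉ E.boundarySpace
  notMem₅ : tri e a b ∉ E.boundarySpace
  corner₁ : E.HasCorner f a b c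
  corner₂ : E.HasCorner f b c d
  corner₃ : E.HasCorner f c d e
  corner₄ : E.HasCorner f d e a
  corner₅ : E.HasCorner f e a b

theorem tri_rotate (a b c : V) : tri a b c = tri b c a := by
  unfold tri; abel

theorem tri_reverse (a b c : V) : tri a b c = tri c b a := by
  unfold tri
  rw [edgeInd_comm a b, edgeInd_comm b c, edgeInd_comm c a]; abel

theorem FaceQuad.rotate {f : V × V × ℤˣ} {a b c d : V} (h : E.FaceQuad f a b c d) :
    E.FaceQuad f b c d a where
  adj := h.adj
  bdy_eq := by rw [h.bdy_eq]; abel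
  onFace_iff p := by rw [h.onFace_iff]; tauto
  ne := by have := h.ne; grind
  notMem₁ := h.notMem₂
  notMem₂ := h.notMem₃
  notMem₃ := h.notMem₄
  notMem₄ := h.notMem₁
  corner₁ := h.corner₂
  corner₂ := h.corner₃
  corner₃ := h.corner₄
  corner₄ := h.corner₁

theorem FaceQuad.reverse {f : V × V × ℤˣ} {a b c d : V} (h : E.FaceQuad f a b c d) :
    E.FaceQuad f d c b a where
  adj := h.adj
  bdy_eq := by
    rw [h.bdy_eq, edgeInd_comm a b, edgeInd_comm b c, edgeInd_comm c d, edgeInd_comm d a]; abel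
  onFace_iff p := by rw [h.onFace_iff]; tauto
  ne := by have := h.ne; grind
  notMem₁ := by rw [← tri_reverse]; exact h.notMem₂
  notMem₂ := by rw [← tri_reverse]; exact h.notMem₁
  notMem₃ := by rw [← tri_reverse]; exact h.notMem₄
  notMem₄ := by rw [← tri_reverse]; exact h.notMem₃
  corner₁ := h.corner₂.symm
  corner₂ := h.corner₁.symm
  corner₃ := h.corner₄.symm
  corner₄ := h.corner₃.symm

theorem FacePent.rotate {f : V × V × ℤˣ} {a b c d e : V} (h : E.FacePent f a b c d e) :
    E.FacePent f b c d e a where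
  adj := h.adj
  bdy_eq := by rw [h.bdy_eq]; abel
  onFace_iff p := by rw [h.onFace_iff]; tauto
  ne := by have := h.ne; grind
  notMem₁ := h.notMem₂
  notMem₂ := h.notMem₃
  notMem₃ := h.notMem₄
  notMem₄ := h.notMem₅
  notMem₅ := h.notMem₁
  corner₁ := h.corner₂
  corner₂ := h.corner₃
  corner₃ := h.corner₄
  corner₄ := h.corner₅
  corner₅ := h.corner₁

theorem faceIndicator_self (f : V × V × ℤˣ) : E.faceIndicator f f = 1 :=
  E.faceIndicator_eq_one.2 (SameFace.refl E f)

theorem OnFace.of_sameFace {f g : V × V × ℤˣ} {p : V} (h : E.OnFace f p) (hfg : E.SameFace f g) :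
    E.OnFace g p := by
  obtain ⟨k, hk, hfk, hp⟩ := h
  exact ⟨k, hk, (hfg.symm E).trans E hfk, hp⟩

theorem onFace_iff_of_period {f : V × V × ℤˣ} (hf : H.Adj f.1 f.2.1) {n : ℕ} (hn : 0 < n)
    (hp : (E.step ^ n) f = f) (p : V) : E.OnFace f p ↔ ∃ i < n, E.vtx f i = p := by
  have hmod : ∀ m, (E.step ^ m) f = (E.step ^ (m % n)) f := by
    intro m
    conv_lhs => rw [← Nat.mod_add_div m n, pow_add, pow_mul, Equiv.Perm.mul_apply]
    congr 1
    have : ∀ k, ((E.step ^ n) ^ k) f = f := by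
      intro k
      induction k with
      | zero => rfl
      | succ k ih => rw [pow_succ', Equiv.Perm.mul_apply, ih, hp]
    exact this _
  constructor
  · rintro ⟨g, -, hg, rfl⟩
    have key : ∀ m, ∃ i < n, E.vtx f i = E.vtx f m := fun m =>
      ⟨m % n, Nat.mod_lt _ hn, by rw [vtx, vtx, ← hmod]⟩
    rcases hg with hg | hg
    · obtain ⟨m, -, hm⟩ := hg.exists_pow_eq'
      obtain ⟨i, hi, h⟩ := key m
      exact ⟨i, hi, by rw [h, vtx, hm]⟩
    · obtain ⟨m, -, hm⟩ := hg.exists_pow_eq'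
      obtain ⟨i, hi, h⟩ := key (m + 1)
      exact ⟨i, hi, by rw [h, vtx_succ, hm]; rfl⟩
  · rintro ⟨i, -, rfl⟩
    exact ⟨_, E.adj_step_pow hf i, E.sameFace_step_pow f i, rfl⟩

theorem hasCorner_vtx {f : V × V × ℤˣ} (hf : H.Adj f.1 f.2.1) (i : ℕ) :
    E.HasCorner f (E.vtx f i) (E.vtx f (i + 1)) (E.vtx f (i + 2)) := by
  have e2 : (E.step ((E.step ^ i) f)).2.1 = E.vtx f (i + 2) := by
    rw [← Equiv.Perm.mul_apply, ← pow_succ', ← vtx_succ]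
  intro α hα h0 hb t ht ht1 ht2 ε
  rw [vtx_succ] at hb ht ⊢
  refine hα.eq_one_of_step (E.adj_step_pow hf i) ((hα.step_pow hf i).trans h0) (fun s => ?_) ht ht1
    (by rw [e2]; exact ht2) ε
  rw [hb]
  exact if_congr (by rw [e2]; rfl) rfl rfl

theorem IsFaceLabel.eq_of_onFace_self {α : V × V × ℤˣ → ZMod 2} (hα : E.IsFaceLabel α)
    {f : V × V × ℤˣ} (hf : H.Adj f.1 f.2.1) {p t : V} (hp : E.OnFace f p)
    (h0 : ∀ t, bdy H α p t = 0) (ht : H.Adj p t) (ε : ℤˣ) : α (p, t, ε) = α f := by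
  obtain ⟨⟨u, w, δ⟩, hg, hfg, rfl⟩ := hp
  rw [← hα.sameFace hf hg hfg]
  exact hα.eq_at_vertex h0 ht hg _ _

/-- An edge between two vertices off the boundary does not cross it. Rerouting provides such edges
between the two sides of an edge, which limits the vertices of the side faces. -/
theorem IsFaceLabel.eq_of_onFace {α : V × V × ℤˣ → ZMod 2} (hα : E.IsFaceLabel α)
    {f g : V × V × ℤˣ} (hf : H.Adj f.1 f.2.1) (hg : H.Adj g.1 g.2.1) {p q : V}
    (hp : E.OnFace f p) (hq : E.OnFace g q) (h0 : ∀ t, bdy H α p t = 0)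
    (h1 : ∀ t, bdy H α q t = 0) (h : p = q ∨ H.Adj p q) : α f = α g := by
  rcases h with rfl | h
  · have hq' := hq
    obtain ⟨⟨u, w, δ⟩, hk, -, rfl⟩ := hq'
    rw [← hα.eq_of_onFace_self hf hp h0 hk 1, hα.eq_of_onFace_self hg hq h0 hk 1]
  · rw [← hα.eq_of_onFace_self hf hp h0 h 1, ← hα.rev (f := (p, q, 1)) h, rev_mk,
      hα.eq_of_onFace_self hg hq h1 h.symm]

theorem exists_sameFace_of_bdy_eq_one {f : V × V × ℤˣ} {u w : V}
    (h : bdy H (E.faceIndicator f) u w = 1) : H.Adj u w ∧ ∃ ε, E.SameFace f (u, w, ε) := by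
  by_cases huw : H.Adj u w
  · refine ⟨huw, ?_⟩
    by_contra! hno
    rw [bdy_apply_of_adj huw, E.faceIndicator_eq_zero.2 (hno 1),
      E.faceIndicator_eq_zero.2 (hno (-1)), add_zero] at h
    exact zero_ne_one h
  · rw [bdy_apply_of_not_adj huw] at h
    exact absurd h zero_ne_one

theorem IsFaceLabel.eq_of_shared_edge {α : V × V × ℤˣ → ZMod 2} (hα : E.IsFaceLabel α)
    {f g : V × V × ℤˣ} (hf : H.Adj f.1 f.2.1) (hg : H.Adj g.1 g.2.1) {u w : V}
    (h1 : bdy H (E.faceIndicator f) u w = 1) (h2 : bdy H (E.faceIndicator g) u w = 1)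
    (h0 : bdy H α u w = 0) : α f = α g := by
  obtain ⟨huw, ε, hε⟩ := exists_sameFace_of_bdy_eq_one h1
  obtain ⟨-, δ, hδ⟩ := exists_sameFace_of_bdy_eq_one h2
  rw [← hα.sameFace hf huw hε, ← hα.sameFace hg huw hδ]
  exact eq_of_bdy_eq_zero huw h0 _ _

namespace IsSaturated

variable (hs : E.IsSaturated) {f : V × V × ℤˣ}

include hs

theorem not_sameFace_of_bdy_eq_zero {u w : V} (huw : H.Adj u w)
    (h : bdy H (E.faceIndicator f) u w = 0) (ε : ℤˣ) : ¬ E.SameFace f (u, w, ε) := by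
  intro hε
  have hε' : ¬ E.SameFace f (u, w, -ε) := fun h' =>
    hs.not_sameFace_neg huw ε ((hε.symm E).trans E h')
  rw [← faceIndicator_eq_one] at hε
  rw [← faceIndicator_eq_zero] at hε'
  rw [bdy_apply_of_adj huw] at h
  rcases Int.units_eq_one_or ε with rfl | rfl
  · rw [hε, hε', add_zero] at h
    exact one_ne_zero h
  · rw [neg_neg] at hε'
    rw [hε, hε', zero_add] at h
    exact one_ne_zero h

theorem adj_of_onFace {p q : V} (hp : E.OnFace f p) (hq : E.OnFace f q)
    (h : p ≠ q) : H.Adj p q := by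
  obtain ⟨g, hg, hfg, rfl⟩ := hp
  obtain ⟨k, hk, hfk, rfl⟩ := hq
  exact hs.adj_of_sameFace hg hk ((hfg.symm E).trans E hfk) h

theorem adj_of_reroute_onFace {u w : V} (huw : H.Adj u w) (hu : E.OnFace f u) (hw : E.OnFace f w)
    (h0 : bdy H (E.faceIndicator f) u w = 0) (ε : ℤˣ) {p q : V} (hp : E.OnFace (u, w, ε) p)
    (hq : E.OnFace (u, w, -ε) q) : p = q ∨ H.Adj p q := by
  obtain ⟨g, hg, hfg, hgu⟩ := hu
  obtain ⟨g', hg', hfg', hgw⟩ := hw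
  obtain ⟨k, hk, huk, rfl⟩ := hp
  obtain ⟨l, hl, hul, rfl⟩ := hq
  have hne : ∀ ε, ¬ E.SameFace g (u, w, ε) := fun ε h =>
    hs.not_sameFace_of_bdy_eq_zero huw h0 ε (hfg.trans E h)
  by_cases hkl : k.1 = l.1
  · exact Or.inl hkl
  · right
    have hgg := (hfg.symm E).trans E hfg'
    rcases Int.units_eq_one_or ε with rfl | rfl
    · exact hs.adj_of_reroute huw hg hg' hgg hgu hgw hne hk hl huk hul hkl
    · rw [neg_neg] at hul
      exact (hs.adj_of_reroute huw hg hg' hgg hgu hgw hne hl hk hul huk fun h => hkl h.symm).symm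

/-- The faces are cycles of length three, four or five. -/
theorem face_cases (hf : H.Adj f.1 f.2.1) :
    (∃ c, E.FaceTri f f.1 f.2.1 c) ∨ (∃ c d, E.FaceQuad f f.1 f.2.1 c d) ∨
      ∃ c d e, E.FacePent f f.1 f.2.1 c d e := by
  have e0 := E.vtx_zero f
  have e1 := E.vtx_one f
  have h01 := fun i => (E.adj_vtx_succ hf i).ne
  have h02 := hs.vtx_ne_succ_succ hf
  by_cases hnt : (E.step ^ 3) f = f
  · left
    have e3 : E.vtx f 3 = E.vtx f 0 := by rw [vtx, hnt]; rfl
    have a0 := h01 0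
    have a1 := h01 1
    have b0 := h02 0
    refine ⟨E.vtx f 2, hf, ?_, fun p => ?_, ?_, hnt⟩
    · rw [hs.bdy_faceIndicator hf (n := 3) (by norm_num) hnt]
      · simp only [Finset.sum_range_succ, Finset.sum_range_zero, zero_add, Nat.reduceAdd, e3, tri,
          e0, e1]
      · intro i hi j hj hij
        simp only [zero_add, Nat.reduceAdd] at *
        interval_cases i <;> interval_cases j <;> first | rfl | grind
    · rw [onFace_iff_of_period hf (by norm_num) hnt, ← e0, ← e1]
      constructor
      · rintro ⟨i, hi, rfl⟩
        interval_cases i <;> simp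
      · rintro (rfl | rfl | rfl)
        · exact ⟨0, by norm_num, rfl⟩
        · exact ⟨1, by norm_num, rfl⟩
        · exact ⟨2, by norm_num, rfl⟩
    · rw [← e0, ← e1]
      exact ⟨a0, a1, b0.symm⟩
  right
  have h03 := hs.vtx_ne_add_three hf hnt
  have ht := hs.tri_notMem hf hnt
  by_cases h4 : (E.step ^ 4) f = f
  · left
    have hper : ∀ i, E.vtx f (i + 4) = E.vtx f i := by
      intro i; rw [vtx, pow_add, Equiv.Perm.mul_apply, h4]; rfl
    have p4 := hper 0
    have p5 := hper 1
    have a0 := h01 0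
    have a1 := h01 1
    have a2 := h01 2
    have b0 := h02 0
    have b1 := h02 1
    have c0 := h03 0
    refine ⟨E.vtx f 2, E.vtx f 3, hf, ?_, fun p => ?_, ?_, ?_, ?_, ?_, ?_, ?_, ?_, ?_, ?_⟩
    · rw [hs.bdy_faceIndicator hf (n := 4) (by norm_num) h4]
      · simp only [Finset.sum_range_succ, Finset.sum_range_zero, zero_add, Nat.reduceAdd] at *
        rw [p4, e0, e1]
      · intro i hi j hj hij
        simp only [zero_add, Nat.reduceAdd] at *
        interval_cases i <;> interval_cases j <;> first | rfl | grind
    · rw [onFace_iff_of_period hf (by norm_num) h4, ← e0, ← e1]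
      constructor
      · rintro ⟨i, hi, rfl⟩
        interval_cases i <;> simp
      · rintro (rfl | rfl | rfl | rfl)
        · exact ⟨0, by norm_num, rfl⟩
        · exact ⟨1, by norm_num, rfl⟩
        · exact ⟨2, by norm_num, rfl⟩
        · exact ⟨3, by norm_num, rfl⟩
    · rw [← e0, ← e1]
      exact ⟨a0, b0, c0, a1, b1, a2⟩
    · exact ht 0
    · exact ht 1
    · rw [← e0, ← p4]; exact ht 2
    · rw [← e0, ← e1, ← p4, ← p5]; exact ht 3
    · exact hasCorner_vtx hf 0
    · exact hasCorner_vtx hf 1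
    · rw [← e0, ← p4]; exact hasCorner_vtx hf 2
    · rw [← e0, ← e1, ← p4, ← p5]; exact hasCorner_vtx hf 3
  · right
    have h5 := hs.step_pow_five hf hnt h4
    have h04 : ∀ i, E.vtx f i ≠ E.vtx f (i + 4) := fun i h' => h4 (hs.step_pow_four hf hnt i h')
    have hper : ∀ i, E.vtx f (i + 5) = E.vtx f i := by
      intro i; rw [vtx, pow_add, Equiv.Perm.mul_apply, h5]; rfl
    have p5 := hper 0
    have p6 := hper 1
    have a0 := h01 0
    have a1 := h01 1
    have a2 := h01 2
    have a3 := h01 3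
    have b0 := h02 0
    have b1 := h02 1
    have b2 := h02 2
    have c0 := h03 0
    have c1 := h03 1
    have d0 := h04 0
    refine ⟨E.vtx f 2, E.vtx f 3, E.vtx f 4, hf, ?_, fun p => ?_, ?_, ?_, ?_, ?_, ?_, ?_, ?_, ?_,
      ?_, ?_, ?_⟩
    · rw [hs.bdy_faceIndicator hf (n := 5) (by norm_num) h5]
      · simp only [Finset.sum_range_succ, Finset.sum_range_zero, zero_add, Nat.reduceAdd] at *
        rw [p5, e0, e1]
      · intro i hi j hj hij
        simp only [zero_add, Nat.reduceAdd] at *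
        interval_cases i <;> interval_cases j <;> first | rfl | grind
    · rw [onFace_iff_of_period hf (by norm_num) h5, ← e0, ← e1]
      constructor
      · rintro ⟨i, hi, rfl⟩
        interval_cases i <;> simp
      · rintro (rfl | rfl | rfl | rfl | rfl)
        · exact ⟨0, by norm_num, rfl⟩
        · exact ⟨1, by norm_num, rfl⟩
        · exact ⟨2, by norm_num, rfl⟩
        · exact ⟨3, by norm_num, rfl⟩
        · exact ⟨4, by norm_num, rfl⟩
    · rw [← e0, ← e1]
      exact ⟨a0, b0, c0, d0, a1, b1, c1, a2, b2, a3⟩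
    · exact ht 0
    · exact ht 1
    · exact ht 2
    · rw [← e0, ← p5]; exact ht 3
    · rw [← e0, ← e1, ← p5, ← p6]; exact ht 4
    · exact hasCorner_vtx hf 0
    · exact hasCorner_vtx hf 1
    · exact hasCorner_vtx hf 2
    · rw [← e0, ← p5]; exact hasCorner_vtx hf 3
    · rw [← e0, ← e1, ← p5, ← p6]; exact hasCorner_vtx hf 4

/-- A set of faces with empty boundary that contains a face contains all faces. -/
theorem eq_zero_of_bdy_eq_zero {α : V × V × ℤˣ → ZMod 2} (hα : E.IsFaceLabel α)
    (h0 : bdy H α = 0) (hf : H.Adj f.1 f.2.1) {g : V × V × ℤˣ} (hg : H.Adj g.1 g.2.1) :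
    α f = α g := by
  obtain ⟨u, w, ε⟩ := f
  obtain ⟨u', w', ε'⟩ := g
  exact hα.eq_of_reachable h0 (hs.preconnected u u') hf hg _ _

theorem exists_adj_of_ne {s p : V} (h : s ≠ p) : ∃ t, H.Adj s t := by
  obtain ⟨w⟩ := hs.preconnected s p
  cases w with
  | nil => exact absurd rfl h
  | cons h' _ => exact ⟨_, h'⟩

end IsSaturated
end RotationSystem
end SimpleGraph

/-! ### Exclusion of pentagonal faces -/

namespace SimpleGraph
namespace RotationSystem

variable {V : Type*} [Fintype V] [DecidableEq V] {H : SimpleGraph V} {E : RotationSystem H}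

theorem not_sameFace_of_onFace {f g : V × V × ℤˣ} {p : V} (hp : E.OnFace g p)
    (h : ¬ E.OnFace f p) : ¬ E.SameFace f g := fun h' => h (hp.of_sameFace (h'.symm E))

theorem faceIndicator_eq_zero_of_not_onFace {f : V × V × ℤˣ} {s t : V} {ε : ℤˣ} (ht : H.Adj s t)
    (h : ¬ E.OnFace f s) : E.faceIndicator f (s, t, ε) = 0 :=
  E.faceIndicator_eq_zero.2 fun h' => h ⟨_, ht, h', rfl⟩

theorem IsFaceLabel.exists_eq_one {α : V × V × ℤˣ → ZMod 2} {u w : V} (huw : H.Adj u w)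
    (h : bdy H α u w = 1) : ∃ ε, α (u, w, ε) = 1 ∧ α (u, w, -ε) = 0 := by
  rw [bdy_apply_of_adj huw] at h
  rcases zmod_two_eq (α (u, w, 1)) with h1 | h1
  · rw [h1, zero_add] at h
    exact ⟨-1, h, by rw [neg_neg, h1]⟩
  · refine ⟨1, h1, ?_⟩
    rw [h1] at h
    simpa using h

theorem exists_notMem_list (l : List V) (h : l.length < Fintype.card V) : ∃ s, s ∉ l := by
  by_contra! hl
  have : (Finset.univ : Finset V) ⊆ l.toFinset := fun x _ => List.mem_toFinset.2 (hl x)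
  have := (Finset.card_le_card this).trans l.toFinset_card_le
  rw [Finset.card_univ] at this
  omega

namespace FacePent

variable {f : V × V × ℤˣ} {a b c d e : V} (h : E.FacePent f a b c d e)

include h

theorem onFace : E.OnFace f a ∧ E.OnFace f b ∧ E.OnFace f c ∧ E.OnFace f d ∧ E.OnFace f e := by
  simp [h.onFace_iff]

theorem adj_all (hs : E.IsSaturated) : H.Adj a b ∧ H.Adj a c ∧ H.Adj a d ∧ H.Adj a e ∧ H.Adj b c ∧
    H.Adj b d ∧ H.Adj b e ∧ H.Adj c d ∧ H.Adj c e ∧ H.Adj d e := by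
  obtain ⟨ha, hb, hc, hd, he⟩ := h.onFace
  obtain ⟨h1, h2, h3, h4, h5, h6, h7, h8, h9, h10⟩ := h.ne
  have key := fun {p q} => hs.adj_of_onFace (f := f) (p := p) (q := q)
  exact ⟨key ha hb h1, key ha hc h2, key ha hd h3, key ha he h4, key hb hc h5, key hb hd h6,
    key hb he h7, key hc hd h8, key hc he h9, key hd he h10⟩

/-- Otherwise its sum with the non-bounding triangle `bcd` bounds. That sum is the cycle `abcd`,
which follows the face at `b` and would separate `b` from the fifth vertex `e` along the edge `be`.
-/
theorem tri_mem (hs : E.IsSaturated) : tri a b d ∈ E.boundarySpace := by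
  by_contra hn
  obtain ⟨hab, hac, had, hae, hbc, hbd, hbe, hcd, hce, hde⟩ := h.adj_all hs
  have hne := h.ne
  have hz := hs.add_mem (tri_mem_cycleSpace hab hbd had.symm) (tri_mem_cycleSpace hbc hcd hbd.symm)
    hn h.notMem₂
  obtain ⟨α, hα, hb, h0⟩ := exists_isFaceLabel_eq_zero hz f
  have h1 : α (b, e, 1) = 1 := by
    refine h.corner₁ α hα h0 (fun t => ?_) e hbe hne.2.2.2.1.symm hne.2.2.2.2.2.2.2.2.1.symm 1
    simp only [hb, tri, Pi.add_apply, edgeInd]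
    grind
  have h2 := hα.eq_of_onFace_self h.adj h.onFace.2.2.2.2 (fun t => by
    simp only [hb, tri, Pi.add_apply, edgeInd]
    grind) hbe.symm
  have h3 := hα.rev (f := (b, e, 1)) hbe
  rw [rev_mk, h2, h0, h1] at h3
  exact zero_ne_one h3

end FacePent

namespace IsSaturated

variable (hs : E.IsSaturated)

include hs

theorem exists_third {f : V × V × ℤˣ} (hf : H.Adj f.1 f.2.1) :
    ∃ x, E.OnFace f x ∧ x ≠ f.1 ∧ x ≠ f.2.1 := by
  rcases hs.face_cases hf with ⟨x, h⟩ | ⟨x, y, h⟩ | ⟨x, y, z, h⟩ <;>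
  · have := h.ne
    exact ⟨x, by simp [h.onFace_iff], by grind, by grind⟩

theorem faceTri_of_onFace {f : V × V × ℤˣ} (hf : H.Adj f.1 f.2.1) {x : V}
    (hx : ∀ p, E.OnFace f p → p = f.1 ∨ p = f.2.1 ∨ p = x) : E.FaceTri f f.1 f.2.1 x := by
  rcases hs.face_cases hf with ⟨y, h⟩ | ⟨y, z, h⟩ | ⟨y, z, w, h⟩ <;> have hne := h.ne
  · have := hx y (by simp [h.onFace_iff])
    obtain rfl : y = x := by grind
    exact h
  all_goals
    have h1 := hx y (by simp [h.onFace_iff])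
    have h2 := hx z (by simp [h.onFace_iff])
    grind

end IsSaturated

namespace FacePent

variable {f : V × V × ℤˣ} {a b c d e : V} (h : E.FacePent f a b c d e)

include h

/-- The two triangular faces at a chord of a pentagonal face. -/
theorem exists_faceTri (hs : E.IsSaturated) :
    (∃ g, E.FaceTri g a c d) ∧ ∃ g, E.FaceTri g a c e := by
  -- The triangles `cda` and `eac` at the chord `ac` bound; `α` and `β` are the sets of faces that
  -- they bound away from the pentagon.
  obtain ⟨α, hα, hbα, hα0⟩ := exists_isFaceLabel_eq_zero (h.rotate.rotate.tri_mem hs) f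
  obtain ⟨β, hβ, hbβ, hβ0⟩ := exists_isFaceLabel_eq_zero (h.rotate.rotate.rotate.rotate.tri_mem hs) f
  obtain ⟨hab, hac, had, hae, hbc, hbd, hbe, hcd, hce, hde⟩ := h.adj_all hs
  obtain ⟨oa, ob, oc, od, oe⟩ := h.onFace
  have hne := h.ne
  have zα : ∀ p, p ≠ a → p ≠ c → p ≠ d → ∀ t, bdy H α p t = 0 := fun p _ _ _ t => by
    simp only [hbα, tri, Pi.add_apply, edgeInd]
    grind
  have zβ : ∀ p, p ≠ a → p ≠ c → p ≠ e → ∀ t, bdy H β p t = 0 := fun p _ _ _ t => by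
    simp only [hbβ, tri, Pi.add_apply, edgeInd]
    grind
  obtain ⟨ε, h1, h2⟩ := IsFaceLabel.exists_eq_one (α := α) hac (by
    simp only [hbα, tri, Pi.add_apply, edgeInd]
    grind)
  have hβac : bdy H β a c = 1 := by
    simp only [hbβ, tri, Pi.add_apply, edgeInd]
    grind
  -- The chord `ac` could be drawn inside the pentagon instead, so the vertices of its two side
  -- faces are pairwise equal or adjacent. As `α` and `β` both change across `ac`, one of any two
  -- such vertices other than `a` and `c` is `d`, and one is `e`.
  have hre := fun p q => hs.adj_of_reroute_onFace (f := f) hac oa oc (by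
    simp only [h.bdy_eq, Pi.add_apply, edgeInd]
    grind) ε (p := p) (q := q)
  have fα : ∀ p q, E.OnFace (a, c, ε) p → E.OnFace (a, c, -ε) q → p ≠ a → p ≠ c → q ≠ a → q ≠ c →
      p = d ∨ q = d := by
    intro p q hp hq pa pc qa qc
    by_contra! hd
    have := hα.eq_of_onFace (f := (a, c, ε)) (g := (a, c, -ε)) hac hac hp hq (zα p pa pc hd.1)
      (zα q qa qc hd.2) (hre p q hp hq)
    rw [h1, h2] at this
    exact one_ne_zero this
  have fβ : ∀ p q, E.OnFace (a, c, ε) p → E.OnFace (a, c, -ε) q → p ≠ a → p ≠ c → q ≠ a → q ≠ c →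
      p = e ∨ q = e := by
    intro p q hp hq pa pc qa qc
    by_contra! hd
    have := hβ.eq_of_onFace (f := (a, c, ε)) (g := (a, c, -ε)) hac hac hp hq (zβ p pa pc hd.1)
      (zβ q qa qc hd.2) (hre p q hp hq)
    rw [bdy_apply_of_adj hac] at hβac
    rcases Int.units_eq_one_or ε with rfl | rfl
    · rw [this, CharTwo.add_self_eq_zero] at hβac
      exact zero_ne_one hβac
    · rw [neg_neg] at this
      rw [this, CharTwo.add_self_eq_zero] at hβac
      exact zero_ne_one hβac
  have nα : ∀ p, E.OnFace (a, c, ε) p → p ≠ e := by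
    rintro p hp rfl
    have := hα.eq_of_onFace (f := (a, c, ε)) hac h.adj hp oe (zα p hae.ne' hce.ne' hde.ne')
      (zα p hae.ne' hce.ne' hde.ne') (Or.inl rfl)
    rw [h1, hα0] at this
    exact one_ne_zero this
  have nβ : ∀ δ, β (a, c, δ) = 1 → ∀ p, E.OnFace (a, c, δ) p → p ≠ d := by
    rintro δ hδ p hp rfl
    have := hβ.eq_of_onFace (f := (a, c, δ)) hac h.adj hp od (zβ p had.ne' hcd.ne' hde.ne)
      (zβ p had.ne' hcd.ne' hde.ne) (Or.inl rfl)
    rw [hδ, hβ0] at this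
    exact one_ne_zero this
  obtain ⟨s, hs1, hsa, hsc⟩ := hs.exists_third (f := (a, c, ε)) hac
  obtain ⟨t, ht1, hta, htc⟩ := hs.exists_third (f := (a, c, -ε)) hac
  -- If `α` and `β` occupy different sides of `ac`, each side face has a single further vertex, `d`
  -- or `e`. If they occupy the same side, no third vertex there is `d` or `e`, so one on the other
  -- side would have to be both.
  rcases zmod_two_eq (β (a, c, ε)) with hε | hε
  · have hε' : β (a, c, -ε) = 1 := by
      rw [bdy_apply_of_adj hac] at hβac
      rcases Int.units_eq_one_or ε with rfl | rfl
      · rwa [hε, zero_add] at hβac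
      · rw [neg_neg]
        rwa [hε, add_zero] at hβac
    have htd := nβ _ hε' t ht1
    have hse := nα s hs1
    refine ⟨⟨_, hs.faceTri_of_onFace (f := (a, c, ε)) hac fun p hp => ?_⟩,
      ⟨_, hs.faceTri_of_onFace (f := (a, c, -ε)) hac fun q hq => ?_⟩⟩
    · by_contra! hp'
      rcases fα p t hp ht1 hp'.1 hp'.2.1 hta htc with h' | h'
      · exact hp'.2.2 h'
      · exact htd h'
    · by_contra! hq'
      rcases fβ s q hs1 hq hsa hsc hq'.1 hq'.2.1 with h' | h'
      · exact hse h'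
      · exact hq'.2.2 h'
  · exfalso
    have hsd := nβ _ hε s hs1
    have hse := nα s hs1
    have h3 := (fα s t hs1 ht1 hsa hsc hta htc).resolve_left hsd
    have h4 := (fβ s t hs1 ht1 hsa hsc hta htc).resolve_left hse
    exact hde.ne (h3.symm.trans h4)

/-- The pentagon and the five triangles at its chords use every edge between the five vertices
twice. Their sum has no boundary and so is constant, although it is `1` on the pentagon and `0` at a
sixth vertex. -/
theorem false_of_card (hs : E.IsSaturated) (hn : 6 ≤ Fintype.card V) : False := by
  obtain ⟨⟨g1, h1⟩, ⟨g2, h2⟩⟩ := h.exists_faceTri hs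
  obtain ⟨⟨g3, h3⟩, ⟨g4, h4⟩⟩ := h.rotate.exists_faceTri hs
  obtain ⟨-, ⟨g5, h5⟩⟩ := h.rotate.rotate.exists_faceTri hs
  have hne := h.ne
  obtain ⟨oa, ob, oc, od, oe⟩ := h.onFace
  obtain ⟨s, hsl⟩ := exists_notMem_list [a, b, c, d, e] (by simp only [List.length_cons, List.length_nil]; omega)
  simp only [List.mem_cons, List.not_mem_nil, or_false, not_or] at hsl
  obtain ⟨t, ht⟩ := hs.exists_adj_of_ne hsl.1
  have hα : E.IsFaceLabel (E.faceIndicator f + (E.faceIndicator g1 + E.faceIndicator g2 +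
      E.faceIndicator g3 + E.faceIndicator g4 + E.faceIndicator g5)) :=
    (E.isFaceLabel_faceIndicator f).add (((((E.isFaceLabel_faceIndicator g1).add
      (E.isFaceLabel_faceIndicator g2)).add (E.isFaceLabel_faceIndicator g3)).add
      (E.isFaceLabel_faceIndicator g4)).add (E.isFaceLabel_faceIndicator g5))
  have := hs.eq_zero_of_bdy_eq_zero hα (by
    ext x y
    simp only [map_add, h.bdy_eq, h1.bdy_eq, h2.bdy_eq, h3.bdy_eq, h4.bdy_eq, h5.bdy_eq, tri,
      edgeInd_comm d a, edgeInd_comm e a, edgeInd_comm e b]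
    have key := fun p q => CharTwo.add_self_eq_zero (edgeInd (V := V) p q x y)
    simp only [Pi.add_apply, Pi.zero_apply]
    linear_combination key a b + key b c + key c d + key d e + key a e + key a c + key c e +
      key b d + key b e + key a d) h.adj (g := (s, t, 1)) ht
  simp only [Pi.add_apply] at this
  rw [faceIndicator_self, E.faceIndicator_eq_zero.2 (not_sameFace_of_onFace ob (by
      simp only [h1.onFace_iff]; grind)), E.faceIndicator_eq_zero.2 (not_sameFace_of_onFace ob (by
      simp only [h2.onFace_iff]; grind)), E.faceIndicator_eq_zero.2 (not_sameFace_of_onFace oa (by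
      simp only [h3.onFace_iff]; grind)), E.faceIndicator_eq_zero.2 (not_sameFace_of_onFace oc (by
      simp only [h4.onFace_iff]; grind)), E.faceIndicator_eq_zero.2 (not_sameFace_of_onFace oa (by
      simp only [h5.onFace_iff]; grind))] at this
  iterate 6 rw [faceIndicator_eq_zero_of_not_onFace ht] at this
  · simp at this
  all_goals first | simp only [h.onFace_iff] | simp only [h1.onFace_iff] | simp only [h2.onFace_iff] | simp only [h3.onFace_iff] | simp only [h4.onFace_iff] | simp only [h5.onFace_iff]
  all_goals tauto

end FacePent
end RotationSystem
end SimpleGraph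

/-! ### Exclusion of quadrangular faces -/

namespace SimpleGraph
namespace RotationSystem

variable {V : Type*} [Fintype V] [DecidableEq V] {H : SimpleGraph V} {E : RotationSystem H}

/-- Two quadrangular faces that share two opposite edges of both. -/
structure FaceQuadPair (E : RotationSystem H) (f f₁ : V × V × ℤˣ) (a b c d : V) : Prop where
  fst : E.FaceQuad f a b c d
  snd : E.FaceQuad f₁ a b d c

namespace FaceQuad

variable {f : V × V × ℤˣ} {a b c d : V} (h : E.FaceQuad f a b c d)

include h

theorem onFace : E.OnFace f a ∧ E.OnFace f b ∧ E.OnFace f c ∧ E.OnFace f d := by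
  simp [h.onFace_iff]

theorem adj_all (hs : E.IsSaturated) : H.Adj a b ∧ H.Adj a c ∧ H.Adj a d ∧ H.Adj b c ∧
    H.Adj b d ∧ H.Adj c d := by
  obtain ⟨ha, hb, hc, hd⟩ := h.onFace
  obtain ⟨h1, h2, h3, h4, h5, h6⟩ := h.ne
  have key := fun {p q} => hs.adj_of_onFace (f := f) (p := p) (q := q)
  exact ⟨key ha hb h1, key ha hc h2, key ha hd h3, key hb hc h4, key hb hd h5, key hc hd h6⟩

theorem tri_cycle (hs : E.IsSaturated) : tri a b c ∈ cycleSpace H ∧ tri b c d ∈ cycleSpace H ∧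
    tri c d a ∈ cycleSpace H ∧ tri d a b ∈ cycleSpace H := by
  obtain ⟨hab, hac, had, hbc, hbd, hcd⟩ := h.adj_all hs
  exact ⟨tri_mem_cycleSpace hab hbc hac.symm, tri_mem_cycleSpace hbc hcd hbd.symm,
    tri_mem_cycleSpace hcd had.symm hac, tri_mem_cycleSpace had.symm hab hbd⟩

/-- If one side of a diagonal of a quadrangular face has only vertices of that face, then it is
another quadrangular face. -/
theorem quad_of_diagonal (hs : E.IsSaturated) {β : V × V × ℤˣ → ZMod 2} {ε : ℤˣ}
    (hβ : E.IsFaceLabel β)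
    (hbβ : bdy H β = edgeInd b c + edgeInd c a + edgeInd a d + edgeInd d b)
    (hβ0 : β f = 0) (hβε : β (a, c, ε) = 0) (hf : ¬ E.SameFace (a, c, ε) f)
    (hv : ∀ p, E.OnFace (a, c, ε) p → p = a ∨ p = b ∨ p = c ∨ p = d) :
    E.FaceQuad (a, c, ε) a c d b := by
  obtain ⟨hab, hac, had, hbc, hbd, hcd⟩ := h.adj_all hs
  have hne := h.ne
  rcases hs.face_cases (f := (a, c, ε)) hac with ⟨x, hx⟩ | ⟨x, y, hx⟩ | ⟨x, y, z, hx⟩ <;>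
    have hxne := hx.ne
  · exfalso
    have hxb : tri a c x ∈ E.boundarySpace := by
      rw [← hx.bdy_eq]
      exact E.mem_boundarySpace.2 ⟨_, E.isFaceLabel_faceIndicator _, rfl⟩
    have h1 := hv x (by simp [hx.onFace_iff])
    have : x = b ∨ x = d := by grind
    rcases this with rfl | rfl
    · rw [tri_reverse, ← tri_rotate] at hxb
      exact h.notMem₁ hxb
    · rw [tri_rotate] at hxb
      exact h.notMem₃ hxb
  · have h1 := hv x (by simp [hx.onFace_iff])
    have h2 := hv y (by simp [hx.onFace_iff])
    have : (x = b ∧ y = d) ∨ (x = d ∧ y = b) := by grind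
    rcases this with ⟨rfl, rfl⟩ | ⟨rfl, rfl⟩
    -- In the cyclic order `a, c, b, d` the face has the same boundary as `β`, so its sum with `β`
    -- is constant; but the sum is `1` on this face and `0` on `f`.
    · exfalso
      have := hs.eq_zero_of_bdy_eq_zero ((E.isFaceLabel_faceIndicator (a, c, ε)).add hβ) (by
        rw [map_add, hx.bdy_eq, hbβ, edgeInd_comm a c, edgeInd_comm c x, edgeInd_comm x y,
          edgeInd_comm y a]
        convert add_self_eq_zero_of_zmod_two _ using 2
        abel) (f := (a, c, ε)) hac h.adj
      rw [Pi.add_apply, Pi.add_apply, faceIndicator_self, hβε, hβ0,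
        E.faceIndicator_eq_zero.2 hf] at this
      exact one_ne_zero this
    · exact hx
  · have h1 := hv x (by simp [hx.onFace_iff])
    have h2 := hv y (by simp [hx.onFace_iff])
    have h3 := hv z (by simp [hx.onFace_iff])
    grind

/-- The cycles `abdc` and `bcad` bound as sums of two non-bounding triangles, and the sets `α` and
`β` that they bound away from `f` partition the faces other than `f`. The diagonal `ac` can be
rerouted through `f`, so at least one of its side faces has only vertices of `f`; that face is the
second quadrangle. -/
theorem exists_pair (hs : E.IsSaturated) : ∃ f₁ a' b' c' d', E.FaceQuadPair f f₁ a' b' c' d' := by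
  obtain ⟨hab, hac, had, hbc, hbd, hcd⟩ := h.adj_all hs
  obtain ⟨t1, t2, t3, t4⟩ := h.tri_cycle hs
  obtain ⟨oa, ob, oc, od⟩ := h.onFace
  have hne := h.ne
  obtain ⟨α, hα, hbα, hα0⟩ := exists_isFaceLabel_eq_zero (hs.add_mem t4 t3 h.notMem₄ h.notMem₃) f
  obtain ⟨β, hβ, hbβ, hβ0⟩ := exists_isFaceLabel_eq_zero (hs.add_mem t1 t4 h.notMem₁ h.notMem₄) f
  have hbα' : bdy H α = edgeInd a b + edgeInd b d + edgeInd d c + edgeInd c a := by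
    ext x y
    have key := CharTwo.add_self_eq_zero (edgeInd d a x y)
    simp only [hbα, tri, Pi.add_apply, edgeInd_comm a c, edgeInd_comm d c]
    grind
  have hbβ' : bdy H β = edgeInd b c + edgeInd c a + edgeInd a d + edgeInd d b := by
    ext x y
    have key := CharTwo.add_self_eq_zero (edgeInd a b x y)
    simp only [hbβ, tri, Pi.add_apply, edgeInd_comm d a, edgeInd_comm d b]
    grind
  have hsum : ∀ g : V × V × ℤˣ, H.Adj g.1 g.2.1 → ¬ E.SameFace f g → α g + β g = 1 := by
    intro g hg hfg
    have := hs.eq_zero_of_bdy_eq_zero ((hα.add hβ).add (E.isFaceLabel_faceIndicator f)) (by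
      ext x y
      have k1 := CharTwo.add_self_eq_zero (edgeInd a b x y)
      have k2 := CharTwo.add_self_eq_zero (edgeInd b c x y)
      have k3 := CharTwo.add_self_eq_zero (edgeInd c d x y)
      have k4 := CharTwo.add_self_eq_zero (edgeInd d a x y)
      have k5 := CharTwo.add_self_eq_zero (edgeInd c a x y)
      have k6 := CharTwo.add_self_eq_zero (edgeInd d b x y)
      simp only [map_add, hbα', hbβ', h.bdy_eq, Pi.add_apply, Pi.zero_apply, edgeInd_comm a d,
        edgeInd_comm d c, edgeInd_comm b d]
      grind) h.adj hg
    simp only [Pi.add_apply] at this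
    rw [hα0, hβ0, faceIndicator_self, E.faceIndicator_eq_zero.2 hfg, add_zero, add_zero,
      zero_add] at this
    exact this.symm
  have h0 : bdy H (E.faceIndicator f) a c = 0 := by
    simp only [h.bdy_eq, Pi.add_apply, edgeInd]
    grind
  obtain ⟨ε, h1, h2⟩ := IsFaceLabel.exists_eq_one (α := α) hac (by
    simp only [hbα', Pi.add_apply, edgeInd]
    grind)
  have hf1 := hs.not_sameFace_of_bdy_eq_zero hac h0
  have h3 := hsum (a, c, ε) hac (hf1 ε)
  have h4 := hsum (a, c, -ε) hac (hf1 (-ε))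
  rw [h2, zero_add] at h4
  rw [h1] at h3
  have h3 : β (a, c, ε) = 0 := by simpa using h3
  by_cases hv : ∀ p, E.OnFace (a, c, ε) p → p = a ∨ p = b ∨ p = c ∨ p = d
  · have := h.quad_of_diagonal hs hβ hbβ' hβ0 h3 (fun h' => hf1 _ (h'.symm E)) hv
    exact ⟨_, a, b, c, d, h, this.reverse.rotate.rotate.rotate⟩
  · push Not at hv
    obtain ⟨p, hp, hpa, hpb, hpc, hpd⟩ := hv
    -- A vertex `p` off `f` on one side of `ac` would be equal or adjacent to a vertex off `f` on
    -- the other side, although `α` separates the sides; so the other side has only vertices of `f`.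
    have := h.reverse.rotate.rotate.rotate.quad_of_diagonal hs hα (by
      rw [hbα', edgeInd_comm a b, edgeInd_comm b d, edgeInd_comm d c, edgeInd_comm c a]; abel) hα0
      h2 (fun h' => hf1 _ (h'.symm E)) (fun q hq => by
        by_contra! hq'
        have := hα.eq_of_onFace (f := (a, c, ε)) (g := (a, c, -ε)) hac hac hp hq (fun t => by
          simp only [hbα', Pi.add_apply, edgeInd]
          grind) (fun t => by
          simp only [hbα', Pi.add_apply, edgeInd]
          grind) (hs.adj_of_reroute_onFace hac oa oc h0 ε hp hq)
        rw [h1, h2] at this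
        exact one_ne_zero this)
    exact ⟨_, b, c, d, a, h.rotate, this.reverse.rotate⟩

end FaceQuad

namespace FaceQuadPair

variable {f f₁ : V × V × ℤˣ} {a b c d : V} (h : E.FaceQuadPair f f₁ a b c d)

include h

theorem swap : E.FaceQuadPair f₁ f a b d c := ⟨h.snd, h.fst⟩

theorem reflect : E.FaceQuadPair f f₁ b a d c :=
  ⟨h.fst.reverse.rotate.rotate, h.snd.reverse.rotate.rotate⟩

theorem not_sameFace (hs : E.IsSaturated) : ¬ E.SameFace f₁ f := by
  obtain ⟨hab, hac, had, hbc, hbd, hcd⟩ := h.fst.adj_all hs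
  have hne := h.fst.ne
  obtain ⟨-, ε, hε⟩ := exists_sameFace_of_bdy_eq_one (E := E) (f := f) (u := b) (w := c) (by
    simp only [h.fst.bdy_eq, Pi.add_apply, edgeInd]
    grind)
  intro h'
  refine hs.not_sameFace_of_bdy_eq_zero (f := f₁) hbc ?_ ε (h'.trans E hε)
  simp only [h.snd.bdy_eq, Pi.add_apply, edgeInd]
  grind

/-- Otherwise its sum with `dab` bounds. At `a` this sum follows the corner of `f`, so `ac` has both
sides inside. But `f₁`, which is outside like `f` because they share the edge `cd` off the boundary,
contains `ac`. -/
theorem tri_mem (hs : E.IsSaturated) {s : V} (hsd : s ≠ d) (hsa : s ≠ a) (hsb : H.Adj s b)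
    (hsc : H.Adj s c) : tri s b c ∈ E.boundarySpace := by
  by_contra hn
  obtain ⟨hab, hac, had, hbc, hbd, hcd⟩ := h.fst.adj_all hs
  have hne := h.fst.ne
  have h1 := hsb.ne
  have h2 := hsc.ne
  obtain ⟨α, hα, hb, h0⟩ := exists_isFaceLabel_eq_zero (hs.add_mem
    (tri_mem_cycleSpace hsb hbc hsc.symm) (h.fst.tri_cycle hs).2.2.2 hn h.fst.notMem₄) f
  have h3 := h.fst.corner₄ α hα h0 (fun t => by
    simp only [hb, tri, Pi.add_apply, edgeInd]
    grind) c hac hcd.ne hbc.ne'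
  have h4 := hα.eq_of_shared_edge h.fst.adj h.snd.adj (u := c) (w := d) (by
    simp only [h.fst.bdy_eq, Pi.add_apply, edgeInd]
    grind) (by
    simp only [h.snd.bdy_eq, Pi.add_apply, edgeInd]
    grind) (by
    simp only [hb, tri, Pi.add_apply, edgeInd]
    grind)
  obtain ⟨-, ε, hε⟩ := exists_sameFace_of_bdy_eq_one (E := E) (f := f₁) (u := a) (w := c) (by
    simp only [h.snd.bdy_eq, Pi.add_apply, edgeInd]
    grind)
  have h5 := hα.sameFace h.snd.adj (g := (a, c, ε)) hac hε
  rw [h3, ← h4, h0] at h5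
  exact one_ne_zero h5

/-- The two sides of `ab` are already taken by `f` and `f₁`. -/
theorem false_of_third_side (hs : E.IsSaturated) {g : V × V × ℤˣ} (hf : ¬ E.SameFace f g)
    (hf₁ : ¬ E.SameFace f₁ g) (hg : bdy H (E.faceIndicator g) a b = 1) : False := by
  have hne := h.fst.ne
  obtain ⟨hab, ε, hε⟩ := exists_sameFace_of_bdy_eq_one hg
  obtain ⟨-, ε₁, hε₁⟩ := exists_sameFace_of_bdy_eq_one (E := E) (f := f) (u := a) (w := b) (by
    simp only [h.fst.bdy_eq, Pi.add_apply, edgeInd]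
    grind)
  obtain ⟨-, ε₂, hε₂⟩ := exists_sameFace_of_bdy_eq_one (E := E) (f := f₁) (u := a) (w := b) (by
    simp only [h.snd.bdy_eq, Pi.add_apply, edgeInd]
    grind)
  have n1 : ε ≠ ε₁ := by rintro rfl; exact hf (hε₁.trans E (hε.symm E))
  have n2 : ε ≠ ε₂ := by rintro rfl; exact hf₁ (hε₂.trans E (hε.symm E))
  have n3 : ε₁ ≠ ε₂ := by rintro rfl; exact h.not_sameFace hs (hε₂.trans E (hε₁.symm E))
  rcases Int.units_eq_one_or ε with rfl | rfl <;> rcases Int.units_eq_one_or ε₁ with rfl | rfl <;>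
    rcases Int.units_eq_one_or ε₂ with rfl | rfl <;> simp at n1 n2 n3

/-- The face on the other side of an edge of a pair of quadrangular faces is a triangle with an
apex outside of the pair. -/
theorem exists_faceTri (hs : E.IsSaturated) (hn : 6 ≤ Fintype.card V) :
    ∃ g x, E.FaceTri g b c x ∧ (x ≠ a ∧ x ≠ b ∧ x ≠ c ∧ x ≠ d) ∧
      (H.Adj x a ∧ H.Adj x b ∧ H.Adj x c ∧ H.Adj x d) ∧ bdy H (E.faceIndicator f) b c = 1 ∧
      ¬ E.SameFace f g ∧ ∃ ε, g = (b, c, -ε) ∧ E.SameFace f (b, c, ε) := by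
  obtain ⟨hab, hac, had, hbc, hbd, hcd⟩ := h.fst.adj_all hs
  obtain ⟨oa, ob, oc, od⟩ := h.fst.onFace
  obtain ⟨-, ob₁, -, oc₁⟩ := h.snd.onFace
  have hne := h.fst.ne
  have hbc1 : bdy H (E.faceIndicator f) b c = 1 := by
    simp only [h.fst.bdy_eq, Pi.add_apply, edgeInd]
    grind
  obtain ⟨-, ε, hε⟩ := exists_sameFace_of_bdy_eq_one hbc1
  have h0 : bdy H (E.faceIndicator f₁) b c = 0 := by
    simp only [h.snd.bdy_eq, Pi.add_apply, edgeInd]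
    grind
  have hfg : ¬ E.SameFace f (b, c, -ε) := fun h' => hs.not_sameFace_neg hbc ε ((hε.symm E).trans E h')
  have hf₁g := hs.not_sameFace_of_bdy_eq_zero hbc h0 (-ε)
  -- The edge `bc` is a diagonal of `f₁`, so it can be rerouted there; hence every vertex of `f` is
  -- equal or adjacent to every vertex of the face across `bc`.
  have hre : ∀ p q, E.OnFace f p → E.OnFace (b, c, -ε) q → p = q ∨ H.Adj p q := fun p q hp hq =>
    hs.adj_of_reroute_onFace hbc ob₁ oc₁ h0 ε (hp.of_sameFace hε) hq
  have hall : ∀ x, E.OnFace (b, c, -ε) x → (x ≠ a ∧ x ≠ b ∧ x ≠ c ∧ x ≠ d) →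
      H.Adj x a ∧ H.Adj x b ∧ H.Adj x c ∧ H.Adj x d := fun x hx hx' =>
    ⟨((hre _ _ oa hx).resolve_left hx'.1.symm).symm,
      ((hre _ _ ob hx).resolve_left hx'.2.1.symm).symm,
      ((hre _ _ oc hx).resolve_left hx'.2.2.1.symm).symm,
      ((hre _ _ od hx).resolve_left hx'.2.2.2.symm).symm⟩
  have hD : ∀ x, E.OnFace (b, c, -ε) x → (x ≠ a ∧ x ≠ b ∧ x ≠ c ∧ x ≠ d) →
      tri x b c ∈ E.boundarySpace := fun x hx hx' => by
    obtain ⟨k1, k2, k3, k4⟩ := hall x hx hx'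
    exact h.tri_mem hs hx'.2.2.2 hx'.1 k2 k3
  rcases hs.face_cases (f := (b, c, -ε)) hbc with ⟨x, hx⟩ | ⟨r, s, hx⟩ | ⟨r, x, s, hx⟩ <;>
    have hxne := hx.ne
  · have hx1 : E.OnFace (b, c, -ε) x := by simp [hx.onFace_iff]
    have hxb : tri b c x ∈ E.boundarySpace := by
      rw [← hx.bdy_eq]
      exact E.mem_boundarySpace.2 ⟨_, E.isFaceLabel_faceIndicator _, rfl⟩
    have hx2 : x ≠ a ∧ x ≠ b ∧ x ≠ c ∧ x ≠ d := by
      refine ⟨?_, hxne.2.2, hxne.2.1.symm, ?_⟩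
      · rintro rfl
        rw [← tri_rotate] at hxb
        exact h.fst.notMem₁ hxb
      · rintro rfl
        exact h.fst.notMem₂ hxb
    exact ⟨_, x, hx, hx2, hall x hx1 hx2, hbc1, hfg, ε, rfl, hε⟩
  -- In a quadrangle across `bc`, each further vertex off `f` would form a bounding triangle with
  -- `bc`, so the further vertices are `a` and `d`. A side `ab` is excluded, so the boundary is
  -- `bcad`; with `f` and `f₁` this closes up on four vertices.
  · exfalso
    have hr1 : E.OnFace (b, c, -ε) r := by simp [hx.onFace_iff]
    have hs1 : E.OnFace (b, c, -ε) s := by simp [hx.onFace_iff]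
    obtain rfl : s = d := by
      by_contra hsd
      by_cases hsa : s = a
      · subst hsa
        refine h.false_of_third_side hs hfg hf₁g ?_
        simp only [hx.bdy_eq, Pi.add_apply, edgeInd]
        grind
      · exact hx.notMem₄ (hD s hs1 ⟨hsa, hxne.2.2.1.symm, hxne.2.2.2.2.1.symm, hsd⟩)
    obtain rfl : r = a := by
      by_contra hra
      refine hx.notMem₁ ?_
      rw [← tri_rotate]
      exact hD r hr1 ⟨hra, hxne.2.1.symm, hxne.2.2.2.1.symm, hxne.2.2.2.2.2⟩
    obtain ⟨p, hpl⟩ := exists_notMem_list [r, b, c, s] (by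
      simp only [List.length_cons, List.length_nil]; omega)
    simp only [List.mem_cons, List.not_mem_nil, or_false, not_or] at hpl
    obtain ⟨t, ht⟩ := hs.exists_adj_of_ne hpl.1
    have := hs.eq_zero_of_bdy_eq_zero (((E.isFaceLabel_faceIndicator f).add
      (E.isFaceLabel_faceIndicator f₁)).add (E.isFaceLabel_faceIndicator (b, c, -ε))) (by
      ext x y
      have k1 := CharTwo.add_self_eq_zero (edgeInd r b x y)
      have k2 := CharTwo.add_self_eq_zero (edgeInd b c x y)
      have k3 := CharTwo.add_self_eq_zero (edgeInd c s x y)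
      have k4 := CharTwo.add_self_eq_zero (edgeInd s r x y)
      have k5 := CharTwo.add_self_eq_zero (edgeInd c r x y)
      have k6 := CharTwo.add_self_eq_zero (edgeInd s b x y)
      simp only [map_add, h.fst.bdy_eq, h.snd.bdy_eq, hx.bdy_eq, Pi.add_apply, Pi.zero_apply,
        edgeInd_comm r s, edgeInd_comm s c, edgeInd_comm b s]
      grind) h.fst.adj (g := (p, t, 1)) ht
    simp only [Pi.add_apply] at this
    rw [faceIndicator_self, E.faceIndicator_eq_zero.2 (h.not_sameFace hs),
      E.faceIndicator_eq_zero.2 (fun h' => hfg (h'.symm E)),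
      faceIndicator_eq_zero_of_not_onFace ht (by rw [h.fst.onFace_iff]; tauto),
      faceIndicator_eq_zero_of_not_onFace ht (by rw [h.snd.onFace_iff]; tauto),
      faceIndicator_eq_zero_of_not_onFace ht (by rw [hx.onFace_iff]; tauto)] at this
    simp at this
  -- In a pentagon the neighbours of `bc` on the face are again `a` and `d`. The triangle of these
  -- two with the remaining vertex bounds, by `tri_mem` for the reflected pair, which a pentagon
  -- does not allow.
  · exfalso
    have hr1 : E.OnFace (b, c, -ε) r := by simp [hx.onFace_iff]
    have hs1 : E.OnFace (b, c, -ε) s := by simp [hx.onFace_iff]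
    have hx1 : E.OnFace (b, c, -ε) x := by simp [hx.onFace_iff]
    obtain rfl : s = d := by
      by_contra hsd
      by_cases hsa : s = a
      · subst hsa
        refine h.false_of_third_side hs hfg hf₁g ?_
        simp only [hx.bdy_eq, Pi.add_apply, edgeInd]
        grind
      · refine hx.notMem₅ (hD s hs1 ⟨hsa, ?_, ?_, hsd⟩) <;> grind
    obtain rfl : r = a := by
      by_contra hra
      refine hx.notMem₁ ?_
      rw [← tri_rotate]
      refine hD r hr1 ⟨hra, ?_, ?_, ?_⟩ <;> grind
    obtain ⟨k1, k2, k3, k4⟩ := hall x hx1 (by grind)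
    refine hx.notMem₃ ?_
    rw [← tri_rotate, tri_reverse]
    exact h.reflect.tri_mem hs (s := x) (by grind) (by grind) k1 k4

/-- The triangle `xbc` bounds. If the apex `y` were not `x`, the edge `ya` would avoid this triangle
and show that both sides of `bc` are on the same side of it, although `bc` is one of its edges. -/
theorem apex_eq (hs : E.IsSaturated) {g : V × V × ℤˣ} {x y : V} {ε : ℤˣ}
    (hg : E.FaceTri g b c y) (hgε : g = (b, c, -ε)) (hε : E.SameFace f (b, c, ε))
    (hy : y ≠ a ∧ y ≠ b ∧ y ≠ c ∧ y ≠ d) (hya : H.Adj y a)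
    (hx : x ≠ a ∧ x ≠ b ∧ x ≠ c ∧ x ≠ d) (hxb : H.Adj x b) (hxc : H.Adj x c) : y = x := by
  by_contra hyx
  have hne := h.fst.ne
  obtain ⟨hab, hac, had, hbc, hbd, hcd⟩ := h.fst.adj_all hs
  obtain ⟨α, hα, hb, h0⟩ := exists_isFaceLabel_eq_zero (h.tri_mem hs hx.2.2.2 hx.1 hxb hxc) f
  have h1 := hα.eq_of_onFace hg.adj h.fst.adj (p := y) (q := a) (by simp [hg.onFace_iff])
    h.fst.onFace.1 (fun t => by
      simp only [hb, tri, Pi.add_apply, edgeInd]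
      grind) (fun t => by
      simp only [hb, tri, Pi.add_apply, edgeInd]
      grind) (Or.inr hya)
  have h2 := hα.sameFace (g := (b, c, ε)) h.fst.adj hbc hε
  have h3 : bdy H α b c = 1 := by
    simp only [hb, tri, Pi.add_apply, edgeInd]
    grind
  rw [hgε, h0] at h1
  rw [h0] at h2
  rw [bdy_apply_of_adj hbc] at h3
  rcases Int.units_eq_one_or ε with rfl | rfl
  · rw [h1, h2] at h3
    simp at h3
  · rw [neg_neg] at h1
    rw [h1, h2] at h3
    simp at h3

theorem exists_faceTri_of_adj (hs : E.IsSaturated) (hn : 6 ≤ Fintype.card V) {x : V}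
    (hx : x ≠ a ∧ x ≠ b ∧ x ≠ c ∧ x ≠ d) (hxb : H.Adj x b) (hxc : H.Adj x c) :
    ∃ g, E.FaceTri g b c x := by
  obtain ⟨g, y, hg, hy, hya, -, -, ε, hgε, hε⟩ := h.exists_faceTri hs hn
  obtain rfl := h.apex_eq hs hg hgε hε hy hya.1 hx hxb hxc
  exact ⟨g, hg⟩

/-- The four unshared edges of the two quadrangles carry triangles with one common apex `x`.
Together with the quadrangles these six faces have no boundary, and none of them reaches a sixth
vertex. -/
theorem false_of_card (hs : E.IsSaturated) (hn : 6 ≤ Fintype.card V) : False := by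
  obtain ⟨g1, x, h1, hx, ⟨xa, xb, xc, xd⟩, -⟩ := h.exists_faceTri hs hn
  -- The symmetries of the pair carry `bc` to the other unshared edges `ad`, `bd` and `ac`.
  obtain ⟨g2, h2⟩ := h.reflect.exists_faceTri_of_adj hs hn (x := x) (by grind) xa xd
  obtain ⟨g3, h3⟩ := h.swap.exists_faceTri_of_adj hs hn (x := x) (by grind) xb xd
  obtain ⟨g4, h4⟩ := h.swap.reflect.exists_faceTri_of_adj hs hn (x := x) (by grind) xa xc
  have hne := h.fst.ne
  obtain ⟨oa, ob, oc, od⟩ := h.fst.onFace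
  obtain ⟨s, hsl⟩ := exists_notMem_list [a, b, c, d, x] (by
    simp only [List.length_cons, List.length_nil]; omega)
  simp only [List.mem_cons, List.not_mem_nil, or_false, not_or] at hsl
  obtain ⟨t, ht⟩ := hs.exists_adj_of_ne hsl.1
  have hα : E.IsFaceLabel (E.faceIndicator f + E.faceIndicator f₁ + (E.faceIndicator g1 +
      E.faceIndicator g2 + E.faceIndicator g3 + E.faceIndicator g4)) :=
    ((E.isFaceLabel_faceIndicator f).add (E.isFaceLabel_faceIndicator f₁)).add
      ((((E.isFaceLabel_faceIndicator g1).add (E.isFaceLabel_faceIndicator g2)).add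
      (E.isFaceLabel_faceIndicator g3)).add (E.isFaceLabel_faceIndicator g4))
  have := hs.eq_zero_of_bdy_eq_zero hα (by
    ext p q
    simp only [map_add, h.fst.bdy_eq, h.snd.bdy_eq, h1.bdy_eq, h2.bdy_eq, h3.bdy_eq, h4.bdy_eq, tri,
      Pi.add_apply, Pi.zero_apply, edgeInd_comm d a, edgeInd_comm c a, edgeInd_comm d c,
      edgeInd_comm x a, edgeInd_comm x b, edgeInd_comm c x, edgeInd_comm d x]
    have key := fun u w => CharTwo.add_self_eq_zero (edgeInd (V := V) u w p q)
    linear_combination key a b + key b c + key c d + key a d + key a c + key b d +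
      key a x + key b x + key x c + key x d) h.fst.adj (g := (s, t, 1)) ht
  simp only [Pi.add_apply] at this
  rw [faceIndicator_self, E.faceIndicator_eq_zero.2 (h.not_sameFace hs),
    E.faceIndicator_eq_zero.2 (not_sameFace_of_onFace oa (by simp only [h1.onFace_iff]; grind)),
    E.faceIndicator_eq_zero.2 (not_sameFace_of_onFace ob (by simp only [h2.onFace_iff]; grind)),
    E.faceIndicator_eq_zero.2 (not_sameFace_of_onFace oa (by simp only [h3.onFace_iff]; grind)),
    E.faceIndicator_eq_zero.2 (not_sameFace_of_onFace ob (by simp only [h4.onFace_iff]; grind)),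
    faceIndicator_eq_zero_of_not_onFace ht (by rw [h.fst.onFace_iff]; tauto),
    faceIndicator_eq_zero_of_not_onFace ht (by rw [h.snd.onFace_iff]; tauto),
    faceIndicator_eq_zero_of_not_onFace ht (by rw [h1.onFace_iff]; tauto),
    faceIndicator_eq_zero_of_not_onFace ht (by rw [h2.onFace_iff]; tauto),
    faceIndicator_eq_zero_of_not_onFace ht (by rw [h3.onFace_iff]; tauto),
    faceIndicator_eq_zero_of_not_onFace ht (by rw [h4.onFace_iff]; tauto)] at this
  simp at this

end FaceQuadPair

theorem IsSaturated.step_pow_three (hs : E.IsSaturated) (hn : 6 ≤ Fintype.card V)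
    {f : V × V × ℤˣ} (hf : H.Adj f.1 f.2.1) : (E.step ^ 3) f = f := by
  rcases hs.face_cases hf with ⟨x, h⟩ | ⟨x, y, h⟩ | ⟨x, y, z, h⟩
  · exact h.period
  · obtain ⟨f₁, a, b, c, d, h'⟩ := h.exists_pair hs
    exact (h'.false_of_card hs hn).elim
  · exact (h.false_of_card hs hn).elim

end RotationSystem
end SimpleGraph

/-! ### Translation between rotation systems and embedding schemes -/

namespace SimpleGraph
namespace RotationSystem

variable {V : Type*} {G : SimpleGraph V} (E : RotationSystem G)

/-- The rotation of the darts of a rotation system. -/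
def dartRot : Equiv.Perm G.Dart where
  toFun d := ⟨(d.fst, E.rot d.fst d.snd), E.adj_rot_iff.2 d.adj⟩
  invFun d := ⟨(d.fst, (E.rot d.fst)⁻¹ d.snd), E.adj_rot_inv_iff.2 d.adj⟩
  left_inv _ := Dart.ext _ _ (Prod.ext rfl (perm_inv_apply _ _))
  right_inv _ := Dart.ext _ _ (Prod.ext rfl (perm_apply_inv _ _))

theorem dartRot_zpow (k : ℤ) (d : G.Dart) : ((E.dartRot ^ k) d).fst = d.fst ∧
    ((E.dartRot ^ k) d).snd = (E.rot d.fst ^ k) d.snd := by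
  induction k using Int.induction_on generalizing d with
  | zero => exact ⟨rfl, rfl⟩
  | succ k ih =>
    rw [zpow_add_one, zpow_add_one, Equiv.Perm.mul_apply, Equiv.Perm.mul_apply]
    exact ih (E.dartRot d)
  | pred k ih =>
    rw [zpow_sub_one, zpow_sub_one, Equiv.Perm.mul_apply, Equiv.Perm.mul_apply]
    exact ih (E.dartRot⁻¹ d)

/-- The embedding scheme of a rotation system. -/
def toScheme : EmbeddingScheme G where
  rot := E.dartRot
  rot_fst _ := rfl
  rot_cyclic d d' h := by
    obtain ⟨i, hi⟩ := (E.isCycleOn_rot d.fst).2 d.adj (show d'.snd ∈ G.neighborSet d.fst from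
      h ▸ d'.adj)
    obtain ⟨h1, h2⟩ := E.dartRot_zpow i d
    exact ⟨i, Dart.ext _ _ (Prod.ext (h1.trans h) (h2.trans hi))⟩
  sign e := Sym2.lift ⟨E.sgn, E.sgn_comm⟩ e.1

open Classical in
/-- Every embedding scheme comes from a rotation system. -/
theorem exists_toScheme_eq (S : EmbeddingScheme G) : ∃ E : RotationSystem G, E.toScheme = S := by
  have hinv : ∀ d, (S.rot⁻¹ d).fst = d.fst := fun d => by
    rw [← S.rot_fst (S.rot⁻¹ d), perm_apply_inv]
  have hzpow : ∀ (k : ℤ) d, ((S.rot ^ k) d).fst = d.fst := by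
    intro k
    induction k using Int.induction_on with
    | zero => exact fun _ => rfl
    | succ k ih => exact fun d => by rw [zpow_add_one, Equiv.Perm.mul_apply, ih, S.rot_fst]
    | pred k ih => exact fun d => by rw [zpow_sub_one, Equiv.Perm.mul_apply, ih, hinv]
  have hadj : ∀ d d' : G.Dart, d'.fst = d.fst → G.Adj d.fst d'.snd := fun d d' h => h ▸ d'.adj
  have heq : ∀ (u w : V) (h : G.Adj u w) (d : G.Dart) (hd : d.fst = u) (hw : d.snd = w),
      (⟨(u, w), h⟩ : G.Dart) = d := by
    rintro u w h ⟨⟨a, b⟩, hab⟩ rfl rfl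
    rfl
  let R : V → Equiv.Perm V := fun u =>
    { toFun := fun w => if h : G.Adj u w then (S.rot ⟨(u, w), h⟩).snd else w
      invFun := fun w => if h : G.Adj u w then (S.rot⁻¹ ⟨(u, w), h⟩).snd else w
      left_inv := fun w => by
        by_cases h : G.Adj u w
        · have h' : G.Adj u (S.rot ⟨(u, w), h⟩).snd := hadj ⟨(u, w), h⟩ _ (S.rot_fst _)
          simp only [dif_pos h, dif_pos h']
          rw [heq u _ h' _ (S.rot_fst _) rfl, perm_inv_apply]
        · simp only [dif_neg h]
      right_inv := fun w => by
        by_cases h : G.Adj u w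
        · have h' : G.Adj u (S.rot⁻¹ ⟨(u, w), h⟩).snd := hadj ⟨(u, w), h⟩ _ (hinv _)
          simp only [dif_pos h, dif_pos h']
          rw [heq u _ h' _ (hinv _) rfl, perm_apply_inv]
        · simp only [dif_neg h] }
  have hR : ∀ d : G.Dart, R d.fst d.snd = (S.rot d).snd := fun d => dif_pos d.adj
  have hRinv : ∀ d : G.Dart, (R d.fst)⁻¹ d.snd = (S.rot⁻¹ d).snd := fun d => dif_pos d.adj
  have hRz : ∀ (k : ℤ) (d : G.Dart), (R d.fst ^ k) d.snd = ((S.rot ^ k) d).snd := by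
    intro k
    induction k using Int.induction_on with
    | zero => exact fun _ => rfl
    | succ k ih =>
      intro d
      rw [zpow_add_one, zpow_add_one, Equiv.Perm.mul_apply, Equiv.Perm.mul_apply, hR, ← ih,
        S.rot_fst]
    | pred k ih =>
      intro d
      rw [zpow_sub_one, zpow_sub_one, Equiv.Perm.mul_apply, Equiv.Perm.mul_apply, hRinv, ← ih,
        hinv]
  let E : RotationSystem G :=
    { rot := R
      sgn := fun u w => if h : G.Adj u w then S.sign ⟨s(u, w), h⟩ else 1
      sgn_comm := fun u w => by
        by_cases h : G.Adj u w
        · rw [dif_pos h, dif_pos h.symm]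
          congr 2
          exact Sym2.eq_swap
        · rw [dif_neg h, dif_neg fun h' => h h'.symm]
      isCycleOn_rot := fun u => by
        refine ⟨⟨fun w hw => ?_, (R u).injective.injOn, fun w hw => ?_⟩, fun w hw w' hw' => ?_⟩
        · have := hadj ⟨(u, w), hw⟩ (S.rot ⟨(u, w), hw⟩) (S.rot_fst _)
          rw [← hR] at this
          exact this
        · have := hadj ⟨(u, w), hw⟩ (S.rot⁻¹ ⟨(u, w), hw⟩) (hinv _)
          rw [← hRinv] at this
          exact ⟨_, this, perm_apply_inv _ _⟩
        · obtain ⟨i, hi⟩ := S.rot_cyclic ⟨(u, w), hw⟩ ⟨(u, w'), hw'⟩ rfl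
          exact ⟨i, by rw [hRz i ⟨(u, w), hw⟩, hi]⟩
      rot_of_not_adj := fun u w h => dif_neg h }
  refine ⟨E, ?_⟩
  obtain ⟨Sr, h1, h2, Ss⟩ := S
  have e1 : E.dartRot = Sr := Equiv.ext fun d =>
    Dart.ext _ _ (Prod.ext (h1 d).symm (hR d))
  have e2 : (fun e : G.edgeSet => Sym2.lift ⟨E.sgn, E.sgn_comm⟩ e.1) = Ss := by
    funext ⟨e, he⟩
    induction e using Sym2.ind with
    | _ u w => exact dif_pos he
  unfold toScheme
  simp only [e1, e2]

/-- The flag of a rotation system that corresponds to a flag of its embedding scheme. -/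
def flag (x : E.toScheme.Flag) : V × V × ℤˣ := (x.1.fst, x.1.snd, x.2)

theorem flag_injective : Function.Injective E.flag := by
  rintro ⟨⟨⟨a, b⟩, h⟩, ε⟩ ⟨⟨⟨a', b'⟩, h'⟩, ε'⟩ h
  simp only [flag, Prod.mk.injEq] at h
  obtain ⟨rfl, rfl, rfl⟩ := h
  rfl

theorem adj_flag (x : E.toScheme.Flag) : G.Adj (E.flag x).1 (E.flag x).2.1 := x.1.adj

theorem flag_faceStep (x : E.toScheme.Flag) : E.flag (E.toScheme.faceStep x) = E.step (E.flag x) := by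
  obtain ⟨h1, h2⟩ := E.dartRot_zpow ((x.2 * E.sgn x.1.fst x.1.snd : ℤˣ) : ℤ) x.1.symm
  exact Prod.ext h1 (Prod.ext h2 rfl)

theorem flag_reverse (x : E.toScheme.Flag) : E.flag (E.toScheme.reverse x) = E.rev (E.flag x) := rfl

theorem isTriangular_toScheme [Fintype V] (hc : G.Connected) (hn : 3 ≤ Fintype.card V)
    (h : ∀ f : V × V × ℤˣ, G.Adj f.1 f.2.1 → (E.step ^ 3) f = f) : E.toScheme.IsTriangular := by
  refine ⟨hc, by rwa [Nat.card_eq_fintype_card], fun x => ?_⟩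
  have : Fact (Nat.Prime 3) := ⟨Nat.prime_three⟩
  -- The minimal period divides the prime three, and it is not one because a step moves the starting
  -- vertex.
  refine Function.minimalPeriod_eq_prime (E.flag_injective ?_) fun hx => ?_
  · rw [← h _ (E.adj_flag x)]
    simp only [Function.iterate_succ, Function.iterate_zero, Function.comp_apply, id_eq,
      flag_faceStep, pow_succ, pow_zero, one_mul, Equiv.Perm.mul_apply]
  · have := congrArg (fun y => (E.flag y).1) hx
    simp only [flag_faceStep, step_fst] at this
    exact (E.adj_flag x).ne this.symm

section Genus

variable [Fintype V]

/-- The functions on the faces, as labels of the flags. -/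
noncomputable def faceFun : (E.toScheme.Face → ZMod 2) →ₗ[ZMod 2] (V × V × ℤˣ → ZMod 2) := by
  classical
  exact
  { toFun := fun φ f => if h : G.Adj f.1 f.2.1 then
      φ (Sum.inl (Quotient.mk _ ((⟨(f.1, f.2.1), h⟩, f.2.2) : E.toScheme.Flag))) else 0
    map_add' := fun φ ψ => by
      ext f
      by_cases h : G.Adj f.1 f.2.1
      · simp only [Pi.add_apply, dif_pos h]
        rfl
      · simp only [Pi.add_apply, dif_neg h, add_zero]
    map_smul' := fun c φ => by
      ext f
      by_cases h : G.Adj f.1 f.2.1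
      · simp only [Pi.smul_apply, dif_pos h, RingHom.id_apply]
        rfl
      · simp only [Pi.smul_apply, dif_neg h, RingHom.id_apply, smul_zero] }

theorem faceFun_flag (φ : E.toScheme.Face → ZMod 2) (x : E.toScheme.Flag) :
    E.faceFun φ (E.flag x) = φ (Sum.inl (Quotient.mk _ x)) := dif_pos (E.adj_flag x)

theorem exists_flag_eq {f : V × V × ℤˣ} (h : G.Adj f.1 f.2.1) : ∃ x, E.flag x = f :=
  ⟨(⟨(f.1, f.2.1), h⟩, f.2.2), rfl⟩

theorem isFaceLabel_faceFun (φ : E.toScheme.Face → ZMod 2) : E.IsFaceLabel (E.faceFun φ) := by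
  have hrev : ∀ x, E.faceFun φ (E.flag (E.toScheme.reverse x)) = E.faceFun φ (E.flag x) := by
    intro x
    rw [faceFun_flag, faceFun_flag]
    congr 2
    exact Quotient.sound ⟨⟨_, Subgroup.subset_closure (Or.inr rfl)⟩, rfl⟩
  have hstep : ∀ x, E.faceFun φ (E.flag (E.toScheme.faceStep x)) = E.faceFun φ (E.flag x) := by
    intro x
    rw [faceFun_flag, faceFun_flag]
    congr 2
    exact Quotient.sound ⟨⟨_, Subgroup.subset_closure (Or.inl rfl)⟩, rfl⟩
  refine ⟨fun f hf => ?_, fun u x hux => ?_⟩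
  · obtain ⟨y, rfl⟩ := E.exists_flag_eq hf
    rw [← flag_reverse, hrev]
  · obtain ⟨y, hy⟩ := E.exists_flag_eq (f := (u, x, -1)) hux
    rw [jump, ← step_rev_neg_one, ← hy, ← flag_reverse, ← flag_faceStep, hstep, hrev]
    exact CharTwo.add_self_eq_zero _

theorem exists_faceFun_eq {L : V × V × ℤˣ → ZMod 2} (hL : E.IsFaceLabel L) :
    ∃ φ, ∀ f : V × V × ℤˣ, G.Adj f.1 f.2.1 → E.faceFun φ f = L f := by
  have key : ∀ σ ∈ Subgroup.closure {E.toScheme.faceStep, E.toScheme.reverse}, ∀ x,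
      L (E.flag (σ x)) = L (E.flag x) := by
    intro σ hσ
    induction hσ using Subgroup.closure_induction with
    | mem σ hσ =>
      intro x
      rcases hσ with rfl | rfl
      · rw [flag_faceStep, hL.step (E.adj_flag x)]
      · rw [flag_reverse, hL.rev (E.adj_flag x)]
    | one => exact fun _ => rfl
    | mul σ τ _ _ h1 h2 => exact fun x => by rw [Equiv.Perm.mul_apply, h1, h2]
    | inv σ _ h => exact fun x => by rw [← h, perm_apply_inv]
  have hl : ∀ x y : E.toScheme.Flag, MulAction.orbitRel
      (Subgroup.closure {E.toScheme.faceStep, E.toScheme.reverse}) _ x y →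
      L (E.flag x) = L (E.flag y) := by
    rintro x y ⟨⟨σ, hσ⟩, rfl⟩
    exact key σ hσ y
  -- The faces of isolated vertices carry no flags, so the value `0` there is arbitrary.
  refine ⟨Sum.elim (Quotient.lift (fun x => L (E.flag x)) hl) 0, fun f hf => ?_⟩
  obtain ⟨x, rfl⟩ := E.exists_flag_eq hf
  exact E.faceFun_flag _ x

end Genus
end RotationSystem
end SimpleGraph

/-! ### The Euler genus as the codimension of the boundaries in the cycle space -/

namespace SimpleGraph

section CycleSpace

open Module

variable {V : Type*} [Fintype V] (G : SimpleGraph V)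

open Classical in
/-- The incidence matrix over the field with two elements, with one column for every edge. -/
noncomputable def edgeMatrix : Matrix V G.edgeSet (ZMod 2) := Matrix.of fun u e => if u ∈ e.1 then 1 else 0

open Classical in
/-- Functions on the edges as functions of two vertices. -/
noncomputable def edgeFun : (G.edgeSet → ZMod 2) →ₗ[ZMod 2] (V → V → ZMod 2) where
  toFun x u w := if h : G.Adj u w then x ⟨s(u, w), h⟩ else 0
  map_add' x y := by
    ext u w
    by_cases h : G.Adj u w
    · simp only [Pi.add_apply, dif_pos h]
    · simp only [Pi.add_apply, dif_neg h, add_zero]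
  map_smul' c x := by
    ext u w
    by_cases h : G.Adj u w
    · simp only [Pi.smul_apply, dif_pos h, RingHom.id_apply]
    · simp only [Pi.smul_apply, dif_neg h, RingHom.id_apply, smul_zero]

theorem edgeFun_of_adj (x : G.edgeSet → ZMod 2) {u w : V} (h : G.Adj u w) :
    edgeFun G x u w = x ⟨s(u, w), h⟩ := dif_pos h

theorem edgeFun_of_not_adj (x : G.edgeSet → ZMod 2) {u w : V} (h : ¬ G.Adj u w) :
    edgeFun G x u w = 0 := dif_neg h

theorem edgeFun_injective : Function.Injective (edgeFun G) := by
  intro x y h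
  ext ⟨e, he⟩
  induction e using Sym2.ind with
  | _ u w => rw [← edgeFun_of_adj G x he, h, edgeFun_of_adj G y he]

variable [Fintype G.edgeSet]

theorem sum_edgeFun (x : G.edgeSet → ZMod 2) (u : V) :
    ∑ w, edgeFun G x u w = (edgeMatrix G).mulVec x u := by
  classical
  let e : {w // G.Adj u w} → G.edgeSet := fun w => ⟨s(u, w.1), w.2⟩
  have he : Function.Injective e := fun w w' h => by
    have h' := congrArg Subtype.val h
    exact Subtype.ext (Sym2.congr_right.1 h')
  rw [Matrix.mulVec, dotProduct,
    ← Fintype.sum_of_injective _ Subtype.val_injective (fun w : {w // G.Adj u w} => x (e w)),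
    ← Fintype.sum_of_injective e he (fun w : {w // G.Adj u w} => x (e w))]
  · rintro ⟨a, ha⟩ h
    rw [edgeMatrix, Matrix.of_apply, if_neg, zero_mul]
    intro hu
    obtain ⟨w, rfl⟩ := hu
    exact h ⟨⟨w, ha⟩, rfl⟩
  · intro w
    rw [edgeMatrix, Matrix.of_apply, if_pos (Sym2.mem_mk_left _ _), one_mul]
  · intro w h
    exact edgeFun_of_not_adj G x fun h' => h ⟨⟨w, h'⟩, rfl⟩
  · intro w
    exact (edgeFun_of_adj G x w.2).symm

theorem map_ker_edgeMatrix :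
    (LinearMap.ker (edgeMatrix G).mulVecLin).map (edgeFun G) = cycleSpace G := by
  ext z
  constructor
  · rintro ⟨x, hx, rfl⟩
    refine ⟨fun u w => ?_, fun u w h => edgeFun_of_not_adj G x h, fun u => ?_⟩
    · by_cases h : G.Adj u w
      · rw [edgeFun_of_adj G x h, edgeFun_of_adj G x h.symm]
        congr 2
        exact Sym2.eq_swap
      · rw [edgeFun_of_not_adj G x h, edgeFun_of_not_adj G x fun h' => h h'.symm]
    · rw [sum_edgeFun]
      exact congrFun hx u
  · rintro ⟨h1, h2, h3⟩
    let x : G.edgeSet → ZMod 2 := fun e => Sym2.lift ⟨z, h1⟩ e.1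
    have hx : edgeFun G x = z := by
      ext u w
      by_cases h : G.Adj u w
      · exact edgeFun_of_adj G x h
      · rw [edgeFun_of_not_adj G x h, h2 u w h]
    refine ⟨x, ?_, hx⟩
    rw [SetLike.mem_coe, LinearMap.mem_ker]
    ext u
    rw [Matrix.mulVecLin_apply, ← sum_edgeFun, hx, h3]
    rfl

theorem transpose_edgeMatrix_mulVec (y : V → ZMod 2) {u w : V} (h : G.Adj u w) :
    (edgeMatrix G).transpose.mulVec y ⟨s(u, w), h⟩ = y u + y w := by
  classical
  rw [Matrix.mulVec, dotProduct, ← Finset.sum_pair h.ne (f := y)]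
  have : ∀ v, (edgeMatrix G).transpose ⟨s(u, w), h⟩ v * y v
      = if v ∈ ({u, w} : Finset V) then y v else 0 := by
    intro v
    simp only [edgeMatrix, Matrix.transpose_apply, Matrix.of_apply, Sym2.mem_iff, Finset.mem_insert,
      Finset.mem_singleton, ite_mul, one_mul, zero_mul]
  rw [Finset.sum_congr rfl fun v _ => this v, Finset.sum_ite_mem, Finset.univ_inter]

/-- A vertex function is killed by the coboundary when it is constant along edges, that is, when it
is a function of the component. -/
theorem ker_transpose_edgeMatrix : LinearMap.ker (edgeMatrix G).transpose.mulVecLin =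
    LinearMap.range (LinearMap.funLeft (ZMod 2) (ZMod 2) G.connectedComponentMk) := by
  ext y
  constructor
  · intro hy
    have hadj : ∀ u w, G.Adj u w → y u = y w := fun u w h => by
      rw [← RotationSystem.zmod_two_add_eq_zero, ← transpose_edgeMatrix_mulVec G y h]
      exact congrFun hy _
    refine ⟨fun c => y c.out, ?_⟩
    ext u
    have hr : G.Reachable u (G.connectedComponentMk u).out :=
      ConnectedComponent.exact (Quot.out_eq (G.connectedComponentMk u)).symm
    have : (G.connectedComponentMk u).out ∈ {v | y v = y u} :=
      mem_of_reachable (fun a ha b hab => (hadj a b hab).symm.trans ha) hr rfl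
    exact this
  · rintro ⟨g, rfl⟩
    rw [LinearMap.mem_ker]
    ext ⟨e, he⟩
    induction e using Sym2.ind with
    | _ u w =>
      refine (transpose_edgeMatrix_mulVec G _ he).trans ?_
      have : G.connectedComponentMk u = G.connectedComponentMk w :=
        ConnectedComponent.sound he.reachable
      simp only [LinearMap.funLeft_apply, this]
      exact CharTwo.add_self_eq_zero _

/-- The cyclomatic number. -/
theorem finrank_cycleSpace : finrank (ZMod 2) (cycleSpace G) + Fintype.card V =
    Fintype.card G.edgeSet + Nat.card G.ConnectedComponent := by
  classical
  -- The cycle space is the kernel of the incidence matrix. Its rank, being that of the transpose,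
  -- is the number of vertices minus the number of components.
  have h1 := LinearMap.finrank_range_add_finrank_ker (edgeMatrix G).mulVecLin
  have h2 := LinearMap.finrank_range_add_finrank_ker (edgeMatrix G).transpose.mulVecLin
  have h3 := (edgeMatrix G).rank_transpose
  have h4 := LinearEquiv.finrank_eq (Submodule.equivMapOfInjective (edgeFun G)
    (edgeFun_injective G) (LinearMap.ker (edgeMatrix G).mulVecLin))
  rw [map_ker_edgeMatrix] at h4
  have : Fintype G.ConnectedComponent := Fintype.ofFinite _
  rw [ker_transpose_edgeMatrix, LinearMap.finrank_range_of_inj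
    (LinearMap.funLeft_injective_of_surjective _ _ _
      (show Function.Surjective G.connectedComponentMk from Quot.mk_surjective)), finrank_fintype_fun_eq_card,
    finrank_fintype_fun_eq_card] at h2
  rw [finrank_fintype_fun_eq_card] at h1
  rw [Matrix.rank, Matrix.rank] at h3
  rw [Nat.card_eq_fintype_card]
  omega

end CycleSpace

namespace RotationSystem

open Module

variable {V : Type*} [Fintype V] {G : SimpleGraph V} (E : RotationSystem G)

/-- The connected component of a face. -/
def faceComponent : E.toScheme.Face → G.ConnectedComponent :=
  Sum.elim (Quotient.lift (fun x => G.connectedComponentMk x.1.fst) (by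
    have key : ∀ σ ∈ Subgroup.closure {E.toScheme.faceStep, E.toScheme.reverse}, ∀ x,
        G.connectedComponentMk (σ x).1.fst = G.connectedComponentMk x.1.fst := by
      intro σ hσ
      induction hσ using Subgroup.closure_induction with
      | mem σ hσ =>
        intro x
        refine ConnectedComponent.sound ?_
        rcases hσ with rfl | rfl
        · have := congrArg Prod.fst (E.flag_faceStep x)
          exact (show (E.toScheme.faceStep x).1.fst = x.1.snd from this) ▸ x.1.adj.symm.reachable
        · exact x.1.adj.symm.reachable
      | one => exact fun _ => rfl
      | mul σ τ _ _ h1 h2 => exact fun x => by rw [Equiv.Perm.mul_apply, h1, h2]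
      | inv σ _ h => exact fun x => by rw [← h, perm_apply_inv]
    rintro x y ⟨⟨σ, hσ⟩, rfl⟩
    exact key σ hσ y)) fun v => G.connectedComponentMk v.1

theorem faceComponent_surjective : Function.Surjective E.faceComponent := by
  intro c
  induction c using ConnectedComponent.ind with
  | _ v =>
    by_cases h : ∃ w, G.Adj v w
    · obtain ⟨w, h⟩ := h
      exact ⟨Sum.inl (Quotient.mk _ (⟨(v, w), h⟩, 1)), rfl⟩
    · exact ⟨Sum.inr ⟨v, fun w hw => h ⟨w, hw⟩⟩, rfl⟩

theorem eq_of_reachable_of_isolated {v w : V} (hv : ∀ x, ¬ G.Adj v x) (h : G.Reachable v w) :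
    v = w := by
  have : w ∈ ({v} : Set V) := mem_of_reachable (by
    rintro a rfl b hab
    exact absurd hab (hv b)) h rfl
  exact this.symm

/-- A set of faces without boundary is constant on the faces of each component; an isolated vertex
has its only face to itself. -/
theorem ker_bdy_comp_faceFun : LinearMap.ker (bdy G ∘ₗ E.faceFun) =
    LinearMap.range (LinearMap.funLeft (ZMod 2) (ZMod 2) E.faceComponent) := by
  classical
  ext φ
  constructor
  · intro hφ
    have hφ : bdy G (E.faceFun φ) = 0 := hφ
    have key : ∀ F F', E.faceComponent F = E.faceComponent F' → φ F = φ F' := by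
      rintro (x | v) (y | v') h
      · induction x using Quotient.ind with | _ x
        induction y using Quotient.ind with | _ y
        have h := ConnectedComponent.exact h
        refine (E.faceFun_flag φ x).symm.trans (Eq.trans ?_ (E.faceFun_flag φ y))
        exact (E.isFaceLabel_faceFun φ).eq_of_reachable hφ h x.1.adj y.1.adj _ _
      · induction x using Quotient.ind with | _ x
        have h := eq_of_reachable_of_isolated v'.2 (ConnectedComponent.exact h).symm
        exact absurd x.1.adj (h ▸ v'.2 _)
      · induction y using Quotient.ind with | _ y
        have h := eq_of_reachable_of_isolated v.2 (ConnectedComponent.exact h)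
        exact absurd y.1.adj (h ▸ v.2 _)
      · rw [Subtype.ext (eq_of_reachable_of_isolated v.2 (ConnectedComponent.exact h))]
    refine ⟨fun c => φ (Function.surjInv E.faceComponent_surjective c), ?_⟩
    ext F
    exact key _ _ (Function.surjInv_eq _ _)
  · rintro ⟨g, rfl⟩
    change bdy G (E.faceFun _) = 0
    ext u w
    by_cases h : G.Adj u w
    · rw [bdy_apply_of_adj h]
      exact (congrArg₂ (· + ·) (E.faceFun_flag _ (⟨(u, w), h⟩, 1))
        (E.faceFun_flag _ (⟨(u, w), h⟩, -1))).trans (CharTwo.add_self_eq_zero _)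
    · exact bdy_apply_of_not_adj h _

theorem range_bdy_comp_faceFun : LinearMap.range (bdy G ∘ₗ E.faceFun) = E.boundarySpace := by
  ext z
  constructor
  · rintro ⟨φ, rfl⟩
    exact E.mem_boundarySpace.2 ⟨_, E.isFaceLabel_faceFun φ, rfl⟩
  · intro hz
    obtain ⟨L, hL, rfl⟩ := E.mem_boundarySpace.1 hz
    obtain ⟨φ, hφ⟩ := E.exists_faceFun_eq hL
    refine ⟨φ, ?_⟩
    ext u w
    by_cases h : G.Adj u w
    · rw [LinearMap.comp_apply, bdy_apply_of_adj h, bdy_apply_of_adj h, hφ _ h, hφ _ h]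
    · rw [LinearMap.comp_apply, bdy_apply_of_not_adj h, bdy_apply_of_not_adj h]

instance : Finite E.toScheme.Flag := Finite.of_injective _ E.flag_injective

instance : Finite E.toScheme.Face :=
  inferInstanceAs (Finite (Quotient _ ⊕ _))

/-- Rank-nullity for the boundary map on functions of the faces: the image is the boundary space and
the kernel has one dimension for each component. -/
theorem card_face : Nat.card E.toScheme.Face =
    finrank (ZMod 2) E.boundarySpace + Nat.card G.ConnectedComponent := by
  have : Fintype E.toScheme.Face := Fintype.ofFinite _
  have : Fintype G.ConnectedComponent := Fintype.ofFinite _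
  have h := LinearMap.finrank_range_add_finrank_ker (bdy G ∘ₗ E.faceFun)
  rw [ker_bdy_comp_faceFun, range_bdy_comp_faceFun, LinearMap.finrank_range_of_inj
    (LinearMap.funLeft_injective_of_surjective _ _ _ E.faceComponent_surjective),
    finrank_fintype_fun_eq_card, finrank_fintype_fun_eq_card] at h
  rw [Nat.card_eq_fintype_card, Nat.card_eq_fintype_card, h]

/-- The Euler genus is the dimension of the first homology of the surface over the field with two
elements. -/
theorem eulerGenus_toScheme : E.toScheme.eulerGenus =
    finrank (ZMod 2) (cycleSpace G) - finrank (ZMod 2) E.boundarySpace := by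
  have : Fintype G.edgeSet := Fintype.ofFinite _
  have h := finrank_cycleSpace G
  rw [EmbeddingScheme.eulerGenus, card_face, Nat.card_eq_fintype_card (α := V),
    Nat.card_eq_fintype_card (α := G.edgeSet)]
  push_cast
  omega

theorem eulerGenus_eq_zero_iff : E.toScheme.eulerGenus = 0 ↔ E.IsSpherical := by
  rw [eulerGenus_toScheme]
  constructor
  · intro h
    rw [IsSpherical, Submodule.eq_of_le_of_finrank_eq E.boundarySpace_le (by omega)]
  · intro h
    rw [le_antisymm h E.boundarySpace_le, sub_self]

/-- A vector space over the field with two elements has dimension at most one exactly when among any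
two vectors and their sum one is zero; here this is applied to the cycle space modulo boundaries. -/
theorem eulerGenus_le_one_iff :
    E.toScheme.eulerGenus = 0 ∨ E.toScheme.eulerGenus = 1 ↔ E.IsProjective := by
  have hle := E.boundarySpace_le
  have hfr := Submodule.finrank_mono hle
  rw [eulerGenus_toScheme]
  constructor
  · intro h z hz z' hz'
    by_cases hzB : z ∈ E.boundarySpace
    · exact Or.inl hzB
    have hsup : E.boundarySpace ⊔ Submodule.span (ZMod 2) {z} ≤ cycleSpace G :=
      sup_le hle ((Submodule.span_singleton_le_iff_mem _ _).2 hz)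
    have hlt : E.boundarySpace < E.boundarySpace ⊔ Submodule.span (ZMod 2) {z} := by
      refine lt_of_le_of_ne le_sup_left fun h' => hzB ?_
      rw [h']
      exact Submodule.mem_sup_right (Submodule.mem_span_singleton_self z)
    have h1 := Submodule.finrank_lt_finrank_of_lt hlt
    have h2 := Submodule.eq_of_le_of_finrank_le hsup (by omega)
    rw [← h2] at hz'
    obtain ⟨b, hb, c, hc, rfl⟩ := Submodule.mem_sup.1 hz'
    obtain ⟨k, rfl⟩ := Submodule.mem_span_singleton.1 hc
    rcases zmod_two_eq k with rfl | rfl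
    · right; left
      rwa [zero_smul, add_zero]
    · right; right
      rw [one_smul, add_comm b, ← add_assoc, add_self_eq_zero_of_zmod_two, zero_add]
      exact hb
  · intro h
    by_cases hs : E.IsSpherical
    · left
      rw [le_antisymm hs hle, sub_self]
    · obtain ⟨z, hz, hzB⟩ := SetLike.not_le_iff_exists.1 hs
      have hsup : cycleSpace G ≤ E.boundarySpace ⊔ Submodule.span (ZMod 2) {z} := by
        intro z' hz'
        rcases h z hz z' hz' with h' | h' | h'
        · exact absurd h' hzB
        · exact Submodule.mem_sup_left h'
        · have : z' = (z + z') + z := by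
            rw [add_comm z, add_assoc, add_self_eq_zero_of_zmod_two, add_zero]
          rw [this]
          exact Submodule.add_mem_sup h' (Submodule.mem_span_singleton_self z)
      have h1 := Submodule.finrank_mono hsup
      have h2 := Submodule.finrank_add_le_finrank_add_finrank E.boundarySpace
        (Submodule.span (ZMod 2) {z})
      have h3 := finrank_span_singleton (K := ZMod 2) (v := z) fun h' =>
        hzB (h' ▸ E.boundarySpace.zero_mem)
      omega

end RotationSystem

variable {V : Type*} [Fintype V] {G : SimpleGraph V}

theorem isPlanar_iff : G.IsPlanar ↔ ∃ E : RotationSystem G, E.IsSpherical := by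
  constructor
  · rintro ⟨S, hS⟩
    obtain ⟨E, rfl⟩ := RotationSystem.exists_toScheme_eq S
    exact ⟨E, E.eulerGenus_eq_zero_iff.1 hS⟩
  · rintro ⟨E, hE⟩
    exact ⟨E.toScheme, E.eulerGenus_eq_zero_iff.2 hE⟩

theorem isProjectivePlanar_iff : G.IsProjectivePlanar ↔ ∃ E : RotationSystem G, E.IsProjective := by
  constructor
  · rintro ⟨S, hS⟩
    obtain ⟨E, rfl⟩ := RotationSystem.exists_toScheme_eq S
    exact ⟨E, E.eulerGenus_le_one_iff.1 hS⟩
  · rintro ⟨E, hE⟩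
    exact ⟨E.toScheme, E.eulerGenus_le_one_iff.2 hE⟩

end SimpleGraph

/-! ### Graphs with at most three vertices, and the proof of the proposition -/

namespace SimpleGraph

section Small

variable {V : Type*} [Fintype V] {G : SimpleGraph V}

theorem exists_rotationSystem (G : SimpleGraph V) : Nonempty (RotationSystem G) := by
  classical
  have key : ∀ u, ∃ σ : Equiv.Perm V, σ.IsCycleOn (G.neighborSet u) ∧ ∀ w, ¬ G.Adj u w → σ w = w := by
    intro u
    obtain ⟨σ, h1, h2⟩ := (G.neighborSet u).toFinset.exists_cycleOn
    rw [Set.coe_toFinset] at h1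
    refine ⟨σ, h1, fun w hw => ?_⟩
    by_contra h
    exact hw (Set.mem_toFinset.1 (h2 (Equiv.Perm.mem_support.2 h)))
  choose R h1 h2 using key
  exact ⟨⟨R, fun _ _ => 1, fun _ _ => rfl, h1, h2⟩⟩

theorem exists_third_of_mem_cycleSpace {z : V → V → ZMod 2} (hz : z ∈ cycleSpace G) {u w : V}
    (h : z u w ≠ 0) : ∃ x, x ≠ w ∧ z u x ≠ 0 := by
  by_contra! h'
  exact h ((Finset.sum_eq_single_of_mem w (Finset.mem_univ w) fun x _ hx => h' x hx).symm.trans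
    (hz.2.2 u))

theorem eq_or_eq_of_card_le_three (hn : Fintype.card V ≤ 3) {a b c : V} (hab : a ≠ b) (hbc : b ≠ c)
    (hca : c ≠ a) (x : V) : x = a ∨ x = b ∨ x = c := by
  classical
  by_contra! h
  have h1 : ({x, a, b, c} : Finset V).card = 4 := by
    rw [Finset.card_insert_of_notMem (by simp [h]), Finset.card_insert_of_notMem
      (by simp [hab, hca.symm]), Finset.card_pair hbc]
  have h2 := Finset.card_le_univ ({x, a, b, c} : Finset V)
  omega

theorem cycleSpace_eq_bot (hn : Fintype.card V ≤ 3)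
    (h : ∀ a b c, G.Adj a b → G.Adj b c → ¬ G.Adj c a) : cycleSpace G = ⊥ := by
  rw [eq_bot_iff]
  intro z hz
  rw [Submodule.mem_bot]
  have hadj : ∀ u w, z u w ≠ 0 → G.Adj u w := fun u w h' => by
    by_contra hn
    exact h' (hz.2.1 u w hn)
  ext u w
  by_contra huw
  have huw : z u w ≠ 0 := huw
  obtain ⟨x, hxw, hx⟩ := exists_third_of_mem_cycleSpace hz huw
  obtain ⟨y, hyu, hy⟩ := exists_third_of_mem_cycleSpace hz (u := w) (w := u) (hz.1 u w ▸ huw)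
  have h1 := hadj _ _ huw
  have h2 := hadj _ _ hx
  have h3 := hadj _ _ hy
  obtain rfl : y = x := ((eq_or_eq_of_card_le_three hn h1.ne hxw.symm h2.ne.symm y).resolve_left
    hyu).resolve_left h3.ne.symm
  exact h u w y h1 h3 h2.symm

theorem isPlanar_of_card_le_three (hn : Fintype.card V ≤ 3) : G.IsPlanar := by
  classical
  rw [isPlanar_iff]
  by_cases h : ∃ a b c, G.Adj a b ∧ G.Adj b c ∧ G.Adj c a
  -- Without one edge of the triangle there are no cycles, so any rotation system is spherical and
  -- its connected graph has a single face, into which the edge can be put back.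
  · obtain ⟨u, w, t, huw, hwt, htu⟩ := h
    have hK := isAddEdge_deleteEdges huw
    obtain ⟨T⟩ := exists_rotationSystem (G.deleteEdges {s(u, w)})
    have hbot : cycleSpace (G.deleteEdges {s(u, w)}) = ⊥ := by
      refine cycleSpace_eq_bot hn fun a b c hab hbc hca => ?_
      have key := eq_or_eq_of_card_le_three hn hab.ne hbc.ne hca.ne
      have h1 := hK.not_adj
      rcases key u with rfl | rfl | rfl <;> rcases key w with rfl | rfl | rfl <;>
        first | exact huw.ne rfl | exact h1 hab | exact h1 hab.symm | exact h1 hbc |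
          exact h1 hbc.symm | exact h1 hca | exact h1 hca.symm
    have hT : T.IsSpherical := by
      rw [RotationSystem.IsSpherical, hbot]
      exact bot_le
    have hut : (G.deleteEdges {s(u, w)}).Adj u t := (hK.adj_iff u t).1 htu.symm |>.resolve_right
      (by rintro (⟨-, h⟩ | ⟨h, -⟩)
          · exact hwt.ne h.symm
          · exact huw.ne h)
    have hwt' : (G.deleteEdges {s(u, w)}).Adj w t := (hK.adj_iff w t).1 hwt |>.resolve_right
      (by rintro (⟨h, -⟩ | ⟨-, h⟩)
          · exact huw.ne h.symm
          · exact htu.ne h)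
    have hsame : T.SameFace (u, t, 1) (w, t, 1) :=
      T.sameFace_of_forall_isFaceLabel fun α hα => by
        have h0 := T.boundarySpace_le (T.mem_boundarySpace.2 ⟨α, hα, rfl⟩)
        rw [hbot, Submodule.mem_bot] at h0
        exact hα.eq_of_reachable h0 (hut.reachable.trans hwt'.symm.reachable) hut hwt' _ _
    obtain ⟨L, hL, -⟩ := T.exists_isLink hsame
    obtain ⟨S, hS, -⟩ := T.exists_addEdge_of_isLink hK hL (T.adj_corner (f := (u, t, 1)) hut)
      (T.adj_corner (f := (w, t, 1)) hwt')
    exact ⟨S, hS hT⟩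
  · push Not at h
    obtain ⟨T⟩ := exists_rotationSystem G
    refine ⟨T, ?_⟩
    rw [RotationSystem.IsSpherical, cycleSpace_eq_bot hn h]
    exact bot_le

end Small

section Main

variable {V : Type*} [Fintype V] [DecidableEq V] {G H : SimpleGraph V}

open RotationSystem

theorem exists_isEdgeMaximal {E : RotationSystem G} (hE : E.IsProjective) :
    ∃ H : SimpleGraph V, G ≤ H ∧ IsEdgeMaximal H ∧ ∃ E : RotationSystem H, E.IsProjective := by
  obtain ⟨H, hGH, ⟨E', hE'⟩, hmax⟩ := (Set.toFinite
    {H : SimpleGraph V | ∃ E : RotationSystem H, E.IsProjective}).exists_le_maximal ⟨E, hE⟩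
  refine ⟨H, hGH, fun u w H' h S hS => ?_, E', hE'⟩
  exact h.not_adj (hmax ⟨S, hS⟩ h.le h.adj)

theorem RotationSystem.IsEdgeMaximal.isTriangulation (hmax : IsEdgeMaximal H) {E : RotationSystem H}
    (hE : E.IsProjective) (hn : 6 ≤ Fintype.card V) :
    H.IsPlaneTriangulation ∨ H.IsProjectiveTriangulation := by
  have : Nonempty V := Fintype.card_pos_iff.1 (by omega)
  have hc : H.Connected := ⟨hmax.preconnected hE⟩
  -- A spherical embedding has to be preferred when one exists: the proof that the two sides of an
  -- edge are different faces needs an embedding of least genus.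
  by_cases h : ∃ S : RotationSystem H, S.IsSpherical
  · obtain ⟨S, hS⟩ := h
    have hs := hmax.isSaturated hS.isProjective (by omega) (Or.inl hS)
    exact Or.inl ⟨S.toScheme, S.isTriangular_toScheme hc (by omega) fun f hf =>
      hs.step_pow_three_of_isSpherical hS hf, S.eulerGenus_eq_zero_iff.2 hS⟩
  · push Not at h
    have hs := hmax.isSaturated hE (by omega) (Or.inr h)
    refine Or.inr ⟨E.toScheme, E.isTriangular_toScheme hc (by omega) fun f hf =>
      hs.step_pow_three hn hf, ?_⟩
    exact (E.eulerGenus_le_one_iff.2 hE).resolve_left fun h0 => h E (E.eulerGenus_eq_zero_iff.1 h0)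

end Main

theorem isPlanar_induce_compl_pair {V : Type*} [Fintype V] (hn : Fintype.card V ≤ 5)
    (G : SimpleGraph V) {u v : V} (h : u ≠ v) : (G.induce ({u, v}ᶜ : Set V)).IsPlanar := by
  classical
  refine isPlanar_of_card_le_three ?_
  rw [Fintype.card_compl_set, Set.card_insert _ (by simpa using h), Set.card_singleton]
  omega

end SimpleGraph

theorem proposition4p1 {V : Type*} [Fintype V] (hV : 2 ≤ Fintype.card V)
    (G : SimpleGraph V) [DecidableRel G.Adj] (hG : G.IsProjectivePlanar) :
    (∃ H : SimpleGraph V, G ≤ H ∧ (H.IsPlaneTriangulation ∨ H.IsProjectiveTriangulation)) ∨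
    (∃ u v : V, u ≠ v ∧ G.degree u ≤ 3 ∧ G.degree v ≤ 3 ∧
      (G.induce ({u, v}ᶜ : Set V)).IsPlanar) ∨
    (∃ u v : V, G.Adj u v ∧ G.degree u ≤ 4 ∧ G.degree v ≤ 4 ∧
      (G.induce ({u, v}ᶜ : Set V)).IsPlanar) := by
  classical
  rcases Nat.lt_or_ge (Fintype.card V) 6 with hn | hn
  · right
    -- With at most five vertices, two adjacent vertices give (c); in a graph without edges any two
    -- vertices give (b).
    by_cases h : ∃ u v, G.Adj u v
    · obtain ⟨u, v, h⟩ := h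
      have hu := G.degree_lt_card_verts u
      have hv := G.degree_lt_card_verts v
      exact Or.inr ⟨u, v, h, by omega, by omega,
        SimpleGraph.isPlanar_induce_compl_pair (by omega) G h.ne⟩
    · push Not at h
      obtain ⟨u, v, huv⟩ := Fintype.exists_pair_of_one_lt_card (α := V) (by omega)
      have hdeg : ∀ w, G.degree w = 0 := fun w => by
        rw [SimpleGraph.degree, Finset.card_eq_zero, Finset.eq_empty_iff_forall_notMem]
        exact fun x hx => h w x ((G.mem_neighborFinset w x).1 hx)
      exact Or.inl ⟨u, v, huv, by rw [hdeg]; omega, by rw [hdeg]; omega,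
        SimpleGraph.isPlanar_induce_compl_pair (by omega) G huv⟩
  · left
    obtain ⟨E, hE⟩ := SimpleGraph.isProjectivePlanar_iff.1 hG
    obtain ⟨H, hGH, hmax, E', hE'⟩ := SimpleGraph.exists_isEdgeMaximal hE
    exact ⟨H, hGH, hmax.isTriangulation hE' hn⟩
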